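/- **Configurations.** A near-triangulation is a finite, non-null, connected simple graph drawn in the plane such that every finite region is a triangle. A configuration $K$ is a near-triangulation $G(K)$ with a map $\gamma_K:V(G(K))\to\{5,6,\dots\}$ such that (i) for each vertex $v$, $G(K)\setminus v$ has at most two components, and if it has two then $\gamma_K(v)=d(v)+2$; (ii) $\gamma_K(v)=d(v)$ if $v$ is not incident with the infinite region, and $\gamma_K(v)>d(v)$ otherwise; (iii) $\sum(\gamma_K(v)-d(v)-1)\ge 2$, summed over the vertices $v$ incident with the infinite region for which $G(K)\setminus v$ is connected. Isomorphisms of configurations are homeomorphisms of the plane preserving $\gamma$; they may preserve or reverse the orientation. A cartwheel $W$ with hub of degree $d\ge5$ is a configuration with the following vertices: the hub $0$; spokes $1,\dots,d$, in clockwise order around the hub; hats $d+1,\dots,2d$, with $d+i$ adjacent to the spokes $i,i+1$ (cyclically); and for each spoke $i$ of degree $k=\gamma_W(i)$ the fans $2d+i,3d+i,\dots,(k-4)d+i$, so that the neighbours of $i$ other than $0$ and spokes form a path: the hat between $i-1$ and $i$, the fans in this order, the hat $d+i$. Here $\gamma_W(0)=d$. A configuration $K$ appears in $W$ if $G(K)$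 is an induced subdrawing of $G(W)$, each finite region of $G(K)$ is a region of $G(W)$, and $\gamma_K=\gamma_W$ on $V(G(K))$. Let $\mathcal G$ be any set of configurations $K$ with $\gamma_K\le 11$. A configuration is good if it is isomorphic to a member of $\mathcal G$. **Passes and rules.** A pass $P=(K,r,s,t)$ consists of a configuration $K$, an integer $r=r(P)>0$ and adjacent vertices $s=s(P)$, $t=t(P)$ of $K$ such that every vertex is at distance at most $2$ in $G(K)$ from $s$ and from $t$; it appears in $W$ if $K$ does. A rule $(G,\beta,\delta,r,s,t)$ consists of a near-triangulation $G$ with $G\setminus v$ connected for all $v$, maps $\beta:V(G)\to\mathbb Z_{>0}$, $\delta:V(G)\to\mathbb Z_{>0}\cup\{\infty\}$ with $\beta\le\delta$, an integer $r>0$ and adjacent vertices $s,t$ such that every vertex is joined to $s$, and also to $t$, by a path of length at most $2$ whose internal vertex $w$, if any, has $\delta(w)\le 8$. A pass obeys the rule if it is isomorphic to some $(K,r,s,t)$ with $G(K)=G$ and $\beta\le\gamma_K\le\delta$; it orientation-obeys (anti-orientation-obeys) the rule if the isomorphism can be chosen orientation-preserving (-reversing). Let $\mathcal P$ be any finite set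 of rules. Write $P\sim\mathcal P$ if $P$ obeys a member of $\mathcal P$, and for a cartwheel $W$ with hub of degree $d$ put $$N_{\mathcal P}(W)=10(6-d)+\sum_{P\sim\mathcal P,\ t(P)=0}r(P)-\sum_{P\sim\mathcal P,\ s(P)=0}r(P),$$ the sums being over passes $P$ that appear in $W$. A rule $R$ is coherent if (i) whenever a pass $P$ obeying $R$ appears in a cartwheel $W$ with the hub as source $s(P)$ or sink $t(P)$ and contains a fan, it contains the spoke $u$ adjacent to that fan, and $\beta(u')=\delta(u')$ for the vertex $u'$ of $R$ corresponding to $u$; (ii) if some pass orientation-obeys and anti-orientation-obeys $R$, then every pass that orientation-obeys $R$ anti-orientation-obeys $R$. In the former case $R$ is called symmetric. Assume that $\mathcal R'$ is a finite family of coherent rules, with $\beta(v)\in\{5,6,7,8,9\}$ and $\delta(v)\in\{5,6,7,8,\infty\}$ for all vertices $v$, that has the same net effect as $\mathcal P$: every pass $P\sim\mathcal P$ obeys exactly one rule of the family, and every other pass obeys none. Let $\mathcal R$ be the family obtained from $\mathcal R'$ by adding the mirror image of each non-symmetric rule, replacing each rule of value $r$ by $r$ copies of value $1$, and replacing $\delta$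 by $\min\{\delta,12\}$. **Axles and outlets.** Let $7\le d\le 11$. An axle of degree $d$ is a pair $A=(l_A,u_A)$ of maps on $\{1,\dots,5d\}$ with $l_A(i)\in\{5,6,7,8,9\}$, $u_A(i)\in\{5,6,7,8,12\}$, $l_A(i)\le u_A(i)$, and such that for $1\le i\le d$ with $l_A(i)\ne u_A(i)$ we have $(l_A(j),u_A(j))=(5,12)$ for $j=2d+i,3d+i,4d+i$. A cartwheel $W$ with hub of degree $d$ is compatible with $A$ if $l_A(n)\le\gamma_W(n)\le u_A(n)$ for $1\le n\le 2d$ and for all $n=jd+i$ with $1\le i\le d$, $l_A(i)=u_A(i)$, $2\le j\le l_A(i)-4$. The axle $A$ is reducible if a good configuration appears in every cartwheel compatible with $A$, and successful if for every cartwheel $W$ compatible with $A$ either a good configuration appears in $W$ or $N_{\mathcal P}(W)\le0$. An outlet of degree $d$ is a pair $T=(M,r)$ of a finite set $M$ of triples $(p,l,u)$ with $1\le p\le5d$, $l\in\{5,\dots,9\}$, $u\in\{5,6,7,8,12\}$, $l\le u$, and an integer $r=r(T)\ne0$, such that if $(p,l,u)\in M$, $p=jd+i$, $2\le j\le4$,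 $1\le i\le d$, then $(i,l',l')\in M$ for some $l'\ge j+4$. It is reduced if the $p$'s are distinct and $(l,u)\ne(5,12)$ throughout. For $1\le x\le d$, let $p^{x}$ be the position obtained from $p=jd+i$ by replacing $i$ by $i+x-1$ modulo $d$ (in $\{1,\dots,d\}$). The positioned outlet $(T,x)$ is enforced by $A$ if $l\le l_A(p^x)\le u_A(p^x)\le u$, and permitted by $A$ if $l_A(p^x)\le u$ and $l\le u_A(p^x)$, for all $(p,l,u)\in M$. For a set $S$ of positioned outlets, $A\wedge S$ is the pair $(l,u)$ in which $l(q)$ is the least integer $\ge l_A(q)$ that is at least all $l_j$, and $u(q)$ the largest integer $\le u_A(q)$ that is at most all $u_j$, over the triples $(p_j,l_j,u_j)$ of members $(T,x)$ of $S$ with $p_j^x=q$. For $R\in\mathcal R$, the corresponding outlet for passes into the hub is the reduced outlet $T$ with $r(T)=1$ such that for every axle $A$ of degree $d$ and every $x$, $(T,x)$ is enforced (permitted) by $A$ if and only if for every (for some) cartwheel $W$ compatible with $A$ a pass $P$ that orientation-obeys $R$ appears in $W$ with $s(P)=x$, $t(P)=0$. The corresponding outlet for passes out of the hub is defined in the same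 way with value $-1$, $s(P)=0$, $t(P)=x$. Let $\mathcal T_d$ be the family of all these outlets, for all members of $\mathcal R$ and both directions (where they exist; with multiplicity). **Hubcaps.** For $x,y\in\{1,\dots,d\}$ let $$L_d(A,x,y)=\max_S\Bigl(\ \sum_{T}r(T)+\sum_{T'}r(T')\Bigr),$$ where $S$ ranges over the sets of positioned outlets $(T,k)$ with $T\in\mathcal T_d$ and $k\in\{x,y\}$ for which $A'=A\wedge S$ is a non-reducible axle, and the sums are over the $T\in\mathcal T_d$ with $(T,x)$ enforced by $A'$ and the $T'\in\mathcal T_d$ with $(T',y)$ enforced by $A'$ (the maximum of the empty set is $-\infty$). A hubcap for $A$ is a list of triples of integers $(x_1,y_1,v_1),\dots,(x_n,y_n,v_n)$ such that every $i\in\{1,\dots,d\}$ occurs exactly twice in the list $x_1,y_1,\dots,x_n,y_n$ (and no other integers occur there), $L_d(A,x_i,y_i)\le v_i$ for all $i$, and $$10(6-d)+\Bigl\lfloor\tfrac12\sum_{i=1}^n v_i\Bigr\rfloor\le0.$$ **Theorem.** Every axle of degree $d\in\{7,\dots,11\}$ that has a hubcap is successful. -/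

import Mathlib

/-! ### Drawings, near-triangulations, configurations

A drawing in the plane all of whose finite regions are triangles is recorded by its vertices, its
edges, and the relation "`a`, `b`, `c` are, in clockwise order, the vertices of a finite region".
Only the values on `verts` matter, so that restricting to a set of vertices (taking the induced
subdrawing) just changes `verts`. -/

structure Drawing (V : Type) where
  verts : Set V
  graph : SimpleGraph V
  cw : V → V → V → Prop

namespace Drawing

variable {V V' : Type}

/-- `a`, `b`, `c` bound a finite triangular region, clockwise. -/
def IsFace (D : Drawing V) (a b c : V) : Prop :=
  a ∈ D.verts ∧ b ∈ D.verts ∧ c ∈ D.verts ∧ D.cw a b c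

def IsEdge (D : Drawing V) (a b : V) : Prop :=
  a ∈ D.verts ∧ b ∈ D.verts ∧ D.graph.Adj a b

/-- The number of neighbours of `v`. -/
noncomputable def deg (D : Drawing V) (v : V) : ℕ := {w | D.IsEdge v w}.ncard

/-- `v` is not incident with the infinite region: the finite regions close up around `v`. -/
def IsInterior (D : Drawing V) (v : V) : Prop :=
  (∃ w, D.IsEdge v w) ∧ ∀ w, D.IsEdge v w → ∃ x, D.IsFace v w x

/-- The graph obtained by deleting the vertex `v`. -/
def del (D : Drawing V) (v : V) : SimpleGraph ↥(D.verts \ {v}) := D.graph.induce (D.verts \ {v})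

/-- Finite, non-null, connected plane drawings in which every finite region is a triangle.
`face_unique` says that there is at most one finite region on a given side of an edge,
`link` says that finite regions which close up around a vertex use all its neighbours, and
`euler` is Euler's formula `|V| + |F| = |E| + 1` (with `F` the set of finite regions; each finite
region is counted by three triples, and each edge by two ordered pairs). -/
structure IsNearTriangulation (D : Drawing V) : Prop where
  finite : D.verts.Finite
  connected : (D.graph.induce D.verts).Connected
  face_edge : ∀ a b c, D.IsFace a b c → D.IsEdge a b
  face_rot : ∀ a b c, D.IsFace a b c → D.IsFace b c a
  face_unique : ∀ a b c c', D.IsFace a b c → D.IsFace a b c' → c = c'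
  link : ∀ v, ∀ N : Set V, N.Nonempty → N ⊆ {w | D.IsEdge v w} →
    (∀ w ∈ N, ∃ x ∈ N, D.IsFace v w x) → N = {w | D.IsEdge v w}
  euler : 6 * D.verts.ncard + 2 * {q : V × V × V | D.IsFace q.1 q.2.1 q.2.2}.ncard
    = 3 * {e : V × V | D.IsEdge e.1 e.2}.ncard + 6

/-- The mirror image. -/
def mirror (D : Drawing V) : Drawing V where
  verts := D.verts
  graph := D.graph
  cw a b c := D.cw c b a

/-- `f` is induced by an orientation-preserving homeomorphism taking `D` to `E`. -/
def OrientIso (D : Drawing V) (E : Drawing V') (f : V → V') : Prop :=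
  Set.BijOn f D.verts E.verts ∧
  (∀ a ∈ D.verts, ∀ b ∈ D.verts, D.graph.Adj a b ↔ E.graph.Adj (f a) (f b)) ∧
  (∀ a ∈ D.verts, ∀ b ∈ D.verts, ∀ c ∈ D.verts, D.cw a b c ↔ E.cw (f a) (f b) (f c))

end Drawing

/-- A drawing `G(K)` together with a map `γ` from its vertices to the positive integers. -/
structure Config (V : Type) extends Drawing V where
  γ : V → ℕ

namespace Config

variable {V V' : Type}

noncomputable def ringSize (K : Config V) : ℤ :=
  ∑ᶠ v ∈ {v | v ∈ K.verts ∧ ¬ K.IsInterior v ∧ (K.del v).Preconnected},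
    ((K.γ v : ℤ) - K.deg v - 1)

structure IsConfiguration (K : Config V) : Prop where
  nearTriangulation : K.IsNearTriangulation
  components : ∀ v ∈ K.verts, Nat.card (K.del v).ConnectedComponent ≤ 2 ∧
    (Nat.card (K.del v).ConnectedComponent = 2 → K.γ v = K.deg v + 2)
  interior : ∀ v ∈ K.verts, K.IsInterior v → K.γ v = K.deg v
  boundary : ∀ v ∈ K.verts, ¬ K.IsInterior v → K.deg v < K.γ v
  five_le : ∀ v ∈ K.verts, 5 ≤ K.γ v
  two_le_ringSize : 2 ≤ K.ringSize

/-- Configurations are isomorphic if a homeomorphism of the plane, preserving the orientation or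
reversing it, takes one to the other. -/
def Iso (K : Config V) (L : Config V') : Prop :=
  ∃ f : V → V', (K.toDrawing.OrientIso L.toDrawing f ∨ K.toDrawing.OrientIso L.toDrawing.mirror f) ∧
    ∀ v ∈ K.verts, L.γ (f v) = K.γ v

/-- The part of `K` on the vertex set `X`. -/
def restrict (K : Config V) (X : Set V) : Config V := { K with verts := X }

end Config

/-! ### Cartwheels

A cartwheel with hub of degree `d` has spokes `1, …, d`, hats `d + 1, …, 2 d`, and, over a spoke `i`
of degree `k`, the fans `2 d + i, 3 d + i, …, (k - 4) d + i`. The vertex with number `j d + i`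
(`1 ≤ i ≤ d`) is written `rim j i`, where `i` is read modulo `d`; the vertex `0` is `hub`. -/

inductive Vert (d : ℕ) : Type
  | hub : Vert d
  | rim : ℕ → ZMod d → Vert d

/-- A cartwheel is determined by its degrees. (The values of `γ` outside of `Cartwheel.verts` below
play no role.) -/
structure Cartwheel (d : ℕ) where
  γ : Vert d → ℕ
  five_le_deg : 5 ≤ d
  hub_eq : γ Vert.hub = d
  five_le : ∀ v, 5 ≤ γ v

namespace Cartwheel

variable {d : ℕ}

def verts (W : Cartwheel d) : Set (Vert d) :=
  {v | match v with
    | Vert.hub => True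
    | Vert.rim j i => j ≤ 1 ∨ j + 4 ≤ W.γ (Vert.rim 0 i)}

/-- The path formed by the neighbours of the spoke `i` that are hats or fans: it leads from the hat
between `i - 1` and `i` (at `j = 1`) through the fans over `i` (`2 ≤ j ≤ k - 4`, where `k` is the
degree of the spoke) to the hat between `i` and `i + 1` (at `j = k - 3`). -/
def outer (W : Cartwheel d) (i : ZMod d) (j : ℕ) : Vert d :=
  if j ≤ 1 then Vert.rim 1 (i - 1)
  else if j + 4 ≤ W.γ (Vert.rim 0 i) then Vert.rim j i
  else Vert.rim 1 i

/-- The finite regions, with vertices in clockwise order. -/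
inductive Cw (W : Cartwheel d) : Vert d → Vert d → Vert d → Prop
  | spokes (i : ZMod d) : Cw W Vert.hub (Vert.rim 0 i) (Vert.rim 0 (i + 1))
  | hat (i : ZMod d) : Cw W (Vert.rim 0 (i + 1)) (Vert.rim 0 i) (Vert.rim 1 i)
  | fan (i : ZMod d) (j : ℕ) (h1 : 1 ≤ j) (h2 : j + 4 ≤ W.γ (Vert.rim 0 i)) :
      Cw W (Vert.rim 0 i) (W.outer i j) (W.outer i (j + 1))
  | rot (a b c : Vert d) (h : Cw W a b c) : Cw W b c a

/-- The cartwheel as a configuration: its edges are the sides of its finite regions. -/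
def config (W : Cartwheel d) : Config (Vert d) where
  verts := W.verts
  graph :=
    { Adj := fun a b => a ≠ b ∧ ∃ c, W.Cw a b c ∨ W.Cw b a c
      symm := ⟨fun _ _ h => ⟨h.1.symm, h.2.imp fun _ => Or.symm⟩⟩
      loopless := ⟨fun _ h => h.1 rfl⟩ }
  cw := W.Cw
  γ := W.γ

end Cartwheel

/-- `K` is a configuration, an induced subdrawing of `W` with every finite region of `K` a finite
region of `W`, and `γ` agrees on `K` and `W`. -/
def Config.AppearsIn {d : ℕ} (K : Config (Vert d)) (W : Cartwheel d) : Prop :=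
  K.IsConfiguration ∧ ∃ X : Set (Vert d), X ⊆ W.verts ∧ K = W.config.restrict X

/-- A configuration isomorphic to a member of `𝒢` appears in `W`. -/
def GoodAppears {d : ℕ} (𝒢 : Set (Config ℕ)) (W : Cartwheel d) : Prop :=
  ∃ K : Config (Vert d), K.AppearsIn W ∧ ∃ L ∈ 𝒢, K.Iso L

/-! ### Passes and rules -/

/-- The data `(K, r, s, t)` of a pass. -/
structure Pass (V : Type) where
  K : Config V
  r : ℕ
  s : V
  t : V

structure Pass.IsPass {V : Type} (P : Pass V) : Prop where
  configuration : P.K.IsConfiguration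
  pos : 0 < P.r
  edge : P.K.IsEdge P.s P.t
  near_s : ∀ v ∈ P.K.verts, v = P.s ∨ P.K.IsEdge v P.s ∨ ∃ w, P.K.IsEdge v w ∧ P.K.IsEdge w P.s
  near_t : ∀ v ∈ P.K.verts, v = P.t ∨ P.K.IsEdge v P.t ∨ ∃ w, P.K.IsEdge v w ∧ P.K.IsEdge w P.t

def Pass.AppearsIn {d : ℕ} (P : Pass (Vert d)) (W : Cartwheel d) : Prop := P.K.AppearsIn W

/-- The data `(G, β, δ, r, s, t)` of a rule. -/
structure Rule where
  G : Drawing ℕ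
  β : ℕ → ℕ
  δ : ℕ → ℕ∞
  r : ℕ
  s : ℕ
  t : ℕ

structure Rule.IsRule (R : Rule) : Prop where
  nearTriangulation : R.G.IsNearTriangulation
  noCut : ∀ v ∈ R.G.verts, (R.G.del v).Preconnected
  bounds : ∀ v ∈ R.G.verts, 0 < R.β v ∧ (R.β v : ℕ∞) ≤ R.δ v
  pos : 0 < R.r
  edge : R.G.IsEdge R.s R.t
  near_s : ∀ v ∈ R.G.verts, v = R.s ∨ R.G.IsEdge v R.s ∨
    ∃ w, R.G.IsEdge v w ∧ R.G.IsEdge w R.s ∧ R.δ w ≤ 8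
  near_t : ∀ v ∈ R.G.verts, v = R.t ∨ R.G.IsEdge v R.t ∨
    ∃ w, R.G.IsEdge v w ∧ R.G.IsEdge w R.t ∧ R.δ w ≤ 8

/-- The rule with the mirror image of the drawing. -/
def Rule.mirror (R : Rule) : Rule := { R with G := R.G.mirror }

namespace Pass

variable {V : Type}

/-- `f` is an isomorphism that witnesses that `P` orientation-obeys `R`. -/
def ObeysVia (P : Pass V) (R : Rule) (f : ℕ → V) : Prop :=
  P.IsPass ∧ P.r = R.r ∧ R.G.OrientIso P.K.toDrawing f ∧ f R.s = P.s ∧ f R.t = P.t ∧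
  ∀ v ∈ R.G.verts, R.β v ≤ P.K.γ (f v) ∧ (P.K.γ (f v) : ℕ∞) ≤ R.δ v

def OrientObeys (P : Pass V) (R : Rule) : Prop := ∃ f, P.ObeysVia R f

def AntiObeys (P : Pass V) (R : Rule) : Prop := P.OrientObeys R.mirror

def Obeys (P : Pass V) (R : Rule) : Prop := P.OrientObeys R ∨ P.AntiObeys R

end Pass

/-- `N_𝓟(W)`. -/
noncomputable def netCharge (𝓟 : Set Rule) {d : ℕ} (W : Cartwheel d) : ℤ :=
  10 * (6 - (d : ℤ))
  + ∑ᶠ P ∈ {P : Pass (Vert d) | (∃ R ∈ 𝓟, P.Obeys R) ∧ P.AppearsIn W ∧ P.t = Vert.hub}, (P.r : ℤ)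
  - ∑ᶠ P ∈ {P : Pass (Vert d) | (∃ R ∈ 𝓟, P.Obeys R) ∧ P.AppearsIn W ∧ P.s = Vert.hub}, (P.r : ℤ)

/-! ### Coherent rules, and the rules derived from them -/

structure Rule.IsCoherent (R : Rule) : Prop where
  fan_spoke : ∀ (d : ℕ) (W : Cartwheel d) (P : Pass (Vert d)) (f : ℕ → Vert d),
    P.ObeysVia R f ∨ P.ObeysVia R.mirror f → P.AppearsIn W → P.s = Vert.hub ∨ P.t = Vert.hub →
    ∀ (j : ℕ) (i : ZMod d), 2 ≤ j → Vert.rim j i ∈ P.K.verts →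
      Vert.rim 0 i ∈ P.K.verts ∧
      ∀ v ∈ R.G.verts, f v = Vert.rim 0 i → (R.β v : ℕ∞) = R.δ v
  reflect : (∃ (V : Type) (P : Pass V), P.OrientObeys R ∧ P.AntiObeys R) →
    ∀ (V : Type) (P : Pass V), P.OrientObeys R → P.AntiObeys R

/-- For coherent rules: some pass obeys `R` in both orientations. -/
def Rule.IsSymmetric (R : Rule) : Prop :=
  ∃ (V : Type) (P : Pass V), P.OrientObeys R ∧ P.AntiObeys R

/-- The rules `R' 0, …, R' (m - 1)` are coherent and have the same net effect as the rules in `𝓟`: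
each pass that obeys a member of `𝓟` obeys exactly one of them, and other passes obey none. -/
structure IsCoherentSplitting (𝓟 : Set Rule) {m : ℕ} (R' : Fin m → Rule) : Prop where
  isRule : ∀ j, (R' j).IsRule
  coherent : ∀ j, (R' j).IsCoherent
  same : ∀ (V : Type) (P : Pass V), (∃ R ∈ 𝓟, P.Obeys R) ↔ ∃ j, P.Obeys (R' j)
  once : ∀ (V : Type) (P : Pass V) (j k : Fin m), P.Obeys (R' j) → P.Obeys (R' k) → j = k

/-- Index set of the family `ℛ`: each rule is taken with as many copies as its value, and a rule that
is not symmetric is taken together with its mirror image (flag `true`). -/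
def RuleIndex {m : ℕ} (R' : Fin m → Rule) : Type :=
  Σ j : Fin m, Fin (R' j).r × {o : Bool // o = true → ¬ (R' j).IsSymmetric}

/-- The family `ℛ` itself: all values are one, and upper bounds are replaced by their minimum
with `12`. -/
noncomputable def unitRule {m : ℕ} (R' : Fin m → Rule) (ρ : RuleIndex R') : Rule :=
  let R := if ρ.2.2.1 then (R' ρ.1).mirror else R' ρ.1
  { R with r := 1, δ := fun v => min (R.δ v) 12 }

/-! ### Axles -/

/-- The position with number `j d + i`, where `0 ≤ j ≤ 4` and `1 ≤ i ≤ d`, is written `(j, i)`, with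
`i` read modulo `d`. -/
abbrev Position (d : ℕ) : Type := Fin 5 × ZMod d

structure Axle (d : ℕ) where
  l : Position d → ℕ
  u : Position d → ℕ

namespace Axle

variable {d : ℕ}

structure IsAxle (A : Axle d) : Prop where
  le : ∀ p, A.l p ≤ A.u p
  mem_l : ∀ p, A.l p ∈ ({5, 6, 7, 8, 9} : Set ℕ)
  mem_u : ∀ p, A.u p ∈ ({5, 6, 7, 8, 12} : Set ℕ)
  free : ∀ i : ZMod d, A.l (0, i) ≠ A.u (0, i) →
    ∀ j : Fin 5, 2 ≤ j → A.l (j, i) = 5 ∧ A.u (j, i) = 12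

end Axle

/-- The part derived from `A` fits `W`. The vertices of the part are the hub, the spokes, the hats,
and the fans over those spokes whose degree is specified by `A`. -/
def Cartwheel.Compatible {d : ℕ} (W : Cartwheel d) (A : Axle d) : Prop :=
  ∀ (j : Fin 5) (i : ZMod d),
    (j ≤ 1 ∨ (A.l (0, i) = A.u (0, i) ∧ (j : ℕ) + 4 ≤ A.l (0, i))) →
    A.l (j, i) ≤ W.γ (Vert.rim j i) ∧ W.γ (Vert.rim j i) ≤ A.u (j, i)

namespace Axle

variable {d : ℕ}

def Reducible (𝒢 : Set (Config ℕ)) (A : Axle d) : Prop :=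
  ∀ W : Cartwheel d, W.Compatible A → GoodAppears 𝒢 W

def Successful (𝒢 : Set (Config ℕ)) (𝓟 : Set Rule) (A : Axle d) : Prop :=
  ∀ W : Cartwheel d, W.Compatible A → GoodAppears 𝒢 W ∨ netCharge 𝓟 W ≤ 0

end Axle

/-! ### Outlets -/

/-- A triple `(p, l, u)`. -/
structure Entry (d : ℕ) where
  p : Position d
  l : ℕ
  u : ℕ

structure Outlet (d : ℕ) where
  M : Set (Entry d)
  r : ℤ

namespace Outlet

variable {d : ℕ}

structure IsOutlet (T : Outlet d) : Prop where
  finite : T.M.Finite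
  value : T.r ≠ 0
  le : ∀ e ∈ T.M, e.l ≤ e.u
  mem_l : ∀ e ∈ T.M, e.l ∈ ({5, 6, 7, 8, 9} : Set ℕ)
  mem_u : ∀ e ∈ T.M, e.u ∈ ({5, 6, 7, 8, 12} : Set ℕ)
  fan : ∀ e ∈ T.M, 2 ≤ e.p.1 →
    ∃ e' ∈ T.M, e'.p = (0, e.p.2) ∧ e'.l = e'.u ∧ (e.p.1 : ℕ) + 4 ≤ e'.l

def IsReduced (T : Outlet d) : Prop :=
  (∀ e ∈ T.M, ∀ e' ∈ T.M, e.p = e'.p → e = e') ∧ ∀ e ∈ T.M, ¬ (e.l = 5 ∧ e.u = 12)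

end Outlet

/-- The position `p ⊕ (x - 1)`: rotation by `x - 1` within the spokes, the hats, or a layer of
fans. -/
def shift {d : ℕ} (p : Position d) (x : ZMod d) : Position d := (p.1, p.2 + (x - 1))

namespace Axle

variable {d : ℕ}

def Enforces (A : Axle d) (T : Outlet d) (x : ZMod d) : Prop :=
  ∀ e ∈ T.M, e.l ≤ A.l (shift e.p x) ∧ A.l (shift e.p x) ≤ A.u (shift e.p x) ∧
    A.u (shift e.p x) ≤ e.u

def Permits (A : Axle d) (T : Outlet d) (x : ZMod d) : Prop :=
  ∀ e ∈ T.M, A.l (shift e.p x) ≤ e.u ∧ e.l ≤ A.u (shift e.p x)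

/-- `A ∧ (T₁, k₁) ∧ ⋯ ∧ (Tₙ, kₙ)` for a set of positioned outlets: the bounds of `A` are tightened,
as little as possible, to those of all `(Tᵢ, kᵢ)`. -/
noncomputable def meet (A : Axle d) (S : Set (Outlet d × ZMod d)) : Axle d where
  l p := sInf {n | A.l p ≤ n ∧ ∀ q ∈ S, ∀ e ∈ q.1.M, shift e.p q.2 = p → e.l ≤ n}
  u p := sSup {n | n ≤ A.u p ∧ ∀ q ∈ S, ∀ e ∈ q.1.M, shift e.p q.2 = p → n ≤ e.u}

end Axle

/-- A pass that orientation-obeys `R` appears in `W`, from the spoke `x` to the hub if `toHub` is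
true, and from the hub to the spoke `x` otherwise. -/
def HasPass {d : ℕ} (W : Cartwheel d) (R : Rule) (toHub : Bool) (x : ZMod d) : Prop :=
  ∃ P : Pass (Vert d), P.OrientObeys R ∧ P.AppearsIn W ∧
    if toHub then P.s = Vert.rim 0 x ∧ P.t = Vert.hub else P.s = Vert.hub ∧ P.t = Vert.rim 0 x

/-- `T` is the reduced outlet corresponding to passes that obey `R` and have the hub as their sink
(`toHub` true) or source (`toHub` false). -/
structure IsOutletOf {d : ℕ} (R : Rule) (toHub : Bool) (T : Outlet d) : Prop where
  isOutlet : T.IsOutlet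
  reduced : T.IsReduced
  value : T.r = if toHub then (R.r : ℤ) else -(R.r : ℤ)
  enforced : ∀ (A : Axle d) (x : ZMod d), A.IsAxle →
    (A.Enforces T x ↔ ∀ W : Cartwheel d, W.Compatible A → HasPass W R toHub x)
  permitted : ∀ (A : Axle d) (x : ZMod d), A.IsAxle →
    (A.Permits T x ↔ ∃ W : Cartwheel d, W.Compatible A ∧ HasPass W R toHub x)

/-- Index set of the family `𝒯_d`: a rule in `ℛ` and a direction for which there is a corresponding
outlet. (There is none if no cartwheel with hub of degree `d` contains such a pass, for example if
`R` admits no sink of degree `d`.) -/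
def OutletIndex (d : ℕ) {m : ℕ} (R' : Fin m → Rule) : Type :=
  {q : RuleIndex R' × Bool // ∃ T : Outlet d, IsOutletOf (unitRule R' q.1) q.2 T}

/-- The family `𝒯_d`. -/
noncomputable def outlet {d m : ℕ} {R' : Fin m → Rule} (τ : OutletIndex d R') : Outlet d :=
  τ.2.choose

instance {m : ℕ} (R' : Fin m → Rule) : Finite (RuleIndex R') := by
  unfold RuleIndex; infer_instance

noncomputable instance {d m : ℕ} (R' : Fin m → Rule) : Fintype (OutletIndex d R') :=
  @Fintype.ofFinite _ (by unfold OutletIndex; infer_instance)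

/-! ### Hubcaps -/

/-- The positioned outlet `(T, x)` or `(T, y)`, according to the flag. -/
noncomputable def placed {d m : ℕ} {R' : Fin m → Rule} (x y : ZMod d)
    (q : OutletIndex d R' × Bool) : Outlet d × ZMod d :=
  (outlet q.1, if q.2 then y else x)

open Classical in
/-- `L_d(A, x, y)`; it is `⊥`, the maximum of the empty set, if `A` is reducible. -/
noncomputable def hubcapBound {d m : ℕ} (𝒢 : Set (Config ℕ)) (R' : Fin m → Rule) (A : Axle d)
    (x y : ZMod d) : WithBot ℤ :=
  (Finset.univ.filter fun S : Finset (OutletIndex d R' × Bool) =>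
      (A.meet (placed x y '' (S : Set (OutletIndex d R' × Bool)))).IsAxle ∧ ¬ (A.meet (placed x y '' (S : Set (OutletIndex d R' × Bool)))).Reducible 𝒢).sup
    fun S => ((∑ q : OutletIndex d R' × Bool with
      (A.meet (placed x y '' (S : Set (OutletIndex d R' × Bool)))).Enforces (placed x y q).1 (placed x y q).2,
        (outlet q.1).r : ℤ) : WithBot ℤ)

/-- A list of triples `(x, y, v)` in which each of the `d` indices occurs exactly twice. -/
def IsHubcap {d : ℕ} (H : List (ZMod d × ZMod d × ℤ)) : Prop :=
  ∀ i : ZMod d, (H.map (fun h => h.1) ++ H.map (fun h => h.2.1)).count i = 2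

def Axle.HasHubcap {d m : ℕ} (𝒢 : Set (Config ℕ)) (R' : Fin m → Rule) (A : Axle d) : Prop :=
  ∃ H : List (ZMod d × ZMod d × ℤ), IsHubcap H ∧
    (∀ h ∈ H, hubcapBound 𝒢 R' A h.1 h.2.1 ≤ (h.2.2 : WithBot ℤ)) ∧
    10 * (6 - (d : ℤ)) + ⌊(1 / 2 : ℚ) * ((H.map (fun h => h.2.2)).sum : ℤ)⌋ ≤ 0

/-! Let `W` be compatible with `A` and contain no good configuration. The charge of the hub is `10 *
(6 - d)` plus the sum over spokes `x` of `spokeCharge R' W x`, the values of the outlets whose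
passes occur between `x` and the hub. Given two spokes `x`, `y`, let `S` consist of the outlets,
placed at `x` or `y`, whose passes occur in `W`. The degrees of `W` satisfy all bounds of `S`, so
`A.meet S` is an axle with which `W` is compatible, and it is not reducible. It enforces every
member of `S`; conversely an outlet that it enforces at `x` or `y` has its pass in every compatible
cartwheel, in particular in `W`. Hence `S` contributes exactly the charge of the two spokes to the
maximum that defines `hubcapBound` (`spokeCharge_add_le_hubcapBound`). Adding the inequalities of a
hubcap counts each spoke twice, and the total charge is an integer, so it is at most the floor of
half the sum of the `v`'s.

The work lies in justifying that formula for the charge. It needs an outlet for every unit rule and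
direction that occurs at all (`exists_isOutletOf`), and at most one pass for a given rule, direction
and spoke (`Pass.ObeysVia.eq_of_eq`). Both rest on rigidity (`Pass.ObeysVia.rigid`): once source and
sink are placed, the position of the whole pass is forced. Across a side of a triangle the cartwheel
determines the third vertex, except that the position of a fan depends on the degree of its spoke;
coherence says that the rule prescribes this degree. That every vertex of a rule is reached from the
edge `s t` through triangles (`face_induction`) is topology: there are no cutvertices, and a
near-triangulation with boundary has trivial first cohomology modulo 2, by Euler's formula.

Conversely, a copy of a pass can be placed in any cartwheel that satisfies the resulting degree
bounds (`Pass.ObeysVia.transfer`). The delicate points are the ring-size condition, which holds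
because the vertices of a pass cannot surround the hub when `d ≥ 7`, and pairs of hats, which are
adjacent exactly if the spoke between them has degree 5.

Unit rules have upper bounds at most 12, so `W` is first replaced by a cartwheel with degrees at
most 12. Neither the charge nor the absence of good configurations is affected, because rules and
good configurations do not distinguish degrees from 12 on. -/

/-! ### Cohomology of near-triangulations -/

section Cohomology

open Module

variable {U : Type*} (G : SimpleGraph U)

/-- The value on the ordered pair `(a, b)` of a function on the edges. -/
noncomputable def edgeValue (g : G.edgeSet → ZMod 2) (a b : U) : ZMod 2 :=
  open Classical in if h : G.Adj a b then g ⟨s(a, b), h⟩ else 0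

/-- The coboundary of a function on the edges. -/
noncomputable def faceCoboundary (F : Set (U × U × U)) :
    (G.edgeSet → ZMod 2) →ₗ[ZMod 2] (F → ZMod 2) where
  toFun g f := edgeValue G g f.1.1 f.1.2.1 + edgeValue G g f.1.2.1 f.1.2.2 +
    edgeValue G g f.1.2.2 f.1.1
  map_add' g g' := by
    funext f
    have : ∀ a b, edgeValue G (g + g') a b = edgeValue G g a b + edgeValue G g' a b := by
      intro a b; unfold edgeValue; split <;> simp
    simp only [this, Pi.add_apply]; ring
  map_smul' c g := by
    funext f
    have : ∀ a b, edgeValue G (c • g) a b = c * edgeValue G g a b := by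
      intro a b; unfold edgeValue; split <;> simp
    simp only [this, Pi.smul_apply, smul_eq_mul, RingHom.id_apply]; ring

/-- The coboundary of a function on the vertices. -/
noncomputable def edgeCoboundary : (U → ZMod 2) →ₗ[ZMod 2] (G.edgeSet → ZMod 2) where
  toFun h e := Sym2.lift ⟨fun a b => h a + h b, fun a b => add_comm _ _⟩ e.1
  map_add' g g' := by
    funext ⟨e, he⟩
    induction e with | _ a b => simp; ring
  map_smul' c g := by
    funext ⟨e, he⟩
    induction e with | _ a b => simp; ring

variable {G}

theorem edgeValue_edgeCoboundary (h : U → ZMod 2) {a b : U} (hab : G.Adj a b) :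
    edgeValue G (edgeCoboundary G h) a b = h a + h b := by
  simp [edgeValue, hab, edgeCoboundary]

theorem add_self_zmod_two (x : ZMod 2) : x + x = 0 := CharTwo.add_self_eq_zero x

/-- On a connected graph the only 0-cocycles are the constants. -/
theorem finrank_ker_edgeCoboundary_le [Fintype U] (hG : G.Connected) :
    finrank (ZMod 2) (LinearMap.ker (edgeCoboundary G)) ≤ 1 := by
  have : LinearMap.ker (edgeCoboundary G) ≤ Submodule.span (ZMod 2) {fun _ => 1} := by
    intro h hh
    have hadj : ∀ a b, G.Adj a b → h a = h b := by
      intro a b hab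
      have := edgeValue_edgeCoboundary h hab
      rw [LinearMap.mem_ker.1 hh] at this
      have h0 : h a + h b = 0 := by rw [← this]; simp [edgeValue]
      exact CharTwo.add_eq_zero.1 h0
    have hconst : ∀ a b, h a = h b := by
      intro a b
      obtain ⟨p⟩ := hG.preconnected a b
      induction p with
      | nil => rfl
      | cons hab _ ih => exact (hadj _ _ hab).trans ih
    obtain ⟨v⟩ := hG.nonempty
    rw [Submodule.mem_span_singleton]
    exact ⟨h v, funext fun w => by simp [hconst w v]⟩
  exact (Submodule.finrank_mono this).trans
    ((finrank_span_le_card _).trans (by simp))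

variable {face : U → U → U → Prop}

/-- `(a, b)` is a side of the triangle `f`, in this direction. -/
def IsSide (f : U × U × U) (a b : U) : Prop :=
  (a = f.1 ∧ b = f.2.1) ∨ (a = f.2.1 ∧ b = f.2.2) ∨ (a = f.2.2 ∧ b = f.1)

-- Compares two ways of recording that an edge belongs to a triangle: by directed sides, as faces
-- are stored, and by unordered edges, as cochains are stored.
open Classical in
theorem side_indicator {p q r a b : U} (h1 : p ≠ q) (h2 : q ≠ r) (h3 : r ≠ p) (hab : a ≠ b)
    (x : ZMod 2) :
    (if IsSide (p, q, r) a b then x else 0) + (if IsSide (p, q, r) b a then x else 0) =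
      ((if s(p, q) = s(a, b) then 1 else 0) + (if s(q, r) = s(a, b) then 1 else 0) +
        if s(r, p) = s(a, b) then 1 else 0) * x := by
  have h1' := h1.symm
  have h2' := h2.symm
  have h3' := h3.symm
  simp only [IsSide, Sym2.eq_iff]
  by_cases ha : a = p
  · subst ha
    by_cases hb : b = q
    · subst hb; simp [*]
    by_cases hb' : b = r
    · subst hb'; simp [*]
    simp [*, Ne.symm hb, Ne.symm hb']
  by_cases ha' : a = q
  · subst ha'
    by_cases hb : b = p
    · subst hb; simp [*]
    by_cases hb' : b = r
    · subst hb'; simp [*]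
    simp [*, Ne.symm hb, Ne.symm hb']
  by_cases ha'' : a = r
  · subst ha''
    by_cases hb : b = p
    · subst hb; simp [*]
    by_cases hb' : b = q
    · subst hb'; simp [*]
    simp [*, Ne.symm hb, Ne.symm hb']
  simp [*, Ne.symm ha, Ne.symm ha', Ne.symm ha'']

/-- One representative for each face. -/
def faceReps [LinearOrder U] (face : U → U → U → Prop) : Set (U × U × U) :=
  {f | face f.1 f.2.1 f.2.2 ∧ f.1 < f.2.1 ∧ f.1 < f.2.2}

/-- The second cohomology vanishes. A functional that kills the image is a 2-cycle modulo 2. A cycle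
has equal values on the two sides of each edge, counting a missing face as 0. If it is non-zero on
one face at a vertex, it is non-zero on all faces there, and by connectedness at every vertex; then
faces close up around every vertex, contrary to `boundary`. -/
theorem range_faceCoboundary [Fintype U] [LinearOrder U] (hG : G.Connected)
    (face_edge : ∀ a b c, face a b c → G.Adj a b) (face_rot : ∀ a b c, face a b c → face b c a)
    (face_unique : ∀ a b c c', face a b c → face a b c' → c = c')
    (link : ∀ v, ∀ N : Set U, N.Nonempty → N ⊆ {w | G.Adj v w} →
      (∀ w ∈ N, ∃ x ∈ N, face v w x) → N = {w | G.Adj v w})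
    (boundary : ∃ v, ¬ ((∃ w, G.Adj v w) ∧ ∀ w, G.Adj v w → ∃ x, face v w x)) :
    LinearMap.range (faceCoboundary G (faceReps face)) = ⊤ := by
  classical
  by_contra hne
  obtain ⟨φ, hφ, hker⟩ := Submodule.exists_le_ker_of_lt_top _ (lt_top_iff_ne_top.2 hne)
  have hF : ∀ f : faceReps face, f.1.1 ≠ f.1.2.1 ∧ f.1.2.1 ≠ f.1.2.2 ∧ f.1.2.2 ≠ f.1.1 := by
    rintro ⟨⟨a, b, c⟩, h, -⟩
    exact ⟨(face_edge _ _ _ h).ne, (face_edge _ _ _ (face_rot _ _ _ h)).ne,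
      (face_edge _ _ _ (face_rot _ _ _ (face_rot _ _ _ h))).ne⟩
  -- `z` is the 2-chain that represents `φ`; below, `y a b` is the value of `z` on the face with
  -- directed side `a b`, and 0 if there is none.
  let z : faceReps face → ZMod 2 := fun f => φ (Pi.single f 1)
  have hφz : ∀ g, φ g = ∑ f, g f * z f := by
    intro g
    rw [LinearMap.pi_apply_eq_sum_univ φ g]
    refine Finset.sum_congr rfl fun f _ => ?_
    rw [smul_eq_mul]
    congr 2
    funext j
    simp [Pi.single_apply, eq_comm]
  let y : U → U → ZMod 2 := fun a b => ∑ f : faceReps face, if IsSide f.1 a b then z f else 0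
  have hside : ∀ (f : faceReps face) a b, IsSide f.1 a b → ∃ c, face a b c := by
    rintro ⟨⟨p, q, r⟩, h, -⟩ a b (⟨rfl, rfl⟩ | ⟨rfl, rfl⟩ | ⟨rfl, rfl⟩)
    exacts [⟨_, h⟩, ⟨_, face_rot _ _ _ h⟩, ⟨_, face_rot _ _ _ (face_rot _ _ _ h)⟩]
  have hy0 : ∀ a b, (¬ ∃ c, face a b c) → y a b = 0 := by
    intro a b hab
    refine Finset.sum_eq_zero fun f _ => if_neg fun h => hab (hside f a b h)
  have hsidestep : ∀ (f : faceReps face) a b c, face a b c → IsSide f.1 a b → IsSide f.1 b c := by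
    rintro ⟨⟨p, q, r⟩, h, -⟩ a b c habc (⟨rfl, rfl⟩ | ⟨rfl, rfl⟩ | ⟨rfl, rfl⟩)
    · exact Or.inr (Or.inl ⟨rfl, face_unique _ _ _ _ habc h⟩)
    · exact Or.inr (Or.inr ⟨rfl, face_unique _ _ _ _ habc (face_rot _ _ _ h)⟩)
    · exact Or.inl ⟨rfl, face_unique _ _ _ _ habc (face_rot _ _ _ (face_rot _ _ _ h))⟩
  have hyrot : ∀ a b c, face a b c → y a b = y b c := by
    intro a b c habc
    refine Finset.sum_congr rfl fun f _ => ?_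
    have : IsSide f.1 a b ↔ IsSide f.1 b c :=
      ⟨hsidestep f a b c habc, fun h => hsidestep f _ _ _ (face_rot _ _ _ (face_rot _ _ _ habc))
        (hsidestep f _ _ _ (face_rot _ _ _ habc) h)⟩
    simp only [this]
  -- The cycle condition: `φ` vanishes on the coboundary of the indicator of the edge `a b`.
  have hysymm : ∀ a b, G.Adj a b → y a b = y b a := by
    intro a b hab
    have h0 : φ (faceCoboundary G (faceReps face) (Pi.single ⟨s(a, b), hab⟩ 1)) = 0 :=
      hker ⟨_, rfl⟩
    rw [hφz] at h0
    have hval : ∀ p q, G.Adj p q → edgeValue G (Pi.single ⟨s(a, b), hab⟩ 1) p q =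
        if s(p, q) = s(a, b) then 1 else 0 := by
      intro p q hpq
      simp only [edgeValue, hpq, dif_pos, Pi.single_apply, ← Subtype.val_inj]
    have hab' := hab.ne
    have : y a b + y b a = 0 := by
      rw [← h0, ← Finset.sum_add_distrib]
      refine Finset.sum_congr rfl fun f _ => ?_
      obtain ⟨h1, h2, h3⟩ := hF f
      obtain ⟨⟨p, q, r⟩, h, hlt⟩ := f
      have e1 := face_edge _ _ _ h
      have e2 := face_edge _ _ _ (face_rot _ _ _ h)
      have e3 := face_edge _ _ _ (face_rot _ _ _ (face_rot _ _ _ h))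
      dsimp only at h1 h2 h3 e1 e2 e3
      simp only [faceCoboundary, LinearMap.coe_mk, AddHom.coe_mk, hval _ _ e1, hval _ _ e2,
        hval _ _ e3]
      convert side_indicator h1 h2 h3 hab' (z _)
    exact CharTwo.add_eq_zero.1 this
  have hyall : ∀ v w, G.Adj v w → y v w = 0 := by
    by_contra! hcon
    obtain ⟨v, w, hvw, hy⟩ := hcon
    have hface : ∀ v w, y v w ≠ 0 → ∃ x, face v w x := by
      intro v w h
      by_contra hc
      exact h (hy0 v w hc)
    have hN : ∀ v w, y v w ≠ 0 → ∀ w', G.Adj v w' → y v w' ≠ 0 := by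
      intro v w hy w' hw'
      -- The successor `x` of `w` satisfies `y v w = y w x = y x v = y v x`, so the set is closed
      -- under successors and `link` makes it the whole neighbourhood.
      have hlink := link v {w | y v w ≠ 0} ⟨w, hy⟩
        (fun w hw => (hface v w hw).elim fun x hx => face_edge _ _ _ hx) (by
          intro w hw
          obtain ⟨x, hx⟩ := hface v w hw
          refine ⟨x, ?_, hx⟩
          have h1 := hyrot _ _ _ hx
          have h2 := hyrot _ _ _ (face_rot _ _ _ hx)
          have h3 := face_edge _ _ _ (face_rot _ _ _ (face_rot _ _ _ hx))
          change y v x ≠ 0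
          rw [← hysymm _ _ h3, ← h2, ← h1]
          exact hw)
      have : w' ∈ {w | y v w ≠ 0} := by rw [hlink]; exact hw'
      exact this
    have hprop : ∀ u, ∃ w, y u w ≠ 0 := by
      intro u
      obtain ⟨p⟩ := hG.preconnected u v
      induction p with
      | nil => exact ⟨w, hy⟩
      | @cons a b c hab _ ih =>
        obtain ⟨x, hx⟩ := ih hvw hy
        exact ⟨b, by rw [hysymm a b hab]; exact hN b x hx a hab.symm⟩
    obtain ⟨u, hu⟩ := boundary
    obtain ⟨w, hw⟩ := hprop u
    obtain ⟨x, hx⟩ := hface _ _ hw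
    exact hu ⟨⟨w, face_edge _ _ _ hx⟩, fun w' hw' => hface _ _ (hN u w hw w' hw')⟩
  refine hφ (LinearMap.ext fun g => ?_)
  rw [hφz, LinearMap.zero_apply]
  refine Finset.sum_eq_zero fun f _ => ?_
  have hzy : y f.1.1 f.1.2.1 = z f := by
    refine (Finset.sum_eq_single f (fun f' _ hne => if_neg fun hs => hne ?_)
      fun h => absurd (Finset.mem_univ _) h).trans (if_pos (Or.inl ⟨rfl, rfl⟩))
    obtain ⟨⟨p, q, r⟩, h, h1, h2⟩ := f
    obtain ⟨⟨p', q', r'⟩, h', h1', h2'⟩ := f'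
    dsimp only at *
    rcases hs with ⟨rfl, rfl⟩ | ⟨rfl, rfl⟩ | ⟨rfl, rfl⟩
    · obtain rfl := face_unique _ _ _ _ h h'
      rfl
    · obtain rfl := face_unique _ _ _ _ h (face_rot _ _ _ h')
      exact absurd h2 (not_lt.2 h1'.le)
    · exact absurd h1 (not_lt.2 h2'.le)
  rw [← hzy, hyall _ _ (face_edge _ _ _ f.2.1), mul_zero]

/-- If Euler's formula for the disc holds, every closed `1`-cochain is a coboundary. -/
theorem exists_potential [Fintype U] [LinearOrder U] (hG : G.Connected)
    (face_edge : ∀ a b c, face a b c → G.Adj a b) (face_rot : ∀ a b c, face a b c → face b c a)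
    (face_unique : ∀ a b c c', face a b c → face a b c' → c = c')
    (link : ∀ v, ∀ N : Set U, N.Nonempty → N ⊆ {w | G.Adj v w} →
      (∀ w ∈ N, ∃ x ∈ N, face v w x) → N = {w | G.Adj v w})
    (boundary : ∃ v, ¬ ((∃ w, G.Adj v w) ∧ ∀ w, G.Adj v w → ∃ x, face v w x))
    (euler : Nat.card U + (faceReps face).ncard = G.edgeSet.ncard + 1)
    (g : U → U → ZMod 2) (hsymm : ∀ a b, g a b = g b a)
    (hclosed : ∀ a b c, face a b c → g a b + g b c + g c a = 0) :
    ∃ h : U → ZMod 2, ∀ a b, G.Adj a b → g a b = h a + h b := by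
  classical
  have hrange := range_faceCoboundary hG face_edge face_rot face_unique link boundary
  have hle : LinearMap.range (edgeCoboundary G) ≤
      LinearMap.ker (faceCoboundary G (faceReps face)) := by
    rintro _ ⟨h, rfl⟩
    rw [LinearMap.mem_ker]
    funext ⟨⟨p, q, r⟩, hf, _⟩
    have e1 := face_edge _ _ _ hf
    have e2 := face_edge _ _ _ (face_rot _ _ _ hf)
    have e3 := face_edge _ _ _ (face_rot _ _ _ (face_rot _ _ _ hf))
    simp only [faceCoboundary, LinearMap.coe_mk, AddHom.coe_mk, edgeValue_edgeCoboundary _ e1,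
      edgeValue_edgeCoboundary _ e2, edgeValue_edgeCoboundary _ e3, Pi.zero_apply]
    linear_combination add_self_zmod_two (h p) + add_self_zmod_two (h q) + add_self_zmod_two (h r)
  have hker := LinearMap.finrank_range_add_finrank_ker (faceCoboundary G (faceReps face))
  have hgrad := LinearMap.finrank_range_add_finrank_ker (edgeCoboundary G)
  rw [hrange, finrank_top, finrank_fintype_fun_eq_card, finrank_fintype_fun_eq_card,
    ← Nat.card_eq_fintype_card, ← Nat.card_eq_fintype_card, Nat.card_coe_set_eq,
    Nat.card_coe_set_eq] at hker
  rw [finrank_fintype_fun_eq_card, ← Nat.card_eq_fintype_card] at hgrad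
  have h1 := finrank_ker_edgeCoboundary_le hG
  -- With `V`, `E`, `F` the numbers of vertices, edges and faces, the 1-cocycles have dimension `E -
  -- F` and the 1-coboundaries at least `V - 1`. Euler's formula makes these numbers equal.
  have heq := Submodule.eq_of_le_of_finrank_le hle (by omega)
  let g' : G.edgeSet → ZMod 2 := fun e => Sym2.lift ⟨g, hsymm⟩ e.1
  have hg' : ∀ a b, G.Adj a b → edgeValue G g' a b = g a b := by
    intro a b hab
    simp [edgeValue, hab, g']
  have hmem : g' ∈ LinearMap.ker (faceCoboundary G (faceReps face)) := by
    rw [LinearMap.mem_ker]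
    funext ⟨⟨p, q, r⟩, hf, _⟩
    have e1 := face_edge _ _ _ hf
    have e2 := face_edge _ _ _ (face_rot _ _ _ hf)
    have e3 := face_edge _ _ _ (face_rot _ _ _ (face_rot _ _ _ hf))
    simp only [faceCoboundary, LinearMap.coe_mk, AddHom.coe_mk, hg' _ _ e1, hg' _ _ e2, hg' _ _ e3]
    exact hclosed _ _ _ hf
  rw [← heq] at hmem
  obtain ⟨h, hh⟩ := hmem
  refine ⟨h, fun a b hab => ?_⟩
  rw [← hg' a b hab, ← hh, edgeValue_edgeCoboundary h hab]

/-- Of the three rotations of a face exactly one begins with its least vertex. -/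
theorem three_mul_ncard_faceReps [Fintype U] [LinearOrder U]
    (face_edge : ∀ a b c, face a b c → G.Adj a b) (face_rot : ∀ a b c, face a b c → face b c a) :
    {q : U × U × U | face q.1 q.2.1 q.2.2}.ncard = 3 * (faceReps face).ncard := by
  classical
  let ρ : U × U × U → U × U × U := fun q => (q.2.1, q.2.2, q.1)
  have hρ : Function.Injective ρ := by
    rintro ⟨a, b, c⟩ ⟨a', b', c'⟩ h
    simp only [ρ, Prod.mk.injEq] at h ⊢
    tauto
  have hne : ∀ q : U × U × U, face q.1 q.2.1 q.2.2 →
      q.1 ≠ q.2.1 ∧ q.2.1 ≠ q.2.2 ∧ q.2.2 ≠ q.1 := fun q h =>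
    ⟨(face_edge _ _ _ h).ne, (face_edge _ _ _ (face_rot _ _ _ h)).ne,
      (face_edge _ _ _ (face_rot _ _ _ (face_rot _ _ _ h))).ne⟩
  have hunion : {q : U × U × U | face q.1 q.2.1 q.2.2} =
      faceReps face ∪ (ρ '' faceReps face ∪ ρ '' (ρ '' faceReps face)) := by
    ext ⟨a, b, c⟩
    constructor
    · intro h
      obtain ⟨h1, h2, h3⟩ := hne _ h
      have h' : face a b c := h
      dsimp only at h1 h2 h3
      have hmin : (a < b ∧ a < c) ∨ (c < a ∧ c < b) ∨ (b < c ∧ b < a) := by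
        rcases lt_or_gt_of_ne h1 with hab | hab <;> rcases lt_or_gt_of_ne h2 with hbc | hbc <;>
          rcases lt_or_gt_of_ne h3 with hca | hca <;> simp [*] <;> order
      rcases hmin with hmin | hmin | hmin
      · exact Or.inl ⟨h, hmin⟩
      · exact Or.inr (Or.inl ⟨(c, a, b), ⟨face_rot _ _ _ (face_rot _ _ _ h'), hmin⟩, rfl⟩)
      · exact Or.inr (Or.inr ⟨(c, a, b), ⟨(b, c, a), ⟨face_rot _ _ _ h', hmin⟩, rfl⟩, rfl⟩)
    · rintro (h | ⟨q, h, hq⟩ | ⟨_, ⟨q, h, rfl⟩, hq⟩)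
      · exact h.1
      · rw [← hq]; exact face_rot _ _ _ h.1
      · rw [← hq]; exact face_rot _ _ _ (face_rot _ _ _ h.1)
  rw [hunion, Set.ncard_union_eq, Set.ncard_union_eq, Set.ncard_image_of_injective _ hρ,
    Set.ncard_image_of_injective _ hρ, Set.ncard_image_of_injective _ hρ]
  · ring
  · rw [Set.disjoint_left]
    rintro ⟨a, b, c⟩ ⟨⟨a', b', c'⟩, ⟨-, h1, h2⟩, hq⟩ ⟨_, ⟨⟨a'', b'', c''⟩, ⟨-, h3, h4⟩, rfl⟩, hq'⟩
    simp only [ρ, Prod.mk.injEq] at *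
    obtain ⟨rfl, rfl, rfl⟩ := hq
    obtain ⟨rfl, rfl, rfl⟩ := hq'
    order
  · rw [Set.disjoint_left]
    rintro ⟨a, b, c⟩ ⟨-, h1, h2⟩ (⟨⟨a', b', c'⟩, ⟨-, h3, h4⟩, hq⟩ |
      ⟨_, ⟨⟨a', b', c'⟩, ⟨-, h3, h4⟩, rfl⟩, hq⟩)
    all_goals
      simp only [ρ, Prod.mk.injEq] at *
      obtain ⟨rfl, rfl, rfl⟩ := hq
      order

theorem two_mul_ncard_edgeSet [Finite U] :
    {e : U × U | G.Adj e.1 e.2}.ncard = 2 * G.edgeSet.ncard := by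
  classical
  have := Fintype.ofFinite U
  have h := G.dart_card_eq_twice_card_edges
  rw [← SimpleGraph.coe_edgeFinset, Set.ncard_coe_finset, ← h, ← Nat.card_eq_fintype_card,
    ← Nat.card_coe_set_eq]
  exact Nat.card_congr ⟨fun e => ⟨e.1, e.2⟩, fun d => ⟨d.toProd, d.adj⟩, fun _ => rfl, fun _ => rfl⟩

end Cohomology

/-! ### Near-triangulations -/

namespace Drawing

variable {V V' : Type} {D : Drawing V} {E : Drawing V'} {f : V → V'}

theorem IsEdge.symm {a b : V} (h : D.IsEdge a b) : D.IsEdge b a := ⟨h.2.1, h.1, h.2.2.symm⟩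

namespace IsNearTriangulation

theorem face_edge₃ (hD : D.IsNearTriangulation) {a b c : V} (h : D.IsFace a b c) :
    D.IsEdge c a := hD.face_edge _ _ _ (hD.face_rot _ _ _ (hD.face_rot _ _ _ h))

theorem finite_nbrs (hD : D.IsNearTriangulation) (v : V) : {w | D.IsEdge v w}.Finite :=
  hD.finite.subset fun _ h => h.2.1

/-- If a near-triangulation is not a sphere then its first cohomology vanishes. -/
theorem exists_vertexPotential (hD : D.IsNearTriangulation)
    (boundary : ∃ v ∈ D.verts, ¬ D.IsInterior v)
    (g : V → V → ZMod 2) (hsymm : ∀ a b, g a b = g b a)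
    (hclosed : ∀ a b c, D.IsFace a b c → g a b + g b c + g c a = 0) :
    ∃ h : V → ZMod 2, ∀ a b, D.IsEdge a b → g a b = h a + h b := by
  classical
  have := hD.finite.to_subtype
  have := Fintype.ofFinite D.verts
  let _ : LinearOrder D.verts := LinearOrder.lift' (Fintype.equivFin D.verts)
    (Fintype.equivFin D.verts).injective
  let face : D.verts → D.verts → D.verts → Prop := fun a b c => D.cw a b c
  have hface : ∀ a b c : D.verts, face a b c ↔ D.IsFace a b c := fun a b c =>
    ⟨fun h => ⟨a.2, b.2, c.2, h⟩, fun h => h.2.2.2⟩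
  let G := D.graph.induce D.verts
  have hadj : ∀ a b : D.verts, G.Adj a b ↔ D.IsEdge a b := fun a b =>
    ⟨fun h => ⟨a.2, b.2, h⟩, fun h => h.2.2⟩
  have face_edge : ∀ a b c, face a b c → G.Adj a b := fun a b c h =>
    (hadj _ _).2 (hD.face_edge _ _ _ ((hface _ _ _).1 h))
  have face_rot : ∀ a b c, face a b c → face b c a := fun a b c h =>
    (hface _ _ _).2 (hD.face_rot _ _ _ ((hface _ _ _).1 h))
  have hF := three_mul_ncard_faceReps face_edge face_rot
  have hE := two_mul_ncard_edgeSet (G := G)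
  have hF' : {q : V × V × V | D.IsFace q.1 q.2.1 q.2.2}.ncard =
      {q : D.verts × D.verts × D.verts | face q.1 q.2.1 q.2.2}.ncard := by
    rw [← Set.ncard_image_of_injective (f := fun q : D.verts × D.verts × D.verts =>
      ((q.1 : V), (q.2.1 : V), (q.2.2 : V)))]
    · congr 1
      ext ⟨a, b, c⟩
      constructor
      · intro h
        exact ⟨(⟨a, h.1⟩, ⟨b, h.2.1⟩, ⟨c, h.2.2.1⟩), h.2.2.2, rfl⟩
      · rintro ⟨⟨a', b', c'⟩, h, hq⟩
        simp only [Prod.mk.injEq] at hq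
        obtain ⟨rfl, rfl, rfl⟩ := hq
        exact (hface _ _ _).1 h
    · rintro ⟨a, b, c⟩ ⟨a', b', c'⟩ h
      simpa [Subtype.ext_iff] using h
  have hE' : {e : V × V | D.IsEdge e.1 e.2}.ncard =
      {e : D.verts × D.verts | G.Adj e.1 e.2}.ncard := by
    rw [← Set.ncard_image_of_injective (f := fun q : D.verts × D.verts => ((q.1 : V), (q.2 : V)))]
    · congr 1
      ext ⟨a, b⟩
      constructor
      · intro h
        exact ⟨(⟨a, h.1⟩, ⟨b, h.2.1⟩), h.2.2, rfl⟩
      · rintro ⟨⟨a', b'⟩, h, hq⟩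
        simp only [Prod.mk.injEq] at hq
        obtain ⟨rfl, rfl⟩ := hq
        exact (hadj _ _).1 h
    · rintro ⟨a, b⟩ ⟨a', b'⟩ h
      simpa [Subtype.ext_iff] using h
  have heuler := hD.euler
  rw [hF', hE', hF, hE, ← Nat.card_coe_set_eq] at heuler
  obtain ⟨h, hh⟩ := exists_potential (G := G) (face := face) hD.connected face_edge face_rot
    (fun a b c c' h h' => Subtype.ext (hD.face_unique _ _ _ _ ((hface _ _ _).1 h)
      ((hface _ _ _).1 h')))
    (by
      intro v N hN hsub hcl
      have := hD.link v (Subtype.val '' N) (hN.image _) (by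
        rintro _ ⟨w, hw, rfl⟩
        exact (hadj _ _).1 (hsub hw)) (by
        rintro _ ⟨w, hw, rfl⟩
        obtain ⟨x, hx, hf⟩ := hcl w hw
        exact ⟨x, ⟨x, hx, rfl⟩, (hface _ _ _).1 hf⟩)
      refine Set.Subset.antisymm hsub fun w hw => ?_
      have hw' : (w : V) ∈ {w | D.IsEdge v w} := (hadj _ _).1 hw
      rw [← this] at hw'
      obtain ⟨w', h1, h2⟩ := hw'
      rwa [← Subtype.ext h2])
    (by
      obtain ⟨v, hv, hint⟩ := boundary
      refine ⟨⟨v, hv⟩, fun ⟨⟨w, hw⟩, hall⟩ => hint ⟨⟨w, (hadj _ _).1 hw⟩, fun w' hw' => ?_⟩⟩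
      obtain ⟨x, hx⟩ := hall ⟨w', hw'.2.1⟩ ((hadj _ _).2 hw')
      exact ⟨x, (hface _ _ _).1 hx⟩)
    (by omega)
    (fun a b => g a b) (fun a b => hsymm a b)
    (fun a b c h => hclosed _ _ _ ((hface _ _ _).1 h))
  refine ⟨fun v => if hv : v ∈ D.verts then h ⟨v, hv⟩ else 0, fun a b hab => ?_⟩
  have := hh ⟨a, hab.1⟩ ⟨b, hab.2.1⟩ ((hadj _ _).2 hab)
  simpa [hab.1, hab.2.1] using this

/-- If `v` is not a cutvertex then the neighbours of `v` are connected through the finite regions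
at `v`. -/
theorem link_connected (hD : D.IsNearTriangulation) (boundary : ∃ v ∈ D.verts, ¬ D.IsInterior v)
    {v : V} (hcut : (D.del v).Preconnected) (N : Set V) (hN : N.Nonempty)
    (hsub : N ⊆ {w | D.IsEdge v w}) (hcl : ∀ w ∈ N, ∀ x, D.IsFace v w x → x ∈ N)
    (hcl' : ∀ w ∈ N, ∀ x, D.IsFace v x w → x ∈ N) (w : V) (hw : D.IsEdge v w) : w ∈ N := by
  classical
  by_contra hwN
  obtain ⟨w₀, hw₀⟩ := hN
  have hvN : v ∉ N := fun h => (hsub h).2.2.ne rfl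
  -- The indicator of the edges from `v` to `N`. A face at `v` has both or neither of its other two
  -- vertices in `N`, so `g` is closed and has a potential. A neighbour outside `N` will contradict
  -- this.
  let g : V → V → ZMod 2 := fun a b =>
    if (a = v ∧ b ∈ N) ∨ (b = v ∧ a ∈ N) then 1 else 0
  have hgsymm : ∀ a b, g a b = g b a := by
    intro a b
    simp only [g, or_comm]
  have hstep : ∀ b c, D.IsFace v b c → g v b + g b c + g c v = 0 := by
    intro b c h
    have h1 := (hD.face_edge _ _ _ h).2.2.ne
    have h2 := (hD.face_edge₃ h).2.2.ne
    have hbc : b ∈ N ↔ c ∈ N := ⟨fun hb => hcl b hb c h, fun hc => hcl' c hc b h⟩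
    by_cases hb : b ∈ N
    · simp [g, hb, hbc.1 hb, h1.symm, h2]
      exact CharTwo.add_self_eq_zero _
    · simp [g, hb, mt hbc.2 hb, h1.symm, h2]
  obtain ⟨h, hh⟩ := hD.exists_vertexPotential boundary g hgsymm (by
    intro a b c hf
    by_cases ha : a = v
    · subst ha; exact hstep b c hf
    by_cases hb : b = v
    · subst hb
      rw [← hstep c a (hD.face_rot _ _ _ hf)]; ring
    by_cases hc : c = v
    · subst hc
      rw [← hstep a b (hD.face_rot _ _ _ (hD.face_rot _ _ _ hf))]; ring
    simp [g, ha, hb, hc])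
  -- Off `v` the cochain `g` is zero and the graph is connected, so the potential is constant there.
  -- It follows that `g v w₀ = g v w`, which reads `1 = 0`.
  have hconst : ∀ a b : ↥(D.verts \ {v}), h a = h b := by
    intro a b
    obtain ⟨p⟩ := hcut a b
    induction p with
    | nil => rfl
    | @cons a b c hab _ ih =>
      refine Eq.trans ?_ ih
      have := hh a b ⟨a.2.1, b.2.1, hab⟩
      have ha := a.2.2
      have hb := b.2.2
      simp only [Set.mem_singleton_iff] at ha hb
      rw [show g a b = 0 by simp [g, ha, hb]] at this
      exact CharTwo.add_eq_zero.1 this.symm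
  have h0 := hsub hw₀
  have e1 := hconst ⟨w₀, h0.2.1, h0.2.2.ne.symm⟩ ⟨w, hw.2.1, hw.2.2.ne.symm⟩
  have e2 := hh v w₀ h0
  have e3 := hh v w hw
  rw [show g v w₀ = 1 by simp [g, hw₀]] at e2
  rw [show g v w = 0 by simp [g, hwN, hvN]] at e3
  dsimp only at e1
  rw [e1] at e2
  rw [← e3] at e2
  exact one_ne_zero e2

/-- A property that is inherited along finite regions, in both directions, and holds for the ends
of some edge holds for all vertices. -/
theorem face_induction (hD : D.IsNearTriangulation) (boundary : ∃ v ∈ D.verts, ¬ D.IsInterior v)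
    (hcut : ∀ v ∈ D.verts, (D.del v).Preconnected) (p : V → Prop) {s t : V} (hst : D.IsEdge s t)
    (hs : p s) (ht : p t) (hnext : ∀ a b c, D.IsFace a b c → p a → p b → p c) :
    ∀ v ∈ D.verts, p v := by
  -- One neighbour with the property suffices: at a non-cutvertex the faces connect all neighbours.
  have hnbrs : ∀ v w, D.IsEdge v w → p v → p w → ∀ x, D.IsEdge v x → p x := by
    intro v w hvw hv hw x hx
    have := hD.link_connected boundary (hcut v hvw.1) {w | D.IsEdge v w ∧ p w} ⟨w, hvw, hw⟩
      (fun _ h => h.1)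
      (fun w hw x hf => ⟨(hD.face_edge₃ hf).symm, hnext _ _ _ hf hv hw.2⟩)
      (fun w hw x hf => ⟨hD.face_edge _ _ _ hf,
        hnext _ _ _ (hD.face_rot _ _ _ (hD.face_rot _ _ _ hf)) hw.2 hv⟩) x hx
    exact this.2
  intro v hv
  obtain ⟨q⟩ := hD.connected.preconnected ⟨v, hv⟩ ⟨s, hst.1⟩
  -- The induction along a walk carries a neighbour with the property as well, since propagation
  -- starts from an edge and not from a single vertex.
  suffices h : ∀ a b : D.verts, (D.graph.induce D.verts).Walk a b → (b : V) = s →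
      p a ∧ ∃ w, D.IsEdge a w ∧ p w from (h _ _ q rfl).1
  intro a b q hb
  induction q with
  | nil => exact ⟨hb ▸ hs, t, hb ▸ hst, ht⟩
  | @cons a b c hab _ ih =>
    obtain ⟨h1, w, h2, h3⟩ := ih hb
    have hba : D.IsEdge b a := ⟨b.2, a.2, SimpleGraph.Adj.symm hab⟩
    exact ⟨hnbrs _ _ h2 h1 h3 _ hba, b, hba.symm, h1⟩

end IsNearTriangulation

/-! ### Mirror images -/

theorem IsFace.mirror {a b c : V} : D.mirror.IsFace a b c ↔ D.IsFace c b a := by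
  simp only [IsFace, Drawing.mirror]; tauto

/-- If every neighbour in `N` of `v` has a successor in `N`, then it has a predecessor in `N`. -/
theorem IsNearTriangulation.exists_pred (hD : D.IsNearTriangulation) (v : V) (N : Set V)
    (hN : N ⊆ {w | D.IsEdge v w}) (h : ∀ w ∈ N, ∃ x ∈ N, D.IsFace v w x) :
    ∀ x ∈ N, ∃ w ∈ N, D.IsFace v w x := by
  choose! F hF using h
  have hfin := (hD.finite_nbrs v).subset hN
  have hinj : Set.InjOn F N := by
    intro a ha b hb hab
    have h1 := hD.face_rot _ _ _ (hD.face_rot _ _ _ (hF a ha).2)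
    have h2 := hD.face_rot _ _ _ (hD.face_rot _ _ _ (hF b hb).2)
    rw [← hab] at h2
    exact hD.face_unique _ _ _ _ h1 h2
  have hsurj := ((hfin.injOn_iff_bijOn_of_mapsTo fun a ha => (hF a ha).1).1 hinj).surjOn
  intro x hx
  obtain ⟨w, hw, rfl⟩ := hsurj hx
  exact ⟨w, hw, (hF w hw).2⟩

theorem IsNearTriangulation.exists_succ (hD : D.IsNearTriangulation) (v : V) (N : Set V)
    (hN : N ⊆ {w | D.IsEdge v w}) (h : ∀ w ∈ N, ∃ x ∈ N, D.IsFace v x w) :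
    ∀ x ∈ N, ∃ w ∈ N, D.IsFace v x w := by
  choose! F hF using h
  have hfin := (hD.finite_nbrs v).subset hN
  have hinj : Set.InjOn F N := by
    intro a ha b hb hab
    have h1 := (hF a ha).2
    have h2 := (hF b hb).2
    rw [← hab] at h2
    exact hD.face_unique _ _ _ _ h1 h2
  have hsurj := ((hfin.injOn_iff_bijOn_of_mapsTo fun a ha => (hF a ha).1).1 hinj).surjOn
  intro x hx
  obtain ⟨w, hw, rfl⟩ := hsurj hx
  exact ⟨w, hw, (hF w hw).2⟩

theorem IsNearTriangulation.mirror (hD : D.IsNearTriangulation) :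
    D.mirror.IsNearTriangulation where
  finite := hD.finite
  connected := hD.connected
  face_edge a b c h := by
    rw [IsFace.mirror] at h
    exact (hD.face_edge _ _ _ (hD.face_rot _ _ _ h)).symm
  face_rot a b c h := by
    rw [IsFace.mirror] at h ⊢
    exact hD.face_rot _ _ _ (hD.face_rot _ _ _ h)
  face_unique a b c c' h h' := by
    rw [IsFace.mirror] at h h'
    exact hD.face_unique _ _ _ _ (hD.face_rot _ _ _ h) (hD.face_rot _ _ _ h')
  link v N hN hsub hcl := by
    refine hD.link v N hN hsub (hD.exists_succ v N hsub fun w hw => ?_)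
    obtain ⟨x, hx, hf⟩ := hcl w hw
    rw [IsFace.mirror] at hf
    exact ⟨x, hx, hD.face_rot _ _ _ (hD.face_rot _ _ _ hf)⟩
  euler := by
    have h := hD.euler
    have : {q : V × V × V | D.mirror.IsFace q.1 q.2.1 q.2.2} =
        (fun q : V × V × V => (q.2.2, q.2.1, q.1)) '' {q | D.IsFace q.1 q.2.1 q.2.2} := by
      ext ⟨a, b, c⟩
      constructor
      · intro h
        exact ⟨(c, b, a), IsFace.mirror.1 h, rfl⟩
      · rintro ⟨⟨a', b', c'⟩, h, hq⟩
        simp only [Prod.mk.injEq] at hq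
        obtain ⟨rfl, rfl, rfl⟩ := hq
        exact IsFace.mirror.2 h
    rw [this, Set.ncard_image_of_injective]
    · exact h
    · rintro ⟨a, b, c⟩ ⟨a', b', c'⟩ h
      simp only [Prod.mk.injEq] at h ⊢
      tauto

/-- Being interior is defined by successors; by finiteness predecessors give the same notion. -/
theorem IsNearTriangulation.isInterior_mirror (hD : D.IsNearTriangulation) {v : V} :
    D.mirror.IsInterior v ↔ D.IsInterior v := by
  unfold IsInterior
  refine and_congr Iff.rfl ⟨fun h => ?_, fun h => ?_⟩
  · intro w hw
    obtain ⟨x, -, hx⟩ := hD.exists_succ v {w | D.IsEdge v w} subset_rfl (fun w hw => by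
      obtain ⟨x, hx⟩ := h w hw
      rw [IsFace.mirror] at hx
      have hx' := hD.face_rot _ _ _ (hD.face_rot _ _ _ hx)
      exact ⟨x, hD.face_edge _ _ _ hx', hx'⟩) w hw
    exact ⟨x, hx⟩
  · intro w hw
    obtain ⟨x, -, hx⟩ := hD.exists_pred v {w | D.IsEdge v w} subset_rfl (fun w hw => by
      obtain ⟨x, hx⟩ := h w hw
      exact ⟨x, (hD.face_edge₃ hx).symm, hx⟩) w hw
    exact ⟨x, IsFace.mirror.2 (hD.face_rot _ _ _ hx)⟩

/-! ### Transfer along isomorphisms -/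

theorem OrientIso.isEdge_iff (h : D.OrientIso E f) {a b : V} (ha : a ∈ D.verts) (hb : b ∈ D.verts) :
    E.IsEdge (f a) (f b) ↔ D.IsEdge a b :=
  ⟨fun e => ⟨ha, hb, (h.2.1 a ha b hb).2 e.2.2⟩,
    fun e => ⟨h.1.mapsTo ha, h.1.mapsTo hb, (h.2.1 a ha b hb).1 e.2.2⟩⟩

theorem OrientIso.map_edge (h : D.OrientIso E f) {a b : V} (e : D.IsEdge a b) :
    E.IsEdge (f a) (f b) := (h.isEdge_iff e.1 e.2.1).2 e

theorem OrientIso.isFace_iff (h : D.OrientIso E f) {a b c : V} (ha : a ∈ D.verts)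
    (hb : b ∈ D.verts) (hc : c ∈ D.verts) : E.IsFace (f a) (f b) (f c) ↔ D.IsFace a b c :=
  ⟨fun e => ⟨ha, hb, hc, (h.2.2 a ha b hb c hc).2 e.2.2.2⟩,
    fun e => ⟨h.1.mapsTo ha, h.1.mapsTo hb, h.1.mapsTo hc, (h.2.2 a ha b hb c hc).1 e.2.2.2⟩⟩

theorem OrientIso.map_face (h : D.OrientIso E f) {a b c : V} (e : D.IsFace a b c) :
    E.IsFace (f a) (f b) (f c) := (h.isFace_iff e.1 e.2.1 e.2.2.1).2 e

theorem OrientIso.surj (h : D.OrientIso E f) {y : V'} (hy : y ∈ E.verts) :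
    ∃ x ∈ D.verts, f x = y := h.1.surjOn hy

theorem OrientIso.image_nbrs (h : D.OrientIso E f) {v : V} (hv : v ∈ D.verts) :
    f '' {w | D.IsEdge v w} = {w | E.IsEdge (f v) w} := by
  ext w
  constructor
  · rintro ⟨w, hw, rfl⟩
    exact h.map_edge hw
  · intro hw
    obtain ⟨w, hw', rfl⟩ := h.surj hw.2.1
    exact ⟨w, (h.isEdge_iff hv hw').1 hw, rfl⟩

theorem OrientIso.deg_eq (h : D.OrientIso E f) {v : V} (hv : v ∈ D.verts) :
    E.deg (f v) = D.deg v := by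
  rw [deg, ← h.image_nbrs hv, Set.InjOn.ncard_image]
  · rfl
  · exact h.1.injOn.mono fun _ hw => hw.2.1

theorem OrientIso.isInterior_iff (h : D.OrientIso E f) {v : V} (hv : v ∈ D.verts) :
    E.IsInterior (f v) ↔ D.IsInterior v := by
  constructor
  · rintro ⟨⟨w, hw⟩, hall⟩
    obtain ⟨w, hw', rfl⟩ := h.surj hw.2.1
    refine ⟨⟨w, (h.isEdge_iff hv hw').1 hw⟩, fun w hw => ?_⟩
    obtain ⟨x, hx⟩ := hall _ (h.map_edge hw)
    obtain ⟨x, hx', rfl⟩ := h.surj hx.2.2.1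
    exact ⟨x, (h.isFace_iff hv hw.2.1 hx').1 hx⟩
  · rintro ⟨⟨w, hw⟩, hall⟩
    refine ⟨⟨f w, h.map_edge hw⟩, fun w hw => ?_⟩
    obtain ⟨w, hw', rfl⟩ := h.surj hw.2.1
    obtain ⟨x, hx⟩ := hall w ((h.isEdge_iff hv hw').1 hw)
    exact ⟨f x, h.map_face hx⟩

/-- An isomorphism of drawings restricts to isomorphisms of graphs. -/
noncomputable def OrientIso.induceIso (h : D.OrientIso E f) {X : Set V} {Y : Set V'}
    (hX : X ⊆ D.verts) (hXY : Set.BijOn f X Y) : D.graph.induce X ≃g E.graph.induce Y where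
  toEquiv := hXY.equiv f
  map_rel_iff' {a b} := (h.2.1 a (hX a.2) b (hX b.2)).symm

theorem OrientIso.del_preconnected (h : D.OrientIso E f) {v : V} (hv : v ∈ D.verts)
    (hcut : (D.del v).Preconnected) : (E.del (f v)).Preconnected := by
  refine (h.induceIso (X := D.verts \ {v}) (Y := E.verts \ {f v}) Set.sdiff_subset
    ⟨?_, ?_, ?_⟩).preconnected_iff.1 hcut
  · rintro w ⟨hw, hne⟩
    exact ⟨h.1.mapsTo hw, fun he => hne (h.1.injOn hw hv he)⟩
  · exact h.1.injOn.mono Set.sdiff_subset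
  · rintro y ⟨hy, hne⟩
    obtain ⟨w, hw, rfl⟩ := h.surj hy
    exact ⟨w, ⟨hw, fun he => hne (congrArg f he)⟩, rfl⟩

theorem OrientIso.isNearTriangulation (h : D.OrientIso E f) (hD : D.IsNearTriangulation) :
    E.IsNearTriangulation where
  finite := h.1.image_eq ▸ hD.finite.image f
  connected := (h.induceIso subset_rfl h.1).connected_iff.1 hD.connected
  face_edge a b c hf := by
    obtain ⟨a, ha, rfl⟩ := h.surj hf.1
    obtain ⟨b, hb, rfl⟩ := h.surj hf.2.1
    obtain ⟨c, hc, rfl⟩ := h.surj hf.2.2.1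
    exact h.map_edge (hD.face_edge a b c ((h.isFace_iff ha hb hc).1 hf))
  face_rot a b c hf := by
    obtain ⟨a, ha, rfl⟩ := h.surj hf.1
    obtain ⟨b, hb, rfl⟩ := h.surj hf.2.1
    obtain ⟨c, hc, rfl⟩ := h.surj hf.2.2.1
    exact h.map_face (hD.face_rot a b c ((h.isFace_iff ha hb hc).1 hf))
  face_unique a b c c' hf hf' := by
    obtain ⟨a, ha, rfl⟩ := h.surj hf.1
    obtain ⟨b, hb, rfl⟩ := h.surj hf.2.1
    obtain ⟨c, hc, rfl⟩ := h.surj hf.2.2.1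
    obtain ⟨c', hc', rfl⟩ := h.surj hf'.2.2.1
    rw [hD.face_unique a b c c' ((h.isFace_iff ha hb hc).1 hf) ((h.isFace_iff ha hb hc').1 hf')]
  link v N hN hsub hcl := by
    obtain ⟨y, hy⟩ := hN
    obtain ⟨v, hv, rfl⟩ := h.surj (hsub hy).1
    obtain ⟨x, hx, rfl⟩ := h.surj (hsub hy).2.1
    have := hD.link v {w | w ∈ D.verts ∧ f w ∈ N} ⟨x, hx, hy⟩
      (fun w hw => (h.isEdge_iff hv hw.1).1 (hsub hw.2)) (by
        rintro w ⟨hw, hwN⟩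
        obtain ⟨x, hxN, hf⟩ := hcl _ hwN
        obtain ⟨x, hx, rfl⟩ := h.surj hf.2.2.1
        exact ⟨x, ⟨hx, hxN⟩, (h.isFace_iff hv hw hx).1 hf⟩)
    rw [← h.image_nbrs hv, ← this]
    refine Set.Subset.antisymm (fun y hy => ?_) ?_
    · obtain ⟨x, hx, rfl⟩ := h.surj (hsub hy).2.1
      exact ⟨x, ⟨hx, hy⟩, rfl⟩
    · rintro _ ⟨x, hx, rfl⟩
      exact hx.2
  euler := by
    have hV : E.verts.ncard = D.verts.ncard := (Set.BijOn.ncard_eq h.1).symm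
    have hF : {q : V' × V' × V' | E.IsFace q.1 q.2.1 q.2.2} =
        (fun q : V × V × V => (f q.1, f q.2.1, f q.2.2)) '' {q | D.IsFace q.1 q.2.1 q.2.2} := by
      ext ⟨a, b, c⟩
      constructor
      · intro hf
        obtain ⟨a, ha, rfl⟩ := h.surj hf.1
        obtain ⟨b, hb, rfl⟩ := h.surj hf.2.1
        obtain ⟨c, hc, rfl⟩ := h.surj hf.2.2.1
        exact ⟨(a, b, c), (h.isFace_iff ha hb hc).1 hf, rfl⟩
      · rintro ⟨⟨a', b', c'⟩, hf, hq⟩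
        simp only [Prod.mk.injEq] at hq
        obtain ⟨rfl, rfl, rfl⟩ := hq
        exact h.map_face hf
    have hE : {q : V' × V' | E.IsEdge q.1 q.2} =
        (fun q : V × V => (f q.1, f q.2)) '' {q | D.IsEdge q.1 q.2} := by
      ext ⟨a, b⟩
      constructor
      · intro hf
        obtain ⟨a, ha, rfl⟩ := h.surj hf.1
        obtain ⟨b, hb, rfl⟩ := h.surj hf.2.1
        exact ⟨(a, b), (h.isEdge_iff ha hb).1 hf, rfl⟩
      · rintro ⟨⟨a', b'⟩, hf, hq⟩
        simp only [Prod.mk.injEq] at hq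
        obtain ⟨rfl, rfl⟩ := hq
        exact h.map_edge hf
    rw [hV, hF, hE, Set.InjOn.ncard_image, Set.InjOn.ncard_image]
    · exact hD.euler
    · rintro ⟨a, b⟩ h1 ⟨a', b'⟩ h2 hq
      simp only [Prod.mk.injEq] at hq ⊢
      exact ⟨h.1.injOn h1.1 h2.1 hq.1, h.1.injOn h1.2.1 h2.2.1 hq.2⟩
    · rintro ⟨a, b, c⟩ h1 ⟨a', b', c'⟩ h2 hq
      simp only [Prod.mk.injEq] at hq ⊢
      exact ⟨h.1.injOn h1.1 h2.1 hq.1, h.1.injOn h1.2.1 h2.2.1 hq.2.1,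
        h.1.injOn h1.2.2.1 h2.2.2.1 hq.2.2⟩

end Drawing

/-! ### Configurations -/

namespace Config

variable {V : Type} {K L : Config V}

/-- Without boundary vertices the ring size would be an empty sum. This supplies the hypothesis
needed for the vanishing of cohomology. -/
theorem IsConfiguration.exists_boundary (hK : K.IsConfiguration) :
    ∃ v ∈ K.verts, ¬ K.IsInterior v := by
  by_contra! hcon
  have h := hK.two_le_ringSize
  rw [ringSize, show {v | v ∈ K.verts ∧ ¬ K.IsInterior v ∧ (K.del v).Preconnected} = ∅ from ?_] at h
  · simp at h
  · ext v
    simp only [Set.mem_ofPred_eq, Set.mem_empty_iff_false, iff_false]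
    exact fun hv => hv.2.1 (hcon v hv.1)

theorem IsConfiguration.mirror (hK : K.IsConfiguration) :
    IsConfiguration { K with toDrawing := K.toDrawing.mirror } where
  nearTriangulation := hK.nearTriangulation.mirror
  components := hK.components
  interior v hv hint := hK.interior v hv (hK.nearTriangulation.isInterior_mirror.1 hint)
  boundary v hv hint := hK.boundary v hv (mt hK.nearTriangulation.isInterior_mirror.2 hint)
  five_le := hK.five_le
  two_le_ringSize := by
    have h := hK.two_le_ringSize
    unfold ringSize at h ⊢
    simp only [hK.nearTriangulation.isInterior_mirror]
    exact h

theorem finsum_mem_ge_two {S : Set V} (hS : S.Finite) {φ : V → ℤ} (h0 : ∀ v ∈ S, 0 ≤ φ v)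
    (h : (∃ v ∈ S, 2 ≤ φ v) ∨ ∃ v ∈ S, ∃ w ∈ S, v ≠ w ∧ 1 ≤ φ v ∧ 1 ≤ φ w) :
    2 ≤ ∑ᶠ v ∈ S, φ v := by
  classical
  rw [finsum_mem_eq_finite_toFinset_sum _ hS]
  rcases h with ⟨v, hv, h⟩ | ⟨v, hv, w, hw, hne, h1, h2⟩
  · exact h.trans (Finset.single_le_sum (f := φ) (fun i hi => h0 i (hS.mem_toFinset.1 hi))
      (hS.mem_toFinset.2 hv))
  · have : ∑ x ∈ ({v, w} : Finset V), φ x ≤ ∑ x ∈ hS.toFinset, φ x := by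
      refine Finset.sum_le_sum_of_subset_of_nonneg ?_ fun i hi _ => h0 i (hS.mem_toFinset.1 hi)
      intro x hx
      simp only [Finset.mem_insert, Finset.mem_singleton] at hx
      rcases hx with rfl | rfl
      exacts [hS.mem_toFinset.2 hv, hS.mem_toFinset.2 hw]
    rw [Finset.sum_pair hne] at this
    linarith

/-- A change of large values of `γ` at vertices of small degree does not matter. -/
theorem IsConfiguration.congr_large (hK : K.IsConfiguration) (hKL : L.toDrawing = K.toDrawing)
    (hγ : ∀ v ∈ K.verts, L.γ v = K.γ v ∨ (12 ≤ K.γ v ∧ 12 ≤ L.γ v ∧ K.deg v ≤ 4)) :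
    L.IsConfiguration := by
  obtain ⟨L₀, γ⟩ := L
  obtain ⟨K₀, γ'⟩ := K
  obtain rfl : L₀ = K₀ := hKL
  have hcomp : ∀ v ∈ L₀.verts, Nat.card (L₀.del v).ConnectedComponent ≤ 2 := fun v hv =>
    (hK.components v hv).1
  have hbd : ∀ v ∈ L₀.verts, ¬ L₀.IsInterior v → L₀.deg v < γ v := by
    intro v hv hint
    rcases hγ v hv with h | ⟨h1, h2, h3⟩
    · dsimp only at h
      rw [h]; exact hK.boundary v hv hint
    · dsimp only at h1 h2 h3; omega
  refine ⟨hK.nearTriangulation, fun v hv => ⟨hcomp v hv, fun h2 => ?_⟩, fun v hv hint => ?_, hbd,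
    fun v hv => ?_, ?_⟩
  · have := (hK.components v hv).2 h2
    rcases hγ v hv with h | ⟨h1, h2, h3⟩ <;> dsimp only at * <;> omega
  · have := hK.interior v hv hint
    rcases hγ v hv with h | ⟨h1, h2, h3⟩ <;> dsimp only at * <;> omega
  · have := hK.five_le v hv
    rcases hγ v hv with h | ⟨h1, h2, h3⟩ <;> dsimp only at * <;> omega
  -- If some value changes, that vertex alone contributes at least `12 - 4 - 1`. It does enter the
  -- sum: being interior would give it `γ = deg ≤ 4`, and being a cutvertex would give it `γ = deg +
  -- 2 ≤ 6`.
  · by_cases hall : ∀ v ∈ L₀.verts, γ v = γ' v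
    · have h := hK.two_le_ringSize
      unfold ringSize at h ⊢
      refine h.trans_eq (finsum_mem_congr rfl fun v hv => ?_)
      dsimp only
      rw [hall v hv.1]
    · push Not at hall
      obtain ⟨v, hv, hne⟩ := hall
      obtain ⟨h1, h2, h3⟩ := (hγ v hv).resolve_left hne
      dsimp only at h1 h2 h3
      refine finsum_mem_ge_two (hK.nearTriangulation.finite.subset fun _ h => h.1) ?_
        (Or.inl ⟨v, ⟨hv, fun hint => ?_, ?_⟩, ?_⟩)
      · intro w hw
        have := hbd w hw.1 hw.2.1
        dsimp only
        omega
      · have := hK.interior v hv hint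
        dsimp only at this
        omega
      · have hle := hcomp v hv
        have hne : Nat.card (L₀.del v).ConnectedComponent ≠ 2 := fun h => by
          have := (hK.components v hv).2 h
          dsimp only at this
          omega
        have hfin : Finite ↥(L₀.verts \ {v}) :=
          (hK.nearTriangulation.finite.subset Set.sdiff_subset).to_subtype
        have : Finite (L₀.del v).ConnectedComponent := Quot.finite _
        have hsub : Subsingleton (L₀.del v).ConnectedComponent :=
          Finite.card_le_one_iff_subsingleton.1 (by omega)
        intro a b
        exact SimpleGraph.ConnectedComponent.exact (hsub.elim _ _)
      · dsimp only; omega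

end Config

/-! ### The combinatorics of cartwheels -/

namespace Vert

variable {d : ℕ}

/-- Rotation by `c` spokes. -/
def rot (c : ZMod d) : Vert d → Vert d
  | hub => hub
  | rim j i => rim j (i + c)

@[simp] theorem rot_hub (c : ZMod d) : rot c hub = hub := rfl

@[simp] theorem rot_rim (c : ZMod d) (j : ℕ) (i : ZMod d) : rot c (rim j i) = rim j (i + c) := rfl

@[simp] theorem rot_neg_rot (c : ZMod d) (v : Vert d) : rot (-c) (rot c v) = v := by
  cases v <;> simp

@[simp] theorem rot_zero (v : Vert d) : rot 0 v = v := by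
  cases v <;> simp

theorem rot_injective (c : ZMod d) : Function.Injective (rot (d := d) c) :=
  Function.LeftInverse.injective (rot_neg_rot c)

end Vert

theorem ZMod.natCast_ne_zero_of_lt {d n : ℕ} (h0 : 0 < n) (h : n < d) : (n : ZMod d) ≠ 0 := by
  rw [Ne, ZMod.natCast_eq_zero_iff]
  exact fun hdvd => absurd (Nat.le_of_dvd h0 hdvd) (not_le.2 h)

namespace Cartwheel

open Vert

variable {d : ℕ} (W : Cartwheel d)

theorem one_ne_zero_zmod (W : Cartwheel d) : (1 : ZMod d) ≠ 0 := by
  have := W.five_le_deg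
  exact_mod_cast ZMod.natCast_ne_zero_of_lt (d := d) (n := 1) (by norm_num) (by omega)

theorem two_ne_zero_zmod (W : Cartwheel d) : (2 : ZMod d) ≠ 0 := by
  have := W.five_le_deg
  exact_mod_cast ZMod.natCast_ne_zero_of_lt (d := d) (n := 2) (by norm_num) (by omega)

theorem outer_one (i : ZMod d) : W.outer i 1 = rim 1 (i - 1) := by simp [outer]

variable {W} in
theorem outer_fan {i : ZMod d} {j : ℕ} (h : j + 6 ≤ W.γ (rim 0 i)) :
    W.outer i (j + 2) = rim (j + 2) i := by
  rw [outer, if_neg (by omega), if_pos (by omega)]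

variable {W} in
theorem outer_hat {i : ZMod d} {j : ℕ} (h : W.γ (rim 0 i) < j + 6) :
    W.outer i (j + 2) = rim 1 i := by
  rw [outer, if_neg (by omega), if_neg (by omega)]

theorem outer_last (i : ZMod d) : W.outer i (W.γ (rim 0 i) - 3) = rim 1 i := by
  have := W.five_le (rim 0 i)
  rw [outer, if_neg (by omega), if_neg (by omega)]

theorem outer_cases (i : ZMod d) (j : ℕ) : W.outer i j = rim 1 (i - 1) ∨ W.outer i j = rim 1 i ∨
    2 ≤ j ∧ j + 4 ≤ W.γ (rim 0 i) ∧ W.outer i j = rim j i := by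
  unfold outer
  split_ifs with h1 h2
  · exact Or.inl rfl
  · exact Or.inr (Or.inr ⟨by omega, h2, rfl⟩)
  · exact Or.inr (Or.inl rfl)

/-- What the third vertex of a finite region with two given vertices can be. -/
def ThirdOf (W : Cartwheel d) : Vert d → Vert d → Vert d → Prop
  | hub, rim 0 i, c => c = rim 0 (i + 1)
  | rim 0 i, hub, c => c = rim 0 (i - 1)
  | rim 0 i, rim 0 k, c => (k = i + 1 ∧ c = hub) ∨ (i = k + 1 ∧ c = rim 1 k)
  | rim 0 i, rim 1 k, c => (k = i ∧ c = rim 0 (i + 1)) ∨ (i = k + 1 ∧ c = W.outer i 2)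
  | rim 0 i, rim (j + 2) k, c => k = i ∧ j + 6 ≤ W.γ (rim 0 i) ∧ c = W.outer i (j + 3)
  | rim 1 k, rim 0 i, c =>
    (i = k + 1 ∧ c = rim 0 k) ∨ (k = i ∧ c = W.outer i (W.γ (rim 0 i) - 4))
  | rim (j + 2) k, rim 0 i, c => k = i ∧ j + 6 ≤ W.γ (rim 0 i) ∧ c = W.outer i (j + 1)
  | rim (_ + 1) _, rim (_ + 1) i, c => c = rim 0 i
  | _, _, _ => False

variable {W}

/-- The three rotations have to be treated together because `Cw` is closed under rotation. Of two
consecutive vertices of the path over spoke `i`, the second always carries the index `i`, whereas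
the first may be the hat `i - 1`; this explains the clause of `ThirdOf` for two outer vertices. -/
theorem Cw.thirdOf_all {a b c : Vert d} (h : W.Cw a b c) :
    W.ThirdOf a b c ∧ W.ThirdOf b c a ∧ W.ThirdOf c a b := by
  induction h with
  | spokes i => simp [ThirdOf]
  | hat i => simp [ThirdOf]
  | rot a b c _ ih => exact ⟨ih.2.1, ih.2.2, ih.1⟩
  | fan i j h1 h2 =>
    obtain _ | _ | n := j
    · omega
    · rw [zero_add, outer_one]
      by_cases h6 : 0 + 6 ≤ W.γ (rim 0 i)
      · have e : W.outer i (1 + 1) = rim 2 i := outer_fan h6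
        have e1 := W.outer_one i
        rw [e]
        simp [ThirdOf, e.symm, e1]
        simpa [e] using h6
      · have e : W.outer i (1 + 1) = rim 1 i := outer_hat (not_le.1 h6)
        have e1 := W.outer_one i
        have h5 : W.γ (rim 0 i) - 4 = 1 := by omega
        rw [e]
        simp [ThirdOf, e.symm]
        simp [h5, e1]
    · rw [outer_fan (by omega)]
      by_cases h6 : (n + 1) + 6 ≤ W.γ (rim 0 i)
      · have e : W.outer i (n + 1 + 1 + 1) = rim (n + 3) i := outer_fan h6
        have e1 : W.outer i (n + 2) = rim (n + 2) i := outer_fan (by omega)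
        rw [e]
        simp [ThirdOf, e, e1]
        omega
      · have e : W.outer i (n + 1 + 1 + 1) = rim 1 i := outer_hat (not_le.1 h6)
        have e1 : W.outer i (n + 2) = rim (n + 2) i := outer_fan (by omega)
        have h5 : W.γ (rim 0 i) - 4 = n + 2 := by omega
        rw [e]
        simp [ThirdOf, e, e1, h5]
        omega

theorem Cw.thirdOf {a b c : Vert d} (h : W.Cw a b c) : W.ThirdOf a b c := h.thirdOf_all.1

theorem rot_outer {W₀ : Cartwheel d} {c i : ZMod d}
    (h : W₀.γ (rim 0 i) = W.γ (rim 0 (i + c))) (j : ℕ) :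
    Vert.rot c (W₀.outer i j) = W.outer (i + c) j := by
  unfold outer
  rw [← h]
  split_ifs
  · simp; ring
  · simp
  · simp

/-- Two cartwheels have the same third vertices as long as the degrees of the spokes involved
agree. -/
theorem ThirdOf.rot_eq {W₀ : Cartwheel d} {c : ZMod d} {a b e e' : Vert d}
    (h₀ : W₀.ThirdOf a b e) (h : W.ThirdOf (Vert.rot c a) (Vert.rot c b) e')
    (hγ : ∀ i, a = rim 0 i ∨ b = rim 0 i →
      (∃ j, 2 ≤ j ∧ (a = rim j i ∨ b = rim j i ∨ e = rim j i ∨ e' = rim j (i + c))) →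
      W₀.γ (rim 0 i) = W.γ (rim 0 (i + c))) :
    e' = Vert.rot c e := by
  have hne1 := W.one_ne_zero_zmod
  have hne2 := W.two_ne_zero_zmod
  -- If the two degrees of the spoke differ, the hypothesis `hγ` forbids `e` and `e'` to be fans.
  -- Indices at least 2 then both give the hat `i`. For the indices just before the last hat, not
  -- being a fan forces both degrees to be 5, a contradiction.
  have key : ∀ i n m, (a = rim 0 i ∨ b = rim 0 i) → e = W₀.outer i n → e' = W.outer (i + c) m →
      (W₀.γ (rim 0 i) = W.γ (rim 0 (i + c)) → n = m) →
      (W₀.γ (rim 0 i) = 5 → W.γ (rim 0 (i + c)) = 5 → n = m) →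
      (2 ≤ n ∧ 2 ≤ m ∨ n + 4 = W₀.γ (rim 0 i) ∧ m + 4 = W.γ (rim 0 (i + c))) →
      e' = Vert.rot c e := by
    intro i n m hab he he' heq heq5 hcase
    have hg := W₀.five_le (rim 0 i)
    have hg' := W.five_le (rim 0 (i + c))
    by_cases h : W₀.γ (rim 0 i) = W.γ (rim 0 (i + c))
    · rw [he, he', rot_outer h, heq h]
    · have h1 : ¬ (2 ≤ n ∧ n + 4 ≤ W₀.γ (rim 0 i)) := fun hn =>
        h (hγ i hab ⟨n, hn.1, Or.inr (Or.inr (Or.inl (by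
          rw [he, outer, if_neg (by omega), if_pos hn.2])))⟩)
      have h2 : ¬ (2 ≤ m ∧ m + 4 ≤ W.γ (rim 0 (i + c))) := fun hn =>
        h (hγ i hab ⟨m, hn.1, Or.inr (Or.inr (Or.inr (by
          rw [he', outer, if_neg (by omega), if_pos hn.2])))⟩)
      rcases hcase with hc | hc
      · rw [he, he', outer, outer, if_neg (by omega), if_neg (by omega), if_neg (by omega),
          if_neg (by omega)]
        simp
      · omega
  match a, b, h₀, h, hγ, key with
  | hub, hub, h₀, h, hγ, key => exact h₀.elim
  | hub, rim 0 i, h₀, h, hγ, key =>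
    simp only [ThirdOf, rot_hub, rot_rim] at h₀ h
    rw [h₀, h, rot_rim]; congr 1; ring
  | hub, rim (j + 1) i, h₀, h, hγ, key => exact h₀.elim
  | rim 0 i, hub, h₀, h, hγ, key =>
    simp only [ThirdOf, rot_hub, rot_rim] at h₀ h
    rw [h₀, h, rot_rim]; congr 1; ring
  | rim 0 i, rim 0 k, h₀, h, hγ, key =>
    simp only [ThirdOf, rot_rim] at h₀ h
    rcases h₀ with ⟨rfl, rfl⟩ | ⟨rfl, rfl⟩ <;> rcases h with ⟨hk, rfl⟩ | ⟨hk, rfl⟩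
    · rfl
    · exact absurd (by linear_combination -hk) hne2
    · exact absurd (by linear_combination -hk) hne2
    · rfl
  | rim 0 i, rim 1 k, h₀, h, hγ, key =>
    simp only [ThirdOf, rot_rim] at h₀ h
    rcases h₀ with ⟨h₀, he⟩ | ⟨h₀, he⟩ <;> rcases h with ⟨h, he'⟩ | ⟨h, he'⟩
    · rw [he, he', rot_rim]; congr 1; ring
    · exact absurd (by linear_combination -h - h₀) hne1
    · exact absurd (by linear_combination -h - h₀) hne1
    · exact key i 2 2 (Or.inl rfl) he he' (fun _ => rfl) (fun _ _ => rfl)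
        (Or.inl ⟨le_rfl, le_rfl⟩)
  | rim 0 i, rim (j + 2) k, h₀, h, hγ, key =>
    simp only [ThirdOf, rot_rim] at h₀ h
    obtain ⟨rfl, h1, he⟩ := h₀
    obtain ⟨-, h2, he'⟩ := h
    exact key k (j + 3) (j + 3) (Or.inl rfl) he he' (fun _ => rfl) (fun _ _ => rfl)
      (Or.inl ⟨by omega, by omega⟩)
  | rim 1 k, rim 0 i, h₀, h, hγ, key =>
    simp only [ThirdOf, rot_rim] at h₀ h
    rcases h₀ with ⟨h₀, he⟩ | ⟨h₀, he⟩ <;> rcases h with ⟨h, he'⟩ | ⟨h, he'⟩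
    · rw [he, he', rot_rim]
    · exact absurd (by linear_combination -h - h₀) hne1
    · exact absurd (by linear_combination -h - h₀) hne1
    · have hg := W₀.five_le (rim 0 i)
      have hg' := W.five_le (rim 0 (i + c))
      exact key i _ _ (Or.inr rfl) he he' (fun h => by rw [h]) (fun h h' => by rw [h, h'])
        (Or.inr ⟨by omega, by omega⟩)
  | rim (j + 2) k, rim 0 i, h₀, h, hγ, key =>
    simp only [ThirdOf, rot_rim] at h₀ h
    obtain ⟨rfl, h1, he⟩ := h₀
    obtain ⟨-, h2, he'⟩ := h
    have := hγ k (Or.inr rfl) ⟨j + 2, by omega, Or.inl rfl⟩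
    rw [he, he', rot_outer this]
  | rim (j + 1) k, rim (l + 1) i, h₀, h, hγ, key =>
    simp only [ThirdOf, rot_rim] at h₀ h
    rw [h₀, h, rot_rim]
  | rim (j + 1) k, hub, h₀, h, hγ, key => obtain _ | j := j <;> exact h₀.elim

/-- The edges of a cartwheel. -/
inductive Ed (W : Cartwheel d) : Vert d → Vert d → Prop
  | hub (i : ZMod d) : Ed W Vert.hub (rim 0 i)
  | spoke (i : ZMod d) : Ed W (rim 0 i) (rim 0 (i + 1))
  | outer (i : ZMod d) (j : ℕ) (h1 : 1 ≤ j) (h2 : j + 3 ≤ W.γ (rim 0 i)) :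
      Ed W (rim 0 i) (W.outer i j)
  | path (i : ZMod d) (j : ℕ) (h1 : 1 ≤ j) (h2 : j + 4 ≤ W.γ (rim 0 i)) :
      Ed W (W.outer i j) (W.outer i (j + 1))
  | symm (a b : Vert d) (h : Ed W a b) : Ed W b a

variable (W) in
theorem ed_hat (i : ZMod d) : W.Ed (rim 0 i) (rim 1 i) := by
  have := Ed.outer (W := W) i (W.γ (rim 0 i) - 3) (by have := W.five_le (rim 0 i); omega)
    (by have := W.five_le (rim 0 i); omega)
  rwa [outer_last] at this

variable (W) in
theorem ed_hat_pred (i : ZMod d) : W.Ed (rim 0 i) (rim 1 (i - 1)) := by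
  have := Ed.outer (W := W) i 1 le_rfl (by have := W.five_le (rim 0 i); omega)
  rwa [outer_one] at this

theorem Cw.ed_all {a b c : Vert d} (h : W.Cw a b c) : W.Ed a b ∧ W.Ed b c ∧ W.Ed c a := by
  induction h with
  | spokes i => exact ⟨.hub i, .spoke i, .symm _ _ (.hub _)⟩
  | hat i =>
    refine ⟨.symm _ _ (.spoke i), W.ed_hat i, .symm _ _ ?_⟩
    simpa using W.ed_hat_pred (i + 1)
  | fan i j h1 h2 =>
    exact ⟨.outer i j h1 (by omega), .path i j h1 h2, .symm _ _ (.outer i (j + 1) (by omega)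
      (by omega))⟩
  | rot a b c _ ih => exact ⟨ih.2.1, ih.2.2, ih.1⟩

theorem outer_ne_succ (W : Cartwheel d) {i : ZMod d} {j : ℕ} (h1 : 1 ≤ j)
    (h2 : j + 4 ≤ W.γ (rim 0 i)) : W.outer i j ≠ W.outer i (j + 1) := by
  have hne := W.one_ne_zero_zmod
  unfold outer
  split_ifs <;> simp <;> omega

theorem Ed.ne {a b : Vert d} (h : W.Ed a b) : a ≠ b := by
  have hne := W.one_ne_zero_zmod
  induction h with
  | hub i => simp
  | spoke i => simp [hne]
  | outer i j h1 h2 =>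
    rcases W.outer_cases i j with h | h | ⟨h, -, h'⟩
    · simp [h]
    · simp [h]
    · rw [h']; simp; omega
  | path i j h1 h2 => exact W.outer_ne_succ h1 h2
  | symm a b _ ih => exact ih.symm

theorem Ed.exists_cw {a b : Vert d} (h : W.Ed a b) : ∃ c, W.Cw a b c ∨ W.Cw b a c := by
  induction h with
  | hub i => exact ⟨_, Or.inl (.spokes i)⟩
  | spoke i => exact ⟨_, Or.inl (.rot _ _ _ (.spokes i))⟩
  | outer i j h1 h2 =>
    by_cases h : j + 4 ≤ W.γ (rim 0 i)
    · exact ⟨_, Or.inl (.fan i j h1 h)⟩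
    · have := W.five_le (rim 0 i)
      have := Cw.rot _ _ _ (Cw.rot _ _ _ (Cw.fan (W := W) i (j - 1) (by omega) (by omega)))
      rw [show j - 1 + 1 = j by omega] at this
      exact ⟨_, Or.inr this⟩
  | path i j h1 h2 => exact ⟨_, Or.inl (.rot _ _ _ (.fan i j h1 h2))⟩
  | symm a b _ ih => exact ih.imp fun _ => Or.symm

theorem adj_iff {a b : Vert d} : W.config.graph.Adj a b ↔ W.Ed a b := by
  constructor
  · rintro ⟨-, c, h | h⟩
    · exact h.ed_all.1
    · exact .symm _ _ h.ed_all.1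
  · exact fun h => ⟨h.ne, h.exists_cw⟩

/-- `W₀` and, rotated by `c`, `W` induce the same drawing on `X`. -/
structure Agree (W₀ W : Cartwheel d) (c : ZMod d) (X : Set (Vert d)) : Prop where
  fan : ∀ j i, 2 ≤ j → rim j i ∈ X → W₀.γ (rim 0 i) = W.γ (rim 0 (i + c))
  hats : ∀ i, rim 1 (i - 1) ∈ X → rim 1 i ∈ X →
    (W₀.γ (rim 0 i) = 5 ↔ W.γ (rim 0 (i + c)) = 5)

namespace Agree

variable {W₀ : Cartwheel d} {c : ZMod d} {X : Set (Vert d)}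

theorem symm (h : Agree W₀ W c X) : Agree W W₀ (-c) (Vert.rot c '' X) where
  fan j i hj := by
    rintro ⟨v, hv, hvi⟩
    obtain rfl : v = rim j (i + -c) := by rw [← rot_neg_rot c v, hvi, rot_rim]
    simpa using (h.fan j _ hj hv).symm
  hats i := by
    rintro ⟨v, hv, hvi⟩ ⟨w, hw, hwi⟩
    obtain rfl : v = rim 1 (i - 1 + -c) := by rw [← rot_neg_rot c v, hvi, rot_rim]
    obtain rfl : w = rim 1 (i + -c) := by rw [← rot_neg_rot c w, hwi, rot_rim]
    simpa using (h.hats (i + -c) (by convert hv using 2; ring) hw).symm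

/-- Two consecutive vertices of the path over a spoke determine its degree as far as needed: either
one of them is a fan, or both are hats and the degree is 5. -/
theorem outer_pair (h : Agree W₀ W c X) {i : ZMod d} {j : ℕ} (h1 : 1 ≤ j)
    (h2 : j + 4 ≤ W₀.γ (rim 0 i)) (hX : W₀.outer i j ∈ X) (hX' : W₀.outer i (j + 1) ∈ X) :
    W₀.γ (rim 0 i) = W.γ (rim 0 (i + c)) := by
  by_cases hj : 2 ≤ j
  · exact h.fan j i hj (by rwa [outer, if_neg (by omega), if_pos h2] at hX)
  obtain rfl : j = 1 := by omega
  by_cases h6 : 0 + 6 ≤ W₀.γ (rim 0 i)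
  · exact h.fan 2 i le_rfl (by rwa [outer_fan h6] at hX')
  · rw [outer_one] at hX
    rw [outer_hat (by omega)] at hX'
    have h5 : W₀.γ (rim 0 i) = 5 := by omega
    rw [h5, (h.hats i hX hX').1 h5]

theorem cw (h : Agree W₀ W c X) {a b e : Vert d} (hcw : W₀.Cw a b e) :
    a ∈ X → b ∈ X → e ∈ X → W.Cw (Vert.rot c a) (Vert.rot c b) (Vert.rot c e) := by
  induction hcw with
  | spokes i =>
    intros
    simpa [add_right_comm] using Cw.spokes (W := W) (i + c)
  | hat i =>
    intros
    simpa [add_right_comm] using Cw.hat (W := W) (i + c)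
  | fan i j h1 h2 =>
    intro _ hb he
    have heq := h.outer_pair h1 h2 hb he
    rw [rot_outer heq, rot_outer heq]
    exact Cw.fan _ _ h1 (by omega)
  | rot a b e _ ih => exact fun hb he ha => Cw.rot _ _ _ (ih ha hb he)

theorem ed (h : Agree W₀ W c X) {a b : Vert d} (hed : W₀.Ed a b) :
    a ∈ X → b ∈ X → W.Ed (Vert.rot c a) (Vert.rot c b) := by
  induction hed with
  | hub i => intros; exact .hub _
  | spoke i =>
    intros
    simpa [add_right_comm] using Ed.spoke (W := W) (i + c)
  | outer i j h1 h2 =>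
    intro _ hb
    rcases W₀.outer_cases i j with ho | ho | ⟨hj, hj', ho⟩
    · rw [ho]
      have := W.ed_hat_pred (i + c)
      rwa [← sub_add_eq_add_sub] at this
    · rw [ho]
      exact W.ed_hat (i + c)
    · have heq := h.fan j i hj (ho ▸ hb)
      rw [rot_outer heq]
      exact .outer _ _ h1 (by omega)
  | path i j h1 h2 =>
    intro hb he
    have heq := h.outer_pair h1 h2 hb he
    rw [rot_outer heq, rot_outer heq]
    exact .path _ _ h1 (by omega)
  | symm a b _ ih => exact fun hb ha => .symm _ _ (ih ha hb)

theorem cw_iff (h : Agree W₀ W c X) {a b e : Vert d} (ha : a ∈ X) (hb : b ∈ X) (he : e ∈ X) :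
    W₀.Cw a b e ↔ W.Cw (Vert.rot c a) (Vert.rot c b) (Vert.rot c e) := by
  refine ⟨fun hcw => h.cw hcw ha hb he, fun hcw => ?_⟩
  have := h.symm.cw hcw ⟨a, ha, rfl⟩ ⟨b, hb, rfl⟩ ⟨e, he, rfl⟩
  simpa using this

theorem ed_iff (h : Agree W₀ W c X) {a b : Vert d} (ha : a ∈ X) (hb : b ∈ X) :
    W₀.Ed a b ↔ W.Ed (Vert.rot c a) (Vert.rot c b) := by
  refine ⟨fun hcw => h.ed hcw ha hb, fun hcw => ?_⟩
  have := h.symm.ed hcw ⟨a, ha, rfl⟩ ⟨b, hb, rfl⟩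
  simpa using this

/-- Rotation is an isomorphism between the subdrawings. -/
theorem orientIso (h : Agree W₀ W c X) :
    (W₀.config.restrict X).OrientIso (W.config.restrict (Vert.rot c '' X)).toDrawing
      (Vert.rot c) :=
  ⟨(rot_injective c).injOn.bijOn_image,
    fun _ ha _ hb => by
      change W₀.config.graph.Adj _ _ ↔ W.config.graph.Adj _ _
      rw [adj_iff, adj_iff]; exact h.ed_iff ha hb,
    fun _ ha _ hb _ he => h.cw_iff ha hb he⟩

end Agree

/-! ### Neighbours -/

/-- The next hat or fan in clockwise order. -/
def right (W : Cartwheel d) : Vert d → Vert d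
  | rim 1 i => W.outer (i + 1) 2
  | rim (j + 2) i => W.outer i (j + 3)
  | v => v

/-- The next hat or fan in counterclockwise order. -/
def left (W : Cartwheel d) : Vert d → Vert d
  | rim 1 i => W.outer i (W.γ (rim 0 i) - 4)
  | rim (j + 2) i => W.outer i (j + 1)
  | v => v

theorem right_outer {i : ZMod d} {j : ℕ} (h1 : 1 ≤ j) (h2 : j + 4 ≤ W.γ (rim 0 i)) :
    W.right (W.outer i j) = W.outer i (j + 1) := by
  obtain _ | _ | n := j
  · omega
  · rw [zero_add, outer_one]
    simp [right]
  · rw [outer_fan (by omega)]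
    rfl

theorem left_outer {i : ZMod d} {j : ℕ} (h1 : 1 ≤ j) (h2 : j + 4 ≤ W.γ (rim 0 i)) :
    W.left (W.outer i (j + 1)) = W.outer i j := by
  obtain _ | n := j
  · omega
  · by_cases h6 : n + 6 ≤ W.γ (rim 0 i)
    · rw [outer_fan h6]
      rfl
    · rw [outer_hat (by omega), left, show W.γ (rim 0 i) - 4 = n + 1 by omega]

/-- What the neighbours of a vertex can be. -/
def Nbr (W : Cartwheel d) : Vert d → Vert d → Prop
  | hub, w => ∃ i, w = rim 0 i
  | rim 0 i, w => w = hub ∨ w = rim 0 (i - 1) ∨ w = rim 0 (i + 1) ∨ w = rim 1 (i - 1) ∨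
      w = rim 1 i ∨ ∃ j, 2 ≤ j ∧ j + 4 ≤ W.γ (rim 0 i) ∧ w = rim j i
  | rim (j + 1) i, w => w = rim 0 i ∨ w = rim 0 (i + 1) ∨ w = W.left (rim (j + 1) i) ∨
      w = W.right (rim (j + 1) i)

theorem nbr_outer_of_eq {i : ZMod d} {j : ℕ} {w : Vert d}
    (h : w = rim 0 i ∨ w = W.left (W.outer i j) ∨ w = W.right (W.outer i j)) :
    W.Nbr (W.outer i j) w := by
  rcases W.outer_cases i j with ho | ho | ⟨hj, -, ho⟩
  · rw [ho] at h ⊢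
    simp only [Nbr]
    rcases h with h | h
    · right; left; simpa using h
    · tauto
  · rw [ho] at h ⊢
    simp only [Nbr]
    tauto
  · rw [ho] at h ⊢
    obtain ⟨n, rfl⟩ : ∃ n, j = n + 1 := ⟨j - 1, by omega⟩
    simp only [Nbr]
    tauto

theorem Ed.nbr_both {a b : Vert d} (h : W.Ed a b) : W.Nbr a b ∧ W.Nbr b a := by
  induction h with
  | hub i => exact ⟨⟨i, rfl⟩, Or.inl rfl⟩
  | spoke i => simp [Nbr]
  | outer i j h1 h2 =>
    refine ⟨?_, nbr_outer_of_eq (Or.inl rfl)⟩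
    rcases W.outer_cases i j with ho | ho | ⟨hj, hj', ho⟩
    · simp [ho, Nbr]
    · simp [ho, Nbr]
    · rw [ho]
      simp only [Nbr]
      exact Or.inr (Or.inr (Or.inr (Or.inr (Or.inr ⟨j, hj, hj', rfl⟩))))
  | path i j h1 h2 =>
    exact ⟨nbr_outer_of_eq (Or.inr (Or.inr (right_outer h1 h2).symm)),
      nbr_outer_of_eq (Or.inr (Or.inl (left_outer h1 h2).symm))⟩
  | symm a b _ ih => exact ih.symm

theorem Ed.nbr {a b : Vert d} (h : W.Ed a b) : W.Nbr a b := h.nbr_both.1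

/-- An induced subdrawing containing both hats detects whether the spoke between them has degree 5,
even if it does not contain that spoke. This is the source of an additional degree restriction in
outlets. -/
theorem ed_hats_iff {i : ZMod d} : W.Ed (rim 1 (i - 1)) (rim 1 i) ↔ W.γ (rim 0 i) = 5 := by
  have hne1 := W.one_ne_zero_zmod
  have hne2 := W.two_ne_zero_zmod
  have h5 := W.five_le (rim 0 i)
  constructor
  · intro h
    rcases h.nbr with h | h | h | h
    · simp at h
    · simp at h
    · rcases W.outer_cases (i - 1) (W.γ (rim 0 (i - 1)) - 4) with ho | ho | ⟨hj, -, ho⟩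
      · rw [left, ho, Vert.rim.injEq] at h
        exact absurd (by linear_combination h.2) hne2
      · rw [left, ho, Vert.rim.injEq] at h
        exact absurd (by linear_combination h.2) hne1
      · rw [left, ho, Vert.rim.injEq] at h
        omega
    · by_contra hg
      rw [right, sub_add_cancel, outer_fan (j := 0) (by omega)] at h
      simp at h
  · intro h
    have := Ed.path (W := W) i 1 le_rfl (by omega)
    rwa [outer_one, outer_hat (j := 0) (by omega)] at this

/-- The hats and fans form a cycle. -/
theorem hats_of_right_closed {X : Set (Vert d)} (hX : X ⊆ W.verts)
    (hcl : ∀ j i, rim (j + 1) i ∈ X → W.right (rim (j + 1) i) ∈ X)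
    (hne : ∃ j i, rim (j + 1) i ∈ X) (k : ZMod d) : rim 1 k ∈ X := by
  -- `right` moves along the path over one spoke to its last hat, which is also the first vertex of
  -- the next path; going round, all hats are met.
  have hstep : ∀ i j, 1 ≤ j → j + 4 ≤ W.γ (rim 0 i) → W.outer i j ∈ X → W.outer i (j + 1) ∈ X := by
    intro i j h1 h2 h
    rw [← right_outer h1 h2]
    rcases W.outer_cases i j with ho | ho | ⟨hj, -, ho⟩
    · rw [ho] at h ⊢; exact hcl _ _ h
    · rw [ho] at h ⊢; exact hcl _ _ h
    · obtain ⟨n, rfl⟩ : ∃ n, j = n + 1 := ⟨j - 1, by omega⟩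
      rw [ho] at h ⊢; exact hcl _ _ h
  have hhat : ∀ i j, 1 ≤ j → j + 3 ≤ W.γ (rim 0 i) → W.outer i j ∈ X → rim 1 i ∈ X := by
    intro i j h1 h2 h
    obtain ⟨n, hn⟩ := Nat.exists_eq_add_of_le h2
    induction n generalizing j with
    | zero =>
      rw [← W.outer_last i, show W.γ (rim 0 i) - 3 = j by omega]
      exact h
    | succ n ih => exact ih (j + 1) (by omega) (by omega) (hstep i j h1 (by omega) h) (by omega)
  have hsucc : ∀ i, rim 1 i ∈ X → rim 1 (i + 1) ∈ X := by
    intro i h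
    refine hhat (i + 1) 1 le_rfl (by have := W.five_le (rim 0 (i + 1)); omega) ?_
    rw [outer_one]
    simpa using h
  obtain ⟨i, hi⟩ : ∃ i, rim 1 i ∈ X := by
    obtain ⟨j, i, h⟩ := hne
    rcases Nat.eq_zero_or_pos j with rfl | hj
    · exact ⟨i, h⟩
    · refine ⟨i, hhat i (j + 1) (by omega) ?_ ?_⟩
      · have : j + 1 ≤ 1 ∨ j + 1 + 4 ≤ W.γ (rim 0 i) := hX h
        omega
      · have : j + 1 ≤ 1 ∨ j + 1 + 4 ≤ W.γ (rim 0 i) := hX h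
        rwa [outer, if_neg (by omega), if_pos (by omega)]
  have hall : ∀ n : ℕ, rim 1 (i + (n : ZMod d)) ∈ X := by
    intro n
    induction n with
    | zero => simpa using hi
    | succ n ih =>
      have := hsucc _ ih
      rwa [add_assoc, ← Nat.cast_succ] at this
  have : NeZero d := ⟨by have := W.five_le_deg; omega⟩
  have := hall (k - i).val
  rwa [ZMod.natCast_zmod_val, add_sub_cancel] at this

theorem hats_of_left_closed {X : Set (Vert d)} (hX : X ⊆ W.verts)
    (hcl : ∀ j i, rim (j + 1) i ∈ X → W.left (rim (j + 1) i) ∈ X)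
    (hne : ∃ j i, rim (j + 1) i ∈ X) (k : ZMod d) : rim 1 k ∈ X := by
  have hstep : ∀ i j, 1 ≤ j → j + 4 ≤ W.γ (rim 0 i) → W.outer i (j + 1) ∈ X → W.outer i j ∈ X := by
    intro i j h1 h2 h
    rw [← left_outer h1 h2]
    rcases W.outer_cases i (j + 1) with ho | ho | ⟨hj, -, ho⟩
    · rw [ho] at h ⊢; exact hcl _ _ h
    · rw [ho] at h ⊢; exact hcl _ _ h
    · rw [ho] at h ⊢; exact hcl _ _ h
  have hhat : ∀ i n, n + 4 ≤ W.γ (rim 0 i) → W.outer i (n + 1) ∈ X → rim 1 (i - 1) ∈ X := by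
    intro i n h2 h
    induction n with
    | zero => rwa [zero_add, outer_one] at h
    | succ n ih => exact ih (by omega) (hstep i (n + 1) (by omega) (by omega) h)
  have hpred : ∀ i, rim 1 i ∈ X → rim 1 (i - 1) ∈ X := by
    intro i h
    have := W.five_le (rim 0 i)
    refine hhat i (W.γ (rim 0 i) - 4) (by omega) ?_
    rwa [show W.γ (rim 0 i) - 4 + 1 = W.γ (rim 0 i) - 3 by omega, outer_last]
  obtain ⟨i, hi⟩ : ∃ i, rim 1 i ∈ X := by
    obtain ⟨j, i, h⟩ := hne
    rcases Nat.eq_zero_or_pos j with rfl | hj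
    · exact ⟨i, h⟩
    · have : j + 1 ≤ 1 ∨ j + 1 + 4 ≤ W.γ (rim 0 i) := hX h
      refine ⟨i - 1, hhat i j (by omega) ?_⟩
      rwa [outer, if_neg (by omega), if_pos (by omega)]
  have hall : ∀ n : ℕ, rim 1 (i - (n : ZMod d)) ∈ X := by
    intro n
    induction n with
    | zero => simpa using hi
    | succ n ih =>
      have := hpred _ ih
      rwa [sub_sub, ← Nat.cast_succ] at this
  have : NeZero d := ⟨by have := W.five_le_deg; omega⟩
  have := hall (i - k).val
  rwa [ZMod.natCast_zmod_val, sub_sub_cancel] at this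

/-- If `d ≥ 7` some hat has distance more than two from the spoke `x`. -/
theorem not_near_hat (hd : 7 ≤ d) (x : ZMod d) :
    ¬ W.Ed (rim 1 (x + 3)) (rim 0 x) ∧
      ∀ w, W.Ed (rim 1 (x + 3)) w → ¬ W.Ed w (rim 0 x) := by
  have h1 : (1 : ZMod d) ≠ 0 := by
    exact_mod_cast ZMod.natCast_ne_zero_of_lt (d := d) (n := 1) (by norm_num) (by omega)
  have h2 : (2 : ZMod d) ≠ 0 := by
    exact_mod_cast ZMod.natCast_ne_zero_of_lt (d := d) (n := 2) (by norm_num) (by omega)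
  have h3 : (3 : ZMod d) ≠ 0 := by
    exact_mod_cast ZMod.natCast_ne_zero_of_lt (d := d) (n := 3) (by norm_num) (by omega)
  have h4 : (4 : ZMod d) ≠ 0 := by
    exact_mod_cast ZMod.natCast_ne_zero_of_lt (d := d) (n := 4) (by norm_num) (by omega)
  have h5 : (5 : ZMod d) ≠ 0 := by
    exact_mod_cast ZMod.natCast_ne_zero_of_lt (d := d) (n := 5) (by norm_num) (by omega)
  -- Neighbours of the spoke `x` are spokes of index `x - 1` and `x + 1`, hats and fans of index `x
  -- - 1` or `x`, and the hub. Neighbours of the hat `x + 3` have indices `x + 2`, `x + 3`, `x + 4`.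
  -- All comparisons reduce to `2, 3, 4, 5` being non-zero modulo `d`.
  have hno : ∀ m i : ZMod d, i = x + m → m ≠ 0 → m ≠ 1 → m ≠ -1 → ¬ W.Nbr (rim 0 x) (rim 0 i) := by
    rintro m i rfl h h' h'' (h | h | h | h | h | ⟨j, hj, -, h⟩)
    · simp at h
    · simp only [Vert.rim.injEq] at h
      exact h'' (by linear_combination h.2)
    · simp only [Vert.rim.injEq] at h
      exact h' (by linear_combination h.2)
    · simp at h
    · simp at h
    · simp only [Vert.rim.injEq] at h
      omega
  have hno' : ∀ (j : ℕ) (m i : ZMod d), i = x + m → m ≠ 0 → m ≠ -1 →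
      ¬ W.Nbr (rim 0 x) (rim (j + 1) i) := by
    rintro j m i rfl h h' (h | h | h | h | h | ⟨j', hj, -, h⟩)
    · simp at h
    · simp at h
    · simp at h
    · simp only [Vert.rim.injEq] at h
      exact h' (by linear_combination h.2)
    · simp only [Vert.rim.injEq] at h
      exact absurd (by linear_combination h.2) ‹m ≠ 0›
    · simp only [Vert.rim.injEq] at h
      exact absurd (by linear_combination h.2) ‹m ≠ 0›
  constructor
  · intro h
    exact hno' 0 3 _ rfl h3 (fun h => h4 (by linear_combination h)) (Ed.symm _ _ h).nbr
  · intro w hw hwx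
    have hwx' := (Ed.symm _ _ hwx).nbr
    rcases hw.nbr with rfl | rfl | rfl | rfl
    · exact hno 3 _ rfl h3 (fun h => h2 (by linear_combination h))
        (fun h => h4 (by linear_combination h)) hwx'
    · exact hno 4 _ (by ring) h4 (fun h => h3 (by linear_combination h))
        (fun h => h5 (by linear_combination h)) hwx'
    · rw [left] at hwx'
      rcases W.outer_cases (x + 3) (W.γ (rim 0 (x + 3)) - 4) with ho | ho | ⟨hj, -, ho⟩
      · rw [ho] at hwx'
        exact hno' 0 2 _ (by ring) h2 (fun h => h3 (by linear_combination h)) hwx'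
      · rw [ho] at hwx'
        exact hno' 0 3 _ (by ring) h3 (fun h => h4 (by linear_combination h)) hwx'
      · rw [ho] at hwx'
        obtain ⟨n, hn⟩ : ∃ n, W.γ (rim 0 (x + 3)) - 4 = n + 1 :=
          ⟨W.γ (rim 0 (x + 3)) - 5, by omega⟩
        rw [hn] at hwx'
        exact hno' n 3 _ (by ring) h3 (fun h => h4 (by linear_combination h)) hwx'
    · rw [right] at hwx'
      rcases W.outer_cases (x + 3 + 1) 2 with ho | ho | ⟨hj, -, ho⟩
      · rw [ho] at hwx'
        exact hno' 0 3 _ (by ring) h3 (fun h => h4 (by linear_combination h)) hwx'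
      · rw [ho] at hwx'
        exact hno' 0 4 _ (by ring) h4 (fun h => h5 (by linear_combination h)) hwx'
      · rw [ho] at hwx'
        exact hno' 1 4 _ (by ring) h4 (fun h => h5 (by linear_combination h)) hwx'

end Cartwheel

/-! ### Passes in cartwheels -/

namespace Drawing

variable {V V' V'' : Type} {D : Drawing V} {E : Drawing V'} {F : Drawing V''} {f : V → V'}
  {g : V' → V''}

theorem OrientIso.trans (h : D.OrientIso E f) (h' : E.OrientIso F g) :
    D.OrientIso F (g ∘ f) :=
  ⟨h'.1.comp h.1,
    fun a ha b hb => (h.2.1 a ha b hb).trans (h'.2.1 _ (h.1.mapsTo ha) _ (h.1.mapsTo hb)),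
    fun a ha b hb c hc => (h.2.2 a ha b hb c hc).trans
      (h'.2.2 _ (h.1.mapsTo ha) _ (h.1.mapsTo hb) _ (h.1.mapsTo hc))⟩

open Classical in
theorem deg_le_of_subset {v : V} (S : Finset V) (hS : {w | D.IsEdge v w} ⊆ S) :
    D.deg v ≤ S.card := by
  rw [deg, ← Set.ncard_coe_finset]
  exact Set.ncard_le_ncard hS S.finite_toSet

end Drawing

/-- Condition (i) of coherence, for one orientation and hubs of degree `d`. -/
def Rule.FanSpoke (R : Rule) (d : ℕ) : Prop :=
  ∀ (W : Cartwheel d) (P : Pass (Vert d)) (f : ℕ → Vert d),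
    P.ObeysVia R f → P.AppearsIn W → P.s = Vert.hub ∨ P.t = Vert.hub →
    ∀ (j : ℕ) (i : ZMod d), 2 ≤ j → Vert.rim j i ∈ P.K.verts →
      Vert.rim 0 i ∈ P.K.verts ∧
      ∀ v ∈ R.G.verts, f v = Vert.rim 0 i → (R.β v : ℕ∞) = R.δ v

namespace Pass

open Vert Cartwheel

variable {d : ℕ} {R : Rule} {W₀ W : Cartwheel d} {P₀ P : Pass (Vert d)} {f₀ f : ℕ → Vert d}

theorem AppearsIn.eq (a : P.AppearsIn W) : P.K = W.config.restrict P.K.verts := by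
  obtain ⟨-, X, -, h⟩ := a
  rw [h]; rfl

theorem AppearsIn.subset (a : P.AppearsIn W) : P.K.verts ⊆ W.verts := by
  obtain ⟨-, X, hX, h⟩ := a
  rw [h]; exact hX

theorem AppearsIn.γ_eq (a : P.AppearsIn W) : P.K.γ = W.γ := by
  rw [a.eq]; rfl

theorem AppearsIn.isEdge_iff (a : P.AppearsIn W) {u v : Vert d} :
    P.K.IsEdge u v ↔ u ∈ P.K.verts ∧ v ∈ P.K.verts ∧ W.Ed u v := by
  rw [a.eq, ← adj_iff]; rfl

theorem AppearsIn.cw_iff (a : P.AppearsIn W) {u v w : Vert d} : P.K.cw u v w ↔ W.Cw u v w := by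
  rw [a.eq]; rfl

theorem ObeysVia.isPass (h : P.ObeysVia R f) : P.IsPass := h.1

theorem ObeysVia.iso (h : P.ObeysVia R f) : R.G.OrientIso P.K.toDrawing f := h.2.2.1

theorem ObeysVia.mem (h : P.ObeysVia R f) {v : ℕ} (hv : v ∈ R.G.verts) : f v ∈ P.K.verts :=
  h.iso.1.mapsTo hv

theorem ObeysVia.bounds (h : P.ObeysVia R f) (a : P.AppearsIn W) {v : ℕ} (hv : v ∈ R.G.verts) :
    R.β v ≤ W.γ (f v) ∧ (W.γ (f v) : ℕ∞) ≤ R.δ v := by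
  rw [← a.γ_eq]; exact h.2.2.2.2.2 v hv

/-- A rule is not itself assumed to have a boundary; it inherits one from any pass that obeys it. -/
theorem ObeysVia.exists_boundary (h : P.ObeysVia R f) : ∃ v ∈ R.G.verts, ¬ R.G.IsInterior v := by
  obtain ⟨w, hw, hb⟩ := h.isPass.configuration.exists_boundary
  obtain ⟨v, hv, rfl⟩ := h.iso.surj hw
  exact ⟨v, hv, mt (h.iso.isInterior_iff hv).2 hb⟩

/-- A pass that obeys a rule is determined by the images of the source and the sink. -/
theorem ObeysVia.rigid (hR : R.IsRule) (hfs : R.FanSpoke d) (h₀ : P₀.ObeysVia R f₀)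
    (a₀ : P₀.AppearsIn W₀) (h : P.ObeysVia R f) (a : P.AppearsIn W) {c : ZMod d}
    (hs : P.s = rot c P₀.s) (ht : P.t = rot c P₀.t) (hhub : P₀.s = hub ∨ P₀.t = hub) :
    ∀ v ∈ R.G.verts, f v = rot c (f₀ v) := by
  have hhub' : P.s = hub ∨ P.t = hub := by
    rw [hs, ht]
    rcases hhub with h | h <;> simp [h]
  refine hR.nearTriangulation.face_induction h₀.exists_boundary hR.noCut
    (fun v => f v = rot c (f₀ v)) hR.edge ?_ ?_ ?_
  · rw [h.2.2.2.1, h₀.2.2.2.1, hs]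
  · rw [h.2.2.2.2.1, h₀.2.2.2.2.1, ht]
  · intro u v w hface hu hv
    have c₀ := a₀.cw_iff.1 (h₀.iso.map_face hface).2.2.2
    have c₁ := a.cw_iff.1 (h.iso.map_face hface).2.2.2
    rw [hu, hv] at c₁
    -- Both images of the face have the same first two vertices up to rotation, so only the degree
    -- of a spoke among these two could make the third ones differ, and only if a fan is involved.
    refine c₀.thirdOf.rot_eq c₁.thirdOf fun i hi hj => ?_
    have key : ∀ x ∈ R.G.verts, f₀ x = rim 0 i → f x = rot c (f₀ x) → (R.β x : ℕ∞) = R.δ x →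
        W₀.γ (rim 0 i) = W.γ (rim 0 (i + c)) := by
      intro x hx e e' hβ
      have b₀ := h₀.bounds a₀ hx
      have b := h.bounds a hx
      rw [← hβ, Nat.cast_le] at b₀ b
      rw [e', e, rot_rim] at b
      rw [e] at b₀
      omega
    -- The fan may lie in either pass. Whichever it is, coherence gives `β = δ` at the vertex of the
    -- rule that is mapped to the spoke, so the degree is prescribed in both cartwheels.
    have key₀ : (∃ j, 2 ≤ j ∧ rim j i ∈ P₀.K.verts) ∨ (∃ j, 2 ≤ j ∧ rim j (i + c) ∈ P.K.verts) := by
      obtain ⟨j, hj2, hj | hj | hj | hj⟩ := hj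
      · exact Or.inl ⟨j, hj2, hj ▸ h₀.mem hface.1⟩
      · exact Or.inl ⟨j, hj2, hj ▸ h₀.mem hface.2.1⟩
      · exact Or.inl ⟨j, hj2, hj ▸ h₀.mem hface.2.2.1⟩
      · exact Or.inr ⟨j, hj2, hj ▸ h.mem hface.2.2.1⟩
    have key₁ : ∀ x ∈ R.G.verts, f₀ x = rim 0 i → f x = rot c (f₀ x) → (R.β x : ℕ∞) = R.δ x := by
      intro x hx e e'
      rcases key₀ with ⟨j, hj2, hj⟩ | ⟨j, hj2, hj⟩
      · exact (hfs W₀ P₀ f₀ h₀ a₀ hhub j i hj2 hj).2 x hx e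
      · exact (hfs W P f h a hhub' j _ hj2 hj).2 x hx (by rw [e', e, rot_rim])
    rcases hi with hi | hi
    · exact key u hface.1 hi hu (key₁ u hface.1 hi hu)
    · exact key v hface.2.1 hi hv (key₁ v hface.2.1 hi hv)

/-- Rigidity with rotation 0 gives equal vertex sets, and a subdrawing of `W` is determined by its
vertices. -/
theorem ObeysVia.eq_of_eq (hR : R.IsRule) (hfs : R.FanSpoke d) (h₀ : P₀.ObeysVia R f₀)
    (a₀ : P₀.AppearsIn W) (h : P.ObeysVia R f) (a : P.AppearsIn W)
    (hs : P.s = P₀.s) (ht : P.t = P₀.t) (hhub : P₀.s = hub ∨ P₀.t = hub) : P = P₀ := by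
  have hrigid := h₀.rigid hR hfs a₀ h a (c := 0) (by simpa using hs) (by simpa using ht) hhub
  simp only [rot_zero] at hrigid
  have hverts : P.K.verts = P₀.K.verts := by
    rw [← h.iso.1.image_eq, ← h₀.iso.1.image_eq]
    exact Set.image_congr hrigid
  have hK : P.K = P₀.K := by
    rw [a.eq, a₀.eq, hverts]
  have hr : P.r = P₀.r := h.2.1.trans h₀.2.1.symm
  obtain ⟨K, r, s, t⟩ := P
  obtain ⟨K₀, r₀, s₀, t₀⟩ := P₀
  simp only at hK hr hs ht
  rw [hK, hr, hs, ht]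

end Pass

/-! ### Degrees and ring size of subdrawings of a cartwheel -/

namespace Cartwheel

open Vert

variable {d : ℕ} {W : Cartwheel d} {X : Set (Vert d)}

theorem isEdge_restrict {u v : Vert d} :
    (W.config.restrict X).IsEdge u v ↔ u ∈ X ∧ v ∈ X ∧ W.Ed u v := by
  rw [← adj_iff]; rfl

theorem deg_outer_le (j : ℕ) (i : ZMod d) : (W.config.restrict X).deg (rim (j + 1) i) ≤ 4 := by
  classical
  refine (Drawing.deg_le_of_subset {rim 0 i, rim 0 (i + 1), W.left (rim (j + 1) i),
    W.right (rim (j + 1) i)} fun w hw => ?_).trans Finset.card_le_four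
  have := (isEdge_restrict.1 hw).2.2.nbr
  simpa [Nbr] using this

theorem deg_outer_le_three {j : ℕ} {i : ZMod d}
    (h : W.left (rim (j + 1) i) ∉ X ∨ W.right (rim (j + 1) i) ∉ X) :
    (W.config.restrict X).deg (rim (j + 1) i) ≤ 3 := by
  classical
  rcases h with h | h
  · refine (Drawing.deg_le_of_subset {rim 0 i, rim 0 (i + 1),
      W.right (rim (j + 1) i)} fun w hw => ?_).trans Finset.card_le_three
    obtain ⟨-, hX, hed⟩ := isEdge_restrict.1 hw
    rcases hed.nbr with rfl | rfl | rfl | rfl <;> simp_all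
  · refine (Drawing.deg_le_of_subset {rim 0 i, rim 0 (i + 1),
      W.left (rim (j + 1) i)} fun w hw => ?_).trans Finset.card_le_three
    obtain ⟨-, hX, hed⟩ := isEdge_restrict.1 hw
    rcases hed.nbr with rfl | rfl | rfl | rfl <;> simp_all

theorem deg_outer_le_two {j : ℕ} {i : ZMod d}
    (h : W.left (rim (j + 1) i) ∉ X) (h' : W.right (rim (j + 1) i) ∉ X) :
    (W.config.restrict X).deg (rim (j + 1) i) ≤ 2 := by
  classical
  refine (Drawing.deg_le_of_subset {rim 0 i, rim 0 (i + 1)} fun w hw => ?_).trans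
    Finset.card_le_two
  obtain ⟨-, hX, hed⟩ := isEdge_restrict.1 hw
  rcases hed.nbr with rfl | rfl | rfl | rfl <;> simp_all

/-- Subdrawings that could come from a pass into or out of the hub satisfy the condition on the
ring size. -/
theorem two_le_ringSize (hd : 7 ≤ d) (hX : X ⊆ W.verts) (hfin : X.Finite)
    (hcut : ∀ v ∈ X, ((W.config.restrict X).del v).Preconnected)
    (hint : ∀ v ∈ X, (W.config.restrict X).IsInterior v → W.γ v = (W.config.restrict X).deg v)
    (hbd : ∀ v ∈ X, ¬ (W.config.restrict X).IsInterior v → (W.config.restrict X).deg v < W.γ v)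
    (x : ZMod d) (hx : rim 0 x ∈ X)
    (hnear : ∀ v ∈ X, v = rim 0 x ∨ (W.config.restrict X).IsEdge v (rim 0 x) ∨
      ∃ w, (W.config.restrict X).IsEdge v w ∧ (W.config.restrict X).IsEdge w (rim 0 x)) :
    2 ≤ (W.config.restrict X).ringSize := by
  classical
  set K := W.config.restrict X with hK
  -- An interior vertex has degree `γ ≥ 5` in `K`, so vertices of small degree enter the sum.
  have hsmall : ∀ v ∈ X, K.deg v ≤ 4 →
      v ∈ {v | v ∈ K.verts ∧ ¬ K.IsInterior v ∧ (K.del v).Preconnected} := by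
    intro v hv h
    refine ⟨hv, fun hi => ?_, hcut v hv⟩
    have := hint v hv hi
    have := W.five_le v
    omega
  have hterm : ∀ v, (5 : ℤ) ≤ K.γ v := fun v => by exact_mod_cast W.five_le v
  refine Config.finsum_mem_ge_two (hfin.subset fun v hv => hv.1) ?_ ?_
  · intro v hv
    have : K.deg v < K.γ v := hbd v hv.1 hv.2.1
    omega
  by_cases hout : ∃ j i, rim (j + 1) i ∈ X
  -- Since one hat is too far from `x` to belong to `X`, the hats and fans of `X` do not fill the
  -- outer cycle. One of them lacks its right neighbour and one its left: they have degree at most 3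
  -- and contribute at least 1 each, or they coincide, with degree at most 2, and contribute 2.
  · have hfar : rim 1 (x + 3) ∉ X := by
      intro hmem
      have hn := not_near_hat (W := W) hd x
      rcases hnear _ hmem with h | h | ⟨w, h, h'⟩
      · simp at h
      · exact hn.1 (isEdge_restrict.1 h).2.2
      · exact hn.2 w (isEdge_restrict.1 h).2.2 (isEdge_restrict.1 h').2.2
    have hr : ∃ j i, rim (j + 1) i ∈ X ∧ W.right (rim (j + 1) i) ∉ X := by
      by_contra! hcon
      exact hfar (hats_of_right_closed hX hcon hout _)
    have hl : ∃ j i, rim (j + 1) i ∈ X ∧ W.left (rim (j + 1) i) ∉ X := by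
      by_contra! hcon
      exact hfar (hats_of_left_closed hX hcon hout _)
    obtain ⟨j, i, h1, h2⟩ := hr
    obtain ⟨j', i', h3, h4⟩ := hl
    by_cases heq : (rim (j + 1) i : Vert d) = rim (j' + 1) i'
    · obtain ⟨h, rfl⟩ : j + 1 = j' + 1 ∧ i = i' := by simpa using heq
      obtain rfl : j = j' := by omega
      have hdeg : K.deg (rim (j + 1) i) ≤ 2 := deg_outer_le_two h4 h2
      have := hterm (rim (j + 1) i)
      exact Or.inl ⟨_, hsmall _ h1 (by omega), by omega⟩
    · have hdeg : K.deg (rim (j + 1) i) ≤ 3 := deg_outer_le_three (Or.inr h2)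
      have hdeg' : K.deg (rim (j' + 1) i') ≤ 3 := deg_outer_le_three (Or.inl h4)
      have := hterm (rim (j + 1) i)
      have := hterm (rim (j' + 1) i')
      exact Or.inr ⟨_, hsmall _ h1 (by omega), _, hsmall _ h3 (by omega), heq, by omega, by omega⟩
  -- Without hats and fans each spoke has degree at most 3. Two spokes contribute at least 1 each; a
  -- single one has only the hub as a neighbour and contributes at least 3.
  · push Not at hout
    have hno : ∀ j i, 1 ≤ j → rim j i ∉ X := by
      intro j i hj
      obtain ⟨n, rfl⟩ : ∃ n, j = n + 1 := ⟨j - 1, by omega⟩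
      exact hout n i
    have hdeg : ∀ y, K.deg (rim 0 y) ≤ 3 := by
      intro y
      refine (Drawing.deg_le_of_subset {hub, rim 0 (y - 1), rim 0 (y + 1)} fun w hw => ?_).trans
        Finset.card_le_three
      obtain ⟨-, hwX, hed⟩ := isEdge_restrict.1 hw
      rcases hed.nbr with rfl | rfl | rfl | rfl | rfl | ⟨j, hj, -, rfl⟩
      · simp
      · simp
      · simp
      · exact absurd hwX (hno _ _ le_rfl)
      · exact absurd hwX (hno _ _ le_rfl)
      · exact absurd hwX (hno _ _ (by omega))
    by_cases hy : ∃ y, y ≠ x ∧ rim 0 y ∈ X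
    · obtain ⟨y, hne, hy⟩ := hy
      have := hterm (rim 0 x)
      have := hterm (rim 0 y)
      have := hdeg x
      have := hdeg y
      exact Or.inr ⟨_, hsmall _ hx (by omega), _, hsmall _ hy (by omega), by simpa using hne.symm,
        by omega, by omega⟩
    · push Not at hy
      have hne1 := W.one_ne_zero_zmod
      have hdeg : K.deg (rim 0 x) ≤ 1 := by
        refine (Drawing.deg_le_of_subset {hub} fun w hw => ?_).trans (by simp)
        obtain ⟨-, hwX, hed⟩ := isEdge_restrict.1 hw
        rcases hed.nbr with rfl | rfl | rfl | rfl | rfl | ⟨j, hj, -, rfl⟩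
        · simp
        · exact absurd hwX (hy _ (by simpa using hne1))
        · exact absurd hwX (hy _ (by simpa using hne1))
        · exact absurd hwX (hno _ _ le_rfl)
        · exact absurd hwX (hno _ _ le_rfl)
        · exact absurd hwX (hno _ _ (by omega))
      have := hterm (rim 0 x)
      exact Or.inl ⟨_, hsmall _ hx (by omega), by omega⟩

theorem deg_spoke_le_five {i : ZMod d} (hfan : ∀ j, 2 ≤ j → rim j i ∉ X) :
    (W.config.restrict X).deg (rim 0 i) ≤ 5 := by
  classical
  refine (Drawing.deg_le_of_subset {hub, rim 0 (i - 1), rim 0 (i + 1), rim 1 (i - 1), rim 1 i}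
    fun w hw => ?_).trans Finset.card_le_five
  obtain ⟨-, hwX, hed⟩ := isEdge_restrict.1 hw
  rcases hed.nbr with rfl | rfl | rfl | rfl | rfl | ⟨j, hj, -, rfl⟩
  · simp
  · simp
  · simp
  · simp
  · simp
  · exact absurd hwX (hfan j hj)

theorem deg_spoke_le_four {i : ZMod d} (hfan : ∀ j, 2 ≤ j → rim j i ∉ X)
    (hhat : ¬ (rim 1 (i - 1) ∈ X ∧ rim 1 i ∈ X)) :
    (W.config.restrict X).deg (rim 0 i) ≤ 4 := by
  classical
  by_cases h1 : rim 1 (i - 1) ∈ X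
  · refine (Drawing.deg_le_of_subset {hub, rim 0 (i - 1), rim 0 (i + 1), rim 1 (i - 1)}
      fun w hw => ?_).trans Finset.card_le_four
    obtain ⟨-, hwX, hed⟩ := isEdge_restrict.1 hw
    rcases hed.nbr with rfl | rfl | rfl | rfl | rfl | ⟨j, hj, -, rfl⟩
    · simp
    · simp
    · simp
    · simp
    · exact absurd ⟨h1, hwX⟩ hhat
    · exact absurd hwX (hfan j hj)
  · refine (Drawing.deg_le_of_subset {hub, rim 0 (i - 1), rim 0 (i + 1), rim 1 i}
      fun w hw => ?_).trans Finset.card_le_four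
    obtain ⟨-, hwX, hed⟩ := isEdge_restrict.1 hw
    rcases hed.nbr with rfl | rfl | rfl | rfl | rfl | ⟨j, hj, -, rfl⟩
    · simp
    · simp
    · simp
    · exact absurd hwX h1
    · simp
    · exact absurd hwX (hfan j hj)

end Cartwheel

/-! ### Moving passes to other cartwheels -/

namespace Pass

open Vert Cartwheel

variable {d : ℕ} {R : Rule} {W₀ W : Cartwheel d} {P₀ P : Pass (Vert d)} {f₀ f : ℕ → Vert d}

/-- The image under a rotation, in another cartwheel, of a pass. -/
def transfer (P₀ : Pass (Vert d)) (W : Cartwheel d) (c : ZMod d) : Pass (Vert d) where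
  K := W.config.restrict (rot c '' P₀.K.verts)
  r := P₀.r
  s := rot c P₀.s
  t := rot c P₀.t

/-- Rotation is an isomorphism onto the induced subdrawing of `W`, so drawing and distances carry
over. What has to be checked is that the new degrees still make a configuration; the absence of
cutvertices comes from the rule and the ring size from `two_le_ringSize`. -/
theorem ObeysVia.transfer (hd : 7 ≤ d) (hR : R.IsRule) (h₀ : P₀.ObeysVia R f₀)
    (a₀ : P₀.AppearsIn W₀) {x : ZMod d}
    (hst : (P₀.s = rim 0 x ∧ P₀.t = hub) ∨ (P₀.s = hub ∧ P₀.t = rim 0 x)) {c : ZMod d}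
    (hagree : Agree W₀ W c P₀.K.verts)
    (hbd : ∀ v ∈ R.G.verts, R.β v ≤ W.γ (rot c (f₀ v)) ∧ (W.γ (rot c (f₀ v)) : ℕ∞) ≤ R.δ v) :
    (P₀.transfer W c).ObeysVia R (rot c ∘ f₀) ∧ (P₀.transfer W c).AppearsIn W := by
  have iso₁ : P₀.K.toDrawing.OrientIso (P₀.transfer W c).K.toDrawing (rot c) := by
    have := hagree.orientIso
    rwa [← a₀.eq] at this
  have iso : R.G.OrientIso (P₀.transfer W c).K.toDrawing (rot c ∘ f₀) := h₀.iso.trans iso₁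
  have hsub : rot c '' P₀.K.verts ⊆ W.verts := by
    rintro _ ⟨v, hv, rfl⟩
    have hv' := a₀.subset hv
    rcases v with _ | ⟨j, i⟩
    · trivial
    · have h' : j ≤ 1 ∨ j + 4 ≤ W₀.γ (rim 0 i) := hv'
      change j ≤ 1 ∨ j + 4 ≤ W.γ (rim 0 (i + c))
      by_cases hj : j ≤ 1
      · exact Or.inl hj
      · rw [← hagree.fan j i (by omega) hv]; exact h'
  have hK₀ := h₀.isPass.configuration
  have hnt := iso₁.isNearTriangulation hK₀.nearTriangulation
  have hcut : ∀ v ∈ rot c '' P₀.K.verts, ((P₀.transfer W c).K.del v).Preconnected := by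
    intro v hv
    obtain ⟨u, hu, rfl⟩ := iso.surj hv
    exact iso.del_preconnected hu (hR.noCut u hu)
  -- A degree can change only at a boundary vertex, and stays above the degree in the drawing. Hats
  -- and fans have at most 4 neighbours. A spoke without fans has at most 5 neighbours, with
  -- equality only if both its hats are present; then its degree is 5 in both cartwheels or at least
  -- 6 in both.
  have key : ∀ v ∈ P₀.K.verts, W.γ (rot c v) = W₀.γ v ∨
      (P₀.K.deg v < W.γ (rot c v) ∧ ¬ P₀.K.IsInterior v) := by
    intro v hv
    have hint : P₀.K.IsInterior v → W₀.γ v = P₀.K.deg v := fun hi => by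
      rw [← hK₀.interior v hv hi, a₀.γ_eq]
    have h5 := W.five_le (rot c v)
    have h5' := W₀.five_le v
    rcases v with _ | ⟨_ | j, i⟩
    · left
      rw [rot_hub, W.hub_eq, W₀.hub_eq]
    · by_cases hfan : ∃ j, 2 ≤ j ∧ rim j i ∈ P₀.K.verts
      · obtain ⟨j, hj, hmem⟩ := hfan
        exact Or.inl (hagree.fan j i hj hmem).symm
      push Not at hfan
      by_cases hhat : rim 1 (i - 1) ∈ P₀.K.verts ∧ rim 1 i ∈ P₀.K.verts
      · have h55 := hagree.hats i hhat.1 hhat.2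
        by_cases hg : W₀.γ (rim 0 i) = 5
        · left
          rw [hg]
          exact h55.1 hg
        · have hg' := mt h55.2 hg
          have hdeg := deg_spoke_le_five (W := W₀) hfan
          rw [← a₀.eq] at hdeg
          rw [rot_rim] at h5 ⊢
          exact Or.inr ⟨by omega, fun hi => by have := hint hi; omega⟩
      · have hdeg := deg_spoke_le_four (W := W₀) hfan hhat
        rw [← a₀.eq] at hdeg
        exact Or.inr ⟨by omega, fun hi => by have := hint hi; omega⟩
    · have hdeg := deg_outer_le (W := W₀) (X := P₀.K.verts) j i
      rw [← a₀.eq] at hdeg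
      exact Or.inr ⟨by omega, fun hi => by have := hint hi; omega⟩
  have hint : ∀ v ∈ rot c '' P₀.K.verts, (P₀.transfer W c).K.IsInterior v →
      W.γ v = (P₀.transfer W c).K.deg v := by
    rintro _ ⟨v, hv, rfl⟩ hi
    have hi₀ := (iso₁.isInterior_iff hv).1 hi
    rw [iso₁.deg_eq hv, ← hK₀.interior v hv hi₀, a₀.γ_eq]
    exact (key v hv).resolve_right fun h => h.2 hi₀
  have hbdry : ∀ v ∈ rot c '' P₀.K.verts, ¬ (P₀.transfer W c).K.IsInterior v →
      (P₀.transfer W c).K.deg v < W.γ v := by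
    rintro _ ⟨v, hv, rfl⟩ hi
    have hi₀ := mt (iso₁.isInterior_iff hv).2 hi
    have := hK₀.boundary v hv hi₀
    rw [a₀.γ_eq] at this
    rw [iso₁.deg_eq hv]
    rcases key v hv with h | h
    · omega
    · exact h.1
  have hnear_s : ∀ v ∈ rot c '' P₀.K.verts, v = rot c P₀.s ∨
      (P₀.transfer W c).K.IsEdge v (rot c P₀.s) ∨
      ∃ w, (P₀.transfer W c).K.IsEdge v w ∧ (P₀.transfer W c).K.IsEdge w (rot c P₀.s) := by
    rintro _ ⟨v, hv, rfl⟩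
    rcases h₀.isPass.near_s v hv with h | h | ⟨w, h, h'⟩
    · exact Or.inl (by rw [h])
    · exact Or.inr (Or.inl (iso₁.map_edge h))
    · exact Or.inr (Or.inr ⟨rot c w, iso₁.map_edge h, iso₁.map_edge h'⟩)
  have hnear_t : ∀ v ∈ rot c '' P₀.K.verts, v = rot c P₀.t ∨
      (P₀.transfer W c).K.IsEdge v (rot c P₀.t) ∨
      ∃ w, (P₀.transfer W c).K.IsEdge v w ∧ (P₀.transfer W c).K.IsEdge w (rot c P₀.t) := by
    rintro _ ⟨v, hv, rfl⟩
    rcases h₀.isPass.near_t v hv with h | h | ⟨w, h, h'⟩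
    · exact Or.inl (by rw [h])
    · exact Or.inr (Or.inl (iso₁.map_edge h))
    · exact Or.inr (Or.inr ⟨rot c w, iso₁.map_edge h, iso₁.map_edge h'⟩)
  have hring : 2 ≤ (P₀.transfer W c).K.ringSize := by
    rcases hst with ⟨hs, -⟩ | ⟨-, ht⟩
    · refine two_le_ringSize hd hsub hnt.finite hcut hint hbdry (x + c)
        ⟨rim 0 x, hs ▸ h₀.isPass.edge.1, rfl⟩ ?_
      rw [hs] at hnear_s
      exact hnear_s
    · refine two_le_ringSize hd hsub hnt.finite hcut hint hbdry (x + c)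
        ⟨rim 0 x, ht ▸ h₀.isPass.edge.2.1, rfl⟩ ?_
      rw [ht] at hnear_t
      exact hnear_t
  have hconf : (P₀.transfer W c).K.IsConfiguration := by
    refine ⟨hnt, fun v hv => ?_, hint, hbdry, fun v _ => W.five_le v, hring⟩
    have := (hcut v hv).subsingleton_connectedComponent
    have := Finite.card_le_one_iff_subsingleton.2 this
    exact ⟨by omega, fun h => by omega⟩
  refine ⟨⟨⟨hconf, h₀.isPass.pos, iso₁.map_edge h₀.isPass.edge, hnear_s, hnear_t⟩, h₀.2.1, iso,
    ?_, ?_, hbd⟩, hconf, _, hsub, rfl⟩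
  · exact congrArg (rot c) h₀.2.2.2.1
  · exact congrArg (rot c) h₀.2.2.2.2.1

end Pass

/-! ### The outlets of a rule -/

open Vert Cartwheel in
/-- The spokes, hats and fans at which a rule, placed in a cartwheel, restricts the degrees, and the
restrictions. -/
theorem exists_outlet_bounds {d : ℕ} (hd : 7 ≤ d) {R : Rule} (hR : R.IsRule) (hfs : R.FanSpoke d)
    (hβ : ∀ v ∈ R.G.verts, R.β v ∈ ({5, 6, 7, 8, 9} : Set ℕ))
    (hδ : ∀ v ∈ R.G.verts, ∃ n ∈ ({5, 6, 7, 8, 12} : Set ℕ), R.δ v = n)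
    {toHub : Bool} {W₀ : Cartwheel d} {x₀ : ZMod d} (h : HasPass W₀ R toHub x₀) :
    ∃ L U : ℕ → ZMod d → ℕ,
      (∀ j i, L j i ∈ ({5, 6, 7, 8, 9} : Set ℕ) ∧ U j i ∈ ({5, 6, 7, 8, 12} : Set ℕ) ∧
        L j i ≤ U j i) ∧
      (∀ j i, 2 ≤ j → ¬ (L j i = 5 ∧ U j i = 12) → L 0 i = U 0 i ∧ j + 4 ≤ L 0 i) ∧
      (∀ (W : Cartwheel d) (c : ZMod d), (∀ i, W.γ (rim 0 i) ≤ 12) →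
        HasPass W R toHub (x₀ + c) → ∀ j i, ¬ (L j i = 5 ∧ U j i = 12) →
          L j i ≤ W.γ (rim j (i + c)) ∧ W.γ (rim j (i + c)) ≤ U j i) ∧
      (∀ (W : Cartwheel d) (c : ZMod d),
        (∀ j i, ¬ (L j i = 5 ∧ U j i = 12) →
          L j i ≤ W.γ (rim j (i + c)) ∧ W.γ (rim j (i + c)) ≤ U j i) →
        (∀ j i, j ≤ 1 ∨ (L 0 i = U 0 i ∧ j + 4 ≤ L 0 i) → W.γ (rim j (i + c)) ≤ 12) →
        HasPass W R toHub (x₀ + c)) := by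
  classical
  obtain ⟨P₀, ⟨f₀, h₀⟩, a₀, hst₀⟩ := h
  have hhub₀ : P₀.s = hub ∨ P₀.t = hub := by
    cases toHub
    · exact Or.inl hst₀.1
    · exact Or.inr hst₀.2
  set X := P₀.K.verts with hX
  choose! δ' hδ'mem hδ' using hδ
  let g := Function.invFunOn f₀ R.G.verts
  have hg : ∀ a ∈ X, g a ∈ R.G.verts ∧ f₀ (g a) = a := fun a ha =>
    ⟨Function.invFunOn_mem (h₀.iso.surj ha), Function.invFunOn_eq (h₀.iso.surj ha)⟩
  have hgf : ∀ v ∈ R.G.verts, g (f₀ v) = v := fun v hv =>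
    h₀.iso.1.injOn (hg _ (h₀.mem hv)).1 hv (hg _ (h₀.mem hv)).2
  -- Bounds of the rule read in the cartwheel; `(5, 12)` stands for no restriction outside the pass.
  let lo : Vert d → ℕ := fun a => if a ∈ X then R.β (g a) else 5
  let hi : Vert d → ℕ := fun a => if a ∈ X then δ' (g a) else 12
  have hlo : ∀ a, lo a ∈ ({5, 6, 7, 8, 9} : Set ℕ) := by
    intro a
    by_cases ha : a ∈ X
    · simp only [lo, if_pos ha]; exact hβ _ (hg a ha).1
    · simp [lo, if_neg ha]
  have hhi : ∀ a, hi a ∈ ({5, 6, 7, 8, 12} : Set ℕ) := by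
    intro a
    by_cases ha : a ∈ X
    · simp only [hi, if_pos ha]; exact hδ'mem _ (hg a ha).1
    · simp [hi, if_neg ha]
  have hlohi : ∀ a ∈ X, lo a ≤ W₀.γ a ∧ W₀.γ a ≤ hi a := by
    intro a ha
    have := h₀.bounds a₀ (hg a ha).1
    rw [hδ' _ (hg a ha).1, Nat.cast_le, (hg a ha).2] at this
    simpa only [lo, hi, if_pos ha] using this
  have hle : ∀ a, lo a ≤ hi a := by
    intro a
    by_cases ha : a ∈ X
    · exact (hlohi a ha).1.trans (hlohi a ha).2
    · simp [lo, hi, if_neg ha]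
  have hfan : ∀ j i, 2 ≤ j → rim j i ∈ X → rim 0 i ∈ X ∧ lo (rim 0 i) = W₀.γ (rim 0 i) ∧
      hi (rim 0 i) = W₀.γ (rim 0 i) ∧ j + 4 ≤ W₀.γ (rim 0 i) := by
    intro j i hj hmem
    obtain ⟨h1, h2⟩ := hfs W₀ P₀ f₀ h₀ a₀ hhub₀ j i hj hmem
    rw [← hX] at h1
    have h3 := h2 _ (hg _ h1).1 (hg _ h1).2
    rw [hδ' _ (hg _ h1).1, Nat.cast_inj] at h3
    have h4 : lo (rim 0 i) = hi (rim 0 i) := by simpa only [lo, hi, if_pos h1] using h3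
    have h5 := hlohi _ h1
    have h6 : j ≤ 1 ∨ j + 4 ≤ W₀.γ (rim 0 i) := a₀.subset hmem
    exact ⟨h1, by omega, by omega, by omega⟩
  let both : ZMod d → Prop := fun i => rim 1 (i - 1) ∈ X ∧ rim 1 i ∈ X
  -- If both hats at the spoke `i` lie in the pass, their adjacency must be preserved. So the degree
  -- of the spoke has to be exactly 5 or at least 6 as in `W₀`, whether or not the spoke lies in the
  -- pass.
  let L : ℕ → ZMod d → ℕ := fun j i =>
    if j = 0 ∧ both i then if W₀.γ (rim 0 i) = 5 then 5 else max (lo (rim 0 i)) 6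
    else lo (rim j i)
  let U : ℕ → ZMod d → ℕ := fun j i =>
    if j = 0 ∧ both i ∧ W₀.γ (rim 0 i) = 5 then 5 else hi (rim j i)
  have hL5 : ∀ i, both i → W₀.γ (rim 0 i) = 5 → L 0 i = 5 := by
    intro i h1 h2; simp only [L]; rw [if_pos ⟨trivial, h1⟩, if_pos h2]
  have hU5 : ∀ i, both i → W₀.γ (rim 0 i) = 5 → U 0 i = 5 := by
    intro i h1 h2; simp only [U]; rw [if_pos ⟨trivial, h1, h2⟩]
  have hL6 : ∀ i, both i → W₀.γ (rim 0 i) ≠ 5 → L 0 i = max (lo (rim 0 i)) 6 := by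
    intro i h1 h2; simp only [L]; rw [if_pos ⟨trivial, h1⟩, if_neg h2]
  have hU6 : ∀ i, W₀.γ (rim 0 i) ≠ 5 → U 0 i = hi (rim 0 i) := by
    intro i h2; simp only [U]; rw [if_neg fun h => h2 h.2.2]
  have hLn : ∀ j i, ¬ (j = 0 ∧ both i) → L j i = lo (rim j i) := by
    intro j i h; simp only [L]; rw [if_neg h]
  have hUn : ∀ j i, ¬ (j = 0 ∧ both i) → U j i = hi (rim j i) := by
    intro j i h; simp only [U]; rw [if_neg fun h' => h ⟨h'.1, h'.2.1⟩]
  have hγ5 := W₀.five_le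
  have hfix : ∀ j i, 2 ≤ j → rim j i ∈ X → L 0 i = W₀.γ (rim 0 i) ∧ U 0 i = W₀.γ (rim 0 i) ∧
      j + 4 ≤ L 0 i := by
    intro j i hj hmem
    obtain ⟨-, h2, h3, h4⟩ := hfan j i hj hmem
    by_cases hb : both i
    · rw [hL6 i hb (by omega), hU6 i (by omega)]
      omega
    · rw [hLn 0 i (fun h => hb h.2), hUn 0 i (fun h => hb h.2)]
      omega
  refine ⟨L, U, ?_, ?_, ?_, ?_⟩
  · intro j i
    have e1 := hlo (rim j i)
    have e2 := hhi (rim j i)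
    have e3 := hle (rim j i)
    by_cases hb : j = 0 ∧ both i
    · obtain ⟨rfl, hb⟩ := hb
      by_cases h5 : W₀.γ (rim 0 i) = 5
      · rw [hL5 i hb h5, hU5 i hb h5]; simp
      · rw [hL6 i hb h5, hU6 i h5]
        have h6 : 6 ≤ hi (rim 0 i) := by
          by_cases ha : rim 0 i ∈ X
          · have := hlohi _ ha
            have := hγ5 (rim 0 i)
            omega
          · simp [hi, if_neg ha]
        simp only [Set.mem_insert_iff, Set.mem_singleton_iff] at e1 e2 ⊢
        omega
    · rw [hLn j i hb, hUn j i hb]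
      exact ⟨e1, e2, e3⟩
  · intro j i hj hne
    have hmem : rim j i ∈ X := by
      by_contra hmem
      apply hne
      rw [hLn j i (by omega), hUn j i (by omega)]
      simp [lo, hi, if_neg hmem]
    have := hfix j i hj hmem
    omega
  · rintro W c h12 ⟨P, ⟨f, h⟩, a, hst⟩ j i hne
    -- By rigidity any pass in `W` with these ends is the rotated copy of `P₀`, so its bounds apply
    -- at the rotated positions.
    have hrigid := h₀.rigid hR hfs a₀ h a (c := c)
      (by cases toHub
          · exact hst.1.trans (by rw [hst₀.1, rot_hub])
          · exact hst.1.trans (by rw [hst₀.1, rot_rim]))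
      (by cases toHub
          · exact hst.2.trans (by rw [hst₀.2, rot_rim])
          · exact hst.2.trans (by rw [hst₀.2, rot_hub])) hhub₀
    have hbds : ∀ a ∈ X, lo a ≤ W.γ (rot c a) ∧ W.γ (rot c a) ≤ hi a := by
      intro b hb
      have := h.bounds a (hg b hb).1
      rw [hδ' _ (hg b hb).1, Nat.cast_le, hrigid _ (hg b hb).1, (hg b hb).2] at this
      simpa only [lo, hi, if_pos hb] using this
    have hW5 := W.five_le (rim 0 (i + c))
    by_cases hb : j = 0 ∧ both i
    · obtain ⟨rfl, hb⟩ := hb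
      -- The two hats come from two vertices of the rule; adjacency of these decides both sides.
      have hed : W₀.γ (rim 0 i) = 5 ↔ W.γ (rim 0 (i + c)) = 5 := by
        have e1 := a₀.isEdge_iff (u := rim 1 (i - 1)) (v := rim 1 i)
        have e2 := a.isEdge_iff (u := rim 1 (i + c - 1)) (v := rim 1 (i + c))
        rw [ed_hats_iff] at e1 e2
        have m1 := hg _ hb.1
        have m2 := hg _ hb.2
        have r1 : f (g (rim 1 (i - 1))) = rim 1 (i + c - 1) := by
          rw [hrigid _ m1.1, m1.2, rot_rim, sub_add_eq_add_sub]
        have r2 : f (g (rim 1 i)) = rim 1 (i + c) := by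
          rw [hrigid _ m2.1, m2.2, rot_rim]
        have k1 := h₀.iso.isEdge_iff m1.1 m2.1
        have k2 := h.iso.isEdge_iff m1.1 m2.1
        rw [m1.2, m2.2, e1] at k1
        rw [r1, r2, e2] at k2
        have n1 : rim 1 (i + c - 1) ∈ P.K.verts := r1 ▸ h.mem m1.1
        have n2 : rim 1 (i + c) ∈ P.K.verts := r2 ▸ h.mem m2.1
        exact ⟨fun h5 => (k2.2 (k1.1 ⟨hb.1, hb.2, h5⟩)).2.2,
          fun h5 => (k1.2 (k2.1 ⟨n1, n2, h5⟩)).2.2⟩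
      by_cases h5 : W₀.γ (rim 0 i) = 5
      · rw [hL5 i hb h5, hU5 i hb h5, hed.1 h5]
        simp
      · have h5' := mt hed.2 h5
        rw [hL6 i hb h5, hU6 i h5]
        by_cases ha : rim 0 i ∈ X
        · have := hbds _ ha
          rw [rot_rim] at this
          omega
        · have e1 : lo (rim 0 i) = 5 := by simp only [lo, if_neg ha]
          have e2 : hi (rim 0 i) = 12 := by simp only [hi, if_neg ha]
          have := h12 (i + c)
          omega
    · rw [hLn j i hb, hUn j i hb] at hne ⊢
      have ha : rim j i ∈ X := by
        by_contra ha
        apply hne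
        simp [lo, hi, if_neg ha]
      exact hbds _ ha
  · intro W c hbds h12
    have hagree : Agree W₀ W c P₀.K.verts := by
      constructor
      · intro j i hj hmem
        obtain ⟨h1, h2, h3⟩ := hfix j i hj hmem
        have := hbds 0 i (by omega)
        omega
      · intro i h1 h2
        have hW5 := W.five_le (rim 0 (i + c))
        by_cases h5 : W₀.γ (rim 0 i) = 5
        · have e1 := hL5 i ⟨h1, h2⟩ h5
          have e2 := hU5 i ⟨h1, h2⟩ h5
          have := hbds 0 i (by omega)
          omega
        · have e1 := hL6 i ⟨h1, h2⟩ h5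
          have := hbds 0 i (by omega)
          omega
    have hkey : ∀ j i, rim j i ∈ X →
        lo (rim j i) ≤ W.γ (rim j (i + c)) ∧ W.γ (rim j (i + c)) ≤ hi (rim j i) := by
      intro j i hmem
      have hloL : lo (rim j i) ≤ L j i := by
        by_cases hb : j = 0 ∧ both i
        · obtain ⟨rfl, hb⟩ := hb
          by_cases h5 : W₀.γ (rim 0 i) = 5
          · have := hlohi _ hmem
            rw [hL5 i hb h5]; omega
          · rw [hL6 i hb h5]; omega
        · rw [hLn j i hb]
      have hUhi : U j i ≤ hi (rim j i) := by
        by_cases hb : j = 0 ∧ both i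
        · obtain ⟨rfl, hb⟩ := hb
          by_cases h5 : W₀.γ (rim 0 i) = 5
          · have := hlohi _ hmem
            rw [hU5 i hb h5]; omega
          · rw [hU6 i h5]
        · rw [hUn j i hb]
      -- At an unrestricted position inside the pass the upper bound 12 still has to hold, and `h12`
      -- provides it. For a fan this is available because the degree of its spoke is prescribed.
      by_cases hne : L j i = 5 ∧ U j i = 12
      · have h1 := W.five_le (rim j (i + c))
        have h2 := h12 j i (by
          by_cases hj : j ≤ 1
          · exact Or.inl hj
          · have := hfix j i (by omega) hmem
            omega)
        omega
      · have := hbds j i hne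
        omega
    have htr := h₀.transfer (W := W) (c := c) (x := x₀) hd hR a₀ (by
      cases toHub
      · exact Or.inr hst₀
      · exact Or.inl hst₀) hagree (by
      intro v hv
      rw [hδ' v hv, Nat.cast_le]
      have hmem := h₀.mem hv
      have hgv := hgf v hv
      generalize f₀ v = b at hmem hgv
      rcases b with _ | ⟨j, i⟩
      · have := hlohi _ hmem
        rw [W₀.hub_eq] at this
        rw [rot_hub, W.hub_eq]
        simpa only [lo, hi, hX, if_pos hmem, hgv] using this
      · have := hkey j i hmem
        simpa only [lo, hi, hX, if_pos hmem, hgv, rot_rim] using this)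
    refine ⟨P₀.transfer W c, ⟨_, htr.1⟩, htr.2, ?_⟩
    cases toHub
    · exact ⟨congrArg (rot c) hst₀.1, congrArg (rot c) hst₀.2⟩
    · exact ⟨congrArg (rot c) hst₀.1, congrArg (rot c) hst₀.2⟩

/-- The cartwheel with given degrees of spokes, hats, and fans. -/
def Cartwheel.ofDegrees {d : ℕ} (hd : 5 ≤ d) (g : Position d → ℕ) (hg : ∀ p, 5 ≤ g p) :
    Cartwheel d where
  γ v := match v with
    | Vert.hub => d
    | Vert.rim j i => if h : j < 5 then g (⟨j, h⟩, i) else 5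
  five_le_deg := hd
  hub_eq := rfl
  five_le v := by
    rcases v with _ | ⟨j, i⟩
    · exact hd
    · dsimp only
      split
      · exact hg _
      · exact le_rfl

theorem Cartwheel.ofDegrees_rim {d : ℕ} (hd : 5 ≤ d) (g : Position d → ℕ) (hg : ∀ p, 5 ≤ g p)
    (j : Fin 5) (i : ZMod d) : (ofDegrees hd g hg).γ (Vert.rim j i) = g (j, i) := by
  simp [ofDegrees]

theorem Axle.IsAxle.five_le {d : ℕ} {A : Axle d} (hA : A.IsAxle) (p : Position d) : 5 ≤ A.l p := by
  have := hA.mem_l p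
  simp only [Set.mem_insert_iff, Set.mem_singleton_iff] at this
  omega

theorem Axle.IsAxle.le_twelve {d : ℕ} {A : Axle d} (hA : A.IsAxle) (p : Position d) :
    A.u p ≤ 12 := by
  have := hA.mem_u p
  simp only [Set.mem_insert_iff, Set.mem_singleton_iff] at this
  omega

/-- The outlet with given bounds. -/
def Outlet.ofBounds {d : ℕ} (x₀ : ZMod d) (L U : ℕ → ZMod d → ℕ) (r : ℤ) : Outlet d where
  M := {e | ∃ (j : Fin 5) (i : ZMod d), ¬ (L j i = 5 ∧ U j i = 12) ∧
    e = ⟨(j, i - (x₀ - 1)), L j i, U j i⟩}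
  r := r

/-- A single occurrence yields degree bounds that are necessary and sufficient for the pass to occur
at any spoke of any cartwheel with degrees at most 12 where they matter. Quantifying over compatible
cartwheels turns these into the conditions of being enforced and permitted. -/
theorem exists_isOutletOf {d : ℕ} (hd : 7 ≤ d) {R : Rule} (hR : R.IsRule) (hfs : R.FanSpoke d)
    (hβ : ∀ v ∈ R.G.verts, R.β v ∈ ({5, 6, 7, 8, 9} : Set ℕ))
    (hδ : ∀ v ∈ R.G.verts, ∃ n ∈ ({5, 6, 7, 8, 12} : Set ℕ), R.δ v = n)
    {toHub : Bool} {W₀ : Cartwheel d} {x₀ : ZMod d} (h : HasPass W₀ R toHub x₀) :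
    ∃ T : Outlet d, IsOutletOf R toHub T := by
  obtain ⟨L, U, hmem, hfan, hto, hfrom⟩ := exists_outlet_bounds hd hR hfs hβ hδ h
  have hshift : ∀ (j : Fin 5) (i x : ZMod d),
      shift (j, i - (x₀ - 1)) x = (j, i + (x - x₀)) := by
    intro j i x
    simp only [shift, Prod.mk.injEq, true_and]
    ring
  -- The admissible lower and upper bounds have only `5, 6, 7, 8` in common. Hence a prescribed
  -- spoke has at most the fan layers `2, 3, 4`, and five layers of positions suffice.
  have h8 : ∀ i, L 0 i = U 0 i → L 0 i ≤ 8 := by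
    intro i h
    obtain ⟨h1, h2, -⟩ := hmem 0 i
    simp only [Set.mem_insert_iff, Set.mem_singleton_iff] at h1 h2
    omega
  have hne0 : ∀ i, L 0 i = U 0 i → ¬ (L 0 i = 5 ∧ U 0 i = 12) := by
    intro i h; omega
  have hfin : ∀ j i, 2 ≤ j → ¬ (L j i = 5 ∧ U j i = 12) → j < 5 := by
    intro j i hj hne
    obtain ⟨h1, h2⟩ := hfan j i hj hne
    have := h8 i h1
    omega
  have : NeZero d := ⟨by omega⟩
  have hcomp : ∀ (A : Axle d), A.IsAxle → ∀ W : Cartwheel d, W.Compatible A →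
      ∀ i, W.γ (Vert.rim 0 i) ≤ 12 := by
    intro A hA W hW i
    exact (hW 0 i (Or.inl (by simp))).2.trans (hA.le_twelve _)
  let T := Outlet.ofBounds x₀ L U (if toHub then (R.r : ℤ) else -(R.r : ℤ))
  -- bounds on a cartwheel from bounds on the entries of `T`
  have hsat : ∀ (W : Cartwheel d) (x : ZMod d), HasPass W R toHub x →
      (∀ i, W.γ (Vert.rim 0 i) ≤ 12) → ∀ e ∈ T.M,
      e.l ≤ W.γ (Vert.rim (shift e.p x).1 (shift e.p x).2) ∧
        W.γ (Vert.rim (shift e.p x).1 (shift e.p x).2) ≤ e.u := by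
    rintro W x hP h12 e ⟨j, i, hne, rfl⟩
    rw [hshift]
    exact hto W (x - x₀) h12 (by rwa [add_sub_cancel]) j i hne
  have hpass : ∀ (A : Axle d) (W : Cartwheel d) (x : ZMod d), A.IsAxle → W.Compatible A →
      (∀ e ∈ T.M, (shift e.p x).1 ≤ 1 → e.l ≤ W.γ (Vert.rim (shift e.p x).1 (shift e.p x).2) ∧
        W.γ (Vert.rim (shift e.p x).1 (shift e.p x).2) ≤ e.u) →
      (∀ i, L 0 i = U 0 i → ∀ j : Fin 5, 2 ≤ j → (j : ℕ) + 4 ≤ L 0 i →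
        (¬ (L j i = 5 ∧ U j i = 12) → L j i ≤ W.γ (Vert.rim j (i + (x - x₀))) ∧
          W.γ (Vert.rim j (i + (x - x₀))) ≤ U j i) ∧ W.γ (Vert.rim j (i + (x - x₀))) ≤ 12) →
      HasPass W R toHub x := by
    intro A W x hA hW hlow hhigh
    rw [← add_sub_cancel x₀ x]
    have h2 : ∀ (j : ℕ) (hj : j < 5), 2 ≤ j → (2 : Fin 5) ≤ ⟨j, hj⟩ := fun j hj h => h
    refine hfrom W (x - x₀) (fun j i hne => ?_) (fun j i hji => ?_)
    · by_cases hj : j ≤ 1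
      · have := hlow _ ⟨⟨j, by omega⟩, i, hne, rfl⟩ (by rw [hshift]; exact hj)
        rwa [hshift] at this
      · have h5 := hfin j i (by omega) hne
        obtain ⟨e1, e2⟩ := hfan j i (by omega) hne
        exact (hhigh i e1 ⟨j, h5⟩ (h2 j h5 (by omega)) e2).1 hne
    · by_cases hj : j ≤ 1
      · exact (hW ⟨j, by omega⟩ _ (Or.inl hj)).2.trans (hA.le_twelve _)
      · obtain ⟨e1, e2⟩ := hji.resolve_left hj
        have := h8 i e1
        have h5 : j < 5 := by omega
        exact (hhigh i e1 ⟨j, h5⟩ (h2 j h5 (by omega)) e2).2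
  refine ⟨T, ⟨?_, ?_, ?_, ?_, ?_, ?_⟩, ⟨?_, ?_⟩, rfl, ?_, ?_⟩
  · have : T.M ⊆ Set.range fun q : Fin 5 × ZMod d =>
        (⟨(q.1, q.2 - (x₀ - 1)), L q.1 q.2, U q.1 q.2⟩ : Entry d) := by
      rintro e ⟨j, i, -, rfl⟩
      exact ⟨(j, i), rfl⟩
    exact (Set.finite_range _).subset this
  · have := hR.pos
    change (if toHub then (R.r : ℤ) else -(R.r : ℤ)) ≠ 0
    split_ifs <;> omega
  · rintro e ⟨j, i, -, rfl⟩
    exact (hmem j i).2.2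
  · rintro e ⟨j, i, -, rfl⟩
    exact (hmem j i).1
  · rintro e ⟨j, i, -, rfl⟩
    exact (hmem j i).2.1
  · rintro e ⟨j, i, hne, rfl⟩ hj
    obtain ⟨e1, e2⟩ := hfan j i hj hne
    exact ⟨⟨(0, i - (x₀ - 1)), L 0 i, U 0 i⟩, ⟨0, i, hne0 i e1, rfl⟩, rfl, e1, e2⟩
  · rintro e ⟨j, i, hne, rfl⟩ e' ⟨j', i', hne', rfl⟩ hp
    simp only [Prod.mk.injEq, sub_left_inj] at hp
    obtain ⟨rfl, rfl⟩ := hp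
    rfl
  · rintro e ⟨j, i, hne, rfl⟩
    exact hne
  · intro A x hA
    constructor
    · intro hE W hW
      refine hpass A W x hA hW (fun e he hj => ?_) (fun i hLU j hj hjL => ?_)
      · obtain ⟨e1, -, e3⟩ := hE e he
        obtain ⟨w1, w2⟩ := hW (shift e.p x).1 (shift e.p x).2 (Or.inl hj)
        exact ⟨e1.trans w1, w2.trans e3⟩
      · have hs := hE _ ⟨0, i, hne0 i hLU, rfl⟩
        rw [hshift] at hs
        have hs' : L 0 i ≤ A.l (0, i + (x - x₀)) ∧ A.l (0, i + (x - x₀)) ≤ A.u (0, i + (x - x₀)) ∧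
          A.u (0, i + (x - x₀)) ≤ U 0 i := hs
        obtain ⟨w1, w2⟩ := hW j (i + (x - x₀)) (Or.inr ⟨by omega, by omega⟩)
        refine ⟨fun hne => ?_, w2.trans (hA.le_twelve _)⟩
        have hs := hE _ ⟨j, i, hne, rfl⟩
        rw [hshift] at hs
        exact ⟨hs.1.trans w1, w2.trans hs.2.2⟩
    · intro hall e he
      have hl := hA.five_le
      have hu : ∀ p, 5 ≤ A.u p := fun p => (hl p).trans (hA.le p)
      -- The two extreme cartwheels, with all degrees lowest and with all degrees highest, show that
      -- the interval of `A` lies within that of the outlet.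
      have hWl : (Cartwheel.ofDegrees (by omega) A.l hl).Compatible A := by
        intro j i _
        rw [Cartwheel.ofDegrees_rim]
        exact ⟨le_rfl, hA.le _⟩
      have hWu : (Cartwheel.ofDegrees (by omega) A.u hu).Compatible A := by
        intro j i _
        rw [Cartwheel.ofDegrees_rim]
        exact ⟨hA.le _, le_rfl⟩
      have h1 := hsat _ x (hall _ hWl) (hcomp A hA _ hWl) e he
      have h2 := hsat _ x (hall _ hWu) (hcomp A hA _ hWu) e he
      rw [Cartwheel.ofDegrees_rim] at h1 h2
      exact ⟨h1.1, hA.le _, h2.2⟩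
  · intro A x hA
    constructor
    · intro hP
      -- The intervals of `A` and of the outlet overlap at each position, and distinct entries have
      -- distinct positions; so a common degree can be chosen position by position.
      have hex : ∀ p : Position d, ∃ n, A.l p ≤ n ∧ n ≤ A.u p ∧
          ∀ (j : Fin 5) i, ¬ (L j i = 5 ∧ U j i = 12) → p = (j, i + (x - x₀)) →
            L j i ≤ n ∧ n ≤ U j i := by
        rintro ⟨j, k⟩
        have hA' := hA.le (j, k)
        by_cases hne : L j (k - (x - x₀)) = 5 ∧ U j (k - (x - x₀)) = 12
        · refine ⟨A.l (j, k), le_rfl, hA', ?_⟩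
          rintro j' i hne' hp
          simp only [Prod.mk.injEq] at hp
          obtain ⟨rfl, rfl⟩ := hp
          rw [add_sub_cancel_right] at hne
          exact absurd hne hne'
        · have hs := hP _ ⟨j, k - (x - x₀), hne, rfl⟩
          rw [hshift, sub_add_cancel] at hs
          have hLU := (hmem j (k - (x - x₀))).2.2
          dsimp only at hs
          refine ⟨max (A.l (j, k)) (L j (k - (x - x₀))), le_max_left _ _, max_le hA' hs.2, ?_⟩
          rintro j' i hne' hp
          simp only [Prod.mk.injEq] at hp
          obtain ⟨rfl, rfl⟩ := hp
          rw [add_sub_cancel_right] at hs hLU ⊢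
          exact ⟨le_max_right _ _, max_le hs.1 hLU⟩
      choose n hn1 hn2 hn3 using hex
      have hn5 : ∀ p, 5 ≤ n p := fun p => (hA.five_le p).trans (hn1 p)
      have hW : (Cartwheel.ofDegrees (by omega) n hn5).Compatible A := by
        intro j i _
        rw [Cartwheel.ofDegrees_rim]
        exact ⟨hn1 _, hn2 _⟩
      refine ⟨_, hW, hpass A _ x hA hW ?_ (fun i _ j _ _ => ?_)⟩
      · rintro e ⟨j, i, hne, rfl⟩ -
        rw [Cartwheel.ofDegrees_rim, hshift]
        exact hn3 _ j i hne rfl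
      · rw [Cartwheel.ofDegrees_rim]
        exact ⟨fun hne => hn3 _ j i hne rfl, (hn2 _).trans (hA.le_twelve _)⟩
    · rintro ⟨W, hW, hP⟩ e he
      have hs := hsat W x hP (hcomp A hA W hW)
      have he' := hs e he
      obtain ⟨j, i, hne, rfl⟩ := he
      rw [hshift] at he' ⊢
      dsimp only at he' ⊢
      have hcov : ∀ hc : (j ≤ 1 ∨ (A.l (0, i + (x - x₀)) = A.u (0, i + (x - x₀)) ∧
          (j : ℕ) + 4 ≤ A.l (0, i + (x - x₀)))), A.l (j, i + (x - x₀)) ≤ U j i ∧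
            L j i ≤ A.u (j, i + (x - x₀)) := fun hc => by
        obtain ⟨w1, w2⟩ := hW j (i + (x - x₀)) hc
        exact ⟨w1.trans he'.2, he'.1.trans w2⟩
      by_cases hj : j ≤ 1
      · exact hcov (Or.inl hj)
      · have hj2 : (2 : Fin 5) ≤ j := by
          rw [Fin.le_def] at hj ⊢
          simp at hj ⊢
          omega
        obtain ⟨e1, e2⟩ := hfan j i hj2 hne
        -- An entry at a fan comes with an entry prescribing its spoke. If `A` also prescribes that
        -- spoke, the two values agree through `W`, so the fan exists in the part of `A`. Otherwise
        -- `A` leaves the fan free.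
        by_cases hA0 : A.l (0, i + (x - x₀)) = A.u (0, i + (x - x₀))
        · refine hcov (Or.inr ⟨hA0, ?_⟩)
          have hs0 := hs _ ⟨0, i, hne0 i e1, rfl⟩
          rw [hshift] at hs0
          have w := hW 0 (i + (x - x₀)) (Or.inl (by simp))
          dsimp only at hs0
          have w' : A.l (0, i + (x - x₀)) ≤ W.γ (Vert.rim ((0 : Fin 5) : ℕ) (i + (x - x₀))) := w.1
          have e3 : L ((0 : Fin 5) : ℕ) i = L 0 i := rfl
          have e4 : U ((0 : Fin 5) : ℕ) i = U 0 i := rfl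
          omega
        · obtain ⟨f1, f2⟩ := hA.free _ hA0 j hj2
          rw [f1, f2]
          obtain ⟨g1, g2, -⟩ := hmem j i
          simp only [Set.mem_insert_iff, Set.mem_singleton_iff] at g1 g2
          omega

/-! ### The family of unit rules -/

theorem Rule.IsRule.mirror {R : Rule} (hR : R.IsRule) : R.mirror.IsRule where
  nearTriangulation := hR.nearTriangulation.mirror
  noCut := hR.noCut
  bounds := hR.bounds
  pos := hR.pos
  edge := hR.edge
  near_s := hR.near_s
  near_t := hR.near_t

/-- The mirror image of a pass. -/
def Pass.mirror {V : Type} (P : Pass V) : Pass V :=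
  { P with K := { P.K with toDrawing := P.K.toDrawing.mirror } }

theorem Pass.ObeysVia.mirror {V : Type} {P : Pass V} {R : Rule} {f : ℕ → V}
    (h : P.ObeysVia R f) : P.mirror.ObeysVia R.mirror f := by
  obtain ⟨hP, hr, ⟨h1, h2, h3⟩, hs, ht, hb⟩ := h
  exact ⟨⟨hP.configuration.mirror, hP.pos, hP.edge, hP.near_s, hP.near_t⟩, hr,
    ⟨h1, h2, fun a ha b hb c hc => h3 c hc b hb a ha⟩, hs, ht, hb⟩

/-- The same pass, with another value. -/
def Pass.setValue {V : Type} (P : Pass V) (r : ℕ) : Pass V := { P with r := r }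

theorem Pass.IsPass.setValue {V : Type} {P : Pass V} (hP : P.IsPass) {r : ℕ} (hr : 0 < r) :
    (P.setValue r).IsPass :=
  ⟨hP.configuration, hr, hP.edge, hP.near_s, hP.near_t⟩

/-- Coherence passes from the preserving to the reversing orientation; applied to the mirror image
of `P` it gives the converse. -/
theorem Pass.OrientObeys.symm_of_isSymmetric {V : Type} {P : Pass V} {R : Rule}
    (hR : R.IsCoherent) (hs : R.IsSymmetric) (h : P.AntiObeys R) : P.OrientObeys R := by
  obtain ⟨f, hf⟩ := h
  obtain ⟨g, hg⟩ := hR.reflect hs V P.mirror ⟨f, hf.mirror⟩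
  exact ⟨g, hg.mirror⟩

section Unit

variable {m : ℕ} {R' : Fin m → Rule} {d : ℕ}

/-- A rule of the family before its value and its upper bounds are changed. -/
def orientedRule (R' : Fin m → Rule) (ρ : RuleIndex R') : Rule :=
  if ρ.2.2.1 then (R' ρ.1).mirror else R' ρ.1

theorem unitRule_eq (ρ : RuleIndex R') :
    unitRule R' ρ = { orientedRule R' ρ with
      r := 1, δ := fun v => min ((orientedRule R' ρ).δ v) 12 } := rfl

theorem orientedRule_verts (ρ : RuleIndex R') :
    (orientedRule R' ρ).G.verts = (R' ρ.1).G.verts := by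
  unfold orientedRule; split <;> rfl

theorem orientedRule_β (ρ : RuleIndex R') : (orientedRule R' ρ).β = (R' ρ.1).β := by
  unfold orientedRule; split <;> rfl

theorem orientedRule_δ (ρ : RuleIndex R') : (orientedRule R' ρ).δ = (R' ρ.1).δ := by
  unfold orientedRule; split <;> rfl

theorem orientedRule_r (ρ : RuleIndex R') : (orientedRule R' ρ).r = (R' ρ.1).r := by
  unfold orientedRule; split <;> rfl

theorem isRule_orientedRule (hR : ∀ j, (R' j).IsRule) (ρ : RuleIndex R') :
    (orientedRule R' ρ).IsRule := by
  unfold orientedRule; split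
  · exact (hR _).mirror
  · exact hR _

theorem unitRule_β_mem (hβ : ∀ j, ∀ v ∈ (R' j).G.verts, (R' j).β v ∈ ({5, 6, 7, 8, 9} : Set ℕ))
    (ρ : RuleIndex R') (v : ℕ) (hv : v ∈ (unitRule R' ρ).G.verts) :
    (unitRule R' ρ).β v ∈ ({5, 6, 7, 8, 9} : Set ℕ) := by
  rw [unitRule_eq] at hv ⊢
  dsimp only at hv ⊢
  rw [orientedRule_verts] at hv
  rw [orientedRule_β]
  exact hβ _ _ hv

theorem unitRule_δ_mem
    (hδ : ∀ j, ∀ v ∈ (R' j).G.verts, (R' j).δ v ∈ ({5, 6, 7, 8, ⊤} : Set ℕ∞))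
    (ρ : RuleIndex R') (v : ℕ) (hv : v ∈ (unitRule R' ρ).G.verts) :
    ∃ n ∈ ({5, 6, 7, 8, 12} : Set ℕ), (unitRule R' ρ).δ v = n := by
  rw [unitRule_eq] at hv ⊢
  dsimp only at hv ⊢
  rw [orientedRule_verts] at hv
  rw [orientedRule_δ]
  have := hδ _ _ hv
  simp only [Set.mem_insert_iff, Set.mem_singleton_iff] at this
  rcases this with h | h | h | h | h <;> rw [h]
  · exact ⟨5, by simp, by rw [min_eq_left] <;> norm_num⟩
  · exact ⟨6, by simp, by rw [min_eq_left] <;> norm_num⟩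
  · exact ⟨7, by simp, by rw [min_eq_left] <;> norm_num⟩
  · exact ⟨8, by simp, by rw [min_eq_left] <;> norm_num⟩
  · exact ⟨12, by simp, by simp⟩

theorem le_nine_of_mem {n : ℕ} (h : n ∈ ({5, 6, 7, 8, 9} : Set ℕ)) : n ≤ 9 := by
  simp only [Set.mem_insert_iff, Set.mem_singleton_iff] at h
  omega

theorem isRule_unitRule (hR : ∀ j, (R' j).IsRule)
    (hβ : ∀ j, ∀ v ∈ (R' j).G.verts, (R' j).β v ∈ ({5, 6, 7, 8, 9} : Set ℕ))
    (ρ : RuleIndex R') : (unitRule R' ρ).IsRule := by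
  have h := isRule_orientedRule hR ρ
  refine ⟨h.nearTriangulation, h.noCut, fun v hv => ⟨(h.bounds v hv).1, ?_⟩, Nat.one_pos, h.edge,
    fun v hv => ?_, fun v hv => ?_⟩
  · have h9 : ((unitRule R' ρ).β v : ℕ∞) ≤ 12 := by
      exact_mod_cast (le_nine_of_mem (unitRule_β_mem hβ ρ v hv)).trans (by norm_num)
    exact le_min (h.bounds v hv).2 h9
  · exact (h.near_s v hv).imp_right (Or.imp_right fun ⟨w, h1, h2, h3⟩ =>
      ⟨w, h1, h2, (min_le_left _ _).trans h3⟩)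
  · exact (h.near_t v hv).imp_right (Or.imp_right fun ⟨w, h1, h2, h3⟩ =>
      ⟨w, h1, h2, (min_le_left _ _).trans h3⟩)

theorem Pass.ObeysVia.of_unitRule {V : Type} {P : Pass V} {f : ℕ → V} (hR : ∀ j, (R' j).IsRule)
    {ρ : RuleIndex R'} (h : P.ObeysVia (unitRule R' ρ) f) :
    (P.setValue (R' ρ.1).r).ObeysVia (orientedRule R' ρ) f := by
  obtain ⟨hP, hr, hiso, hs, ht, hb⟩ := h
  exact ⟨hP.setValue (hR _).pos, (orientedRule_r ρ).symm, hiso, hs, ht,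
    fun v hv => ⟨(hb v hv).1, (hb v hv).2.trans (min_le_left _ _)⟩⟩

theorem Pass.ObeysVia.to_unitRule {V : Type} {P : Pass V} {f : ℕ → V}
    {ρ : RuleIndex R'} (h : P.ObeysVia (orientedRule R' ρ) f)
    (h12 : ∀ v ∈ P.K.verts, P.K.γ v ≤ 12) :
    (P.setValue 1).ObeysVia (unitRule R' ρ) f := by
  obtain ⟨hP, hr, hiso, hs, ht, hb⟩ := h
  exact ⟨hP.setValue Nat.one_pos, rfl, hiso, hs, ht,
    fun v hv => ⟨(hb v hv).1, le_min (hb v hv).2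
      (by exact_mod_cast h12 _ (hiso.1.mapsTo hv))⟩⟩

/-- Coherence survives the truncation of `δ` at 12, since `β ≤ 9` and hence `β = δ` is not
disturbed. -/
theorem fanSpoke_unitRule (hR : ∀ j, (R' j).IsRule) (hcoh : ∀ j, (R' j).IsCoherent)
    (hβ : ∀ j, ∀ v ∈ (R' j).G.verts, (R' j).β v ∈ ({5, 6, 7, 8, 9} : Set ℕ))
    (ρ : RuleIndex R') : (unitRule R' ρ).FanSpoke d := by
  intro W P f h a hhub j i hj hmem
  have h' := h.of_unitRule hR
  have hcase : (P.setValue (R' ρ.1).r).ObeysVia (R' ρ.1) f ∨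
      (P.setValue (R' ρ.1).r).ObeysVia (R' ρ.1).mirror f := by
    unfold orientedRule at h'
    split at h'
    · exact Or.inr h'
    · exact Or.inl h'
  obtain ⟨h1, h2⟩ := (hcoh ρ.1).fan_spoke d W _ f hcase a hhub j i hj hmem
  refine ⟨h1, fun v hv hfv => ?_⟩
  have h9 : ((R' ρ.1).β v : ℕ∞) ≤ 12 := by
    exact_mod_cast (le_nine_of_mem (hβ ρ.1 v (orientedRule_verts ρ ▸ hv))).trans (by norm_num)
  have h3 := h2 v (orientedRule_verts ρ ▸ hv) hfv
  rw [unitRule_eq]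
  dsimp only
  rw [orientedRule_β, orientedRule_δ, ← h3, min_eq_left h9]

/-- Each pass that obeys a coherent rule obeys exactly one of its orientations in the family. -/
theorem Pass.Obeys.exists_flag {V : Type} {P : Pass V} (hcoh : ∀ j, (R' j).IsCoherent) {j : Fin m}
    (h : P.Obeys (R' j)) : ∃ o : {o : Bool // o = true → ¬ (R' j).IsSymmetric},
      ∀ (c : Fin (R' j).r) (o' : {o : Bool // o = true → ¬ (R' j).IsSymmetric}),
        P.OrientObeys (orientedRule R' ⟨j, c, o'⟩) ↔ o' = o := by
  by_cases hs : (R' j).IsSymmetric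
  · have ho : P.OrientObeys (R' j) := by
      rcases h with h | h
      · exact h
      · exact Pass.OrientObeys.symm_of_isSymmetric (hcoh j) hs h
    refine ⟨⟨false, by simp⟩, fun c o' => ?_⟩
    obtain ⟨_ | _, ho'⟩ := o'
    · exact ⟨fun _ => rfl, fun _ => ho⟩
    · exact absurd hs (ho' rfl)
  · rcases h with h | h
    · refine ⟨⟨false, by simp⟩, fun c o' => ?_⟩
      obtain ⟨_ | _, ho'⟩ := o'
      · exact ⟨fun _ => rfl, fun _ => h⟩
      · refine ⟨fun h' => absurd ⟨V, P, h, h'⟩ hs, fun h' => ?_⟩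
        simp at h'
    · refine ⟨⟨true, fun _ => hs⟩, fun c o' => ?_⟩
      obtain ⟨_ | _, ho'⟩ := o'
      · refine ⟨fun h' => absurd ⟨V, P, h', h⟩ hs, fun h' => ?_⟩
        simp at h'
      · exact ⟨fun _ => rfl, fun _ => h⟩

theorem Pass.OrientObeys.obeys {V : Type} {P : Pass V} {ρ : RuleIndex R'}
    (h : P.OrientObeys (orientedRule R' ρ)) : P.Obeys (R' ρ.1) := by
  unfold orientedRule at h
  split at h
  · exact Or.inr h
  · exact Or.inl h

/-! ### Counting passes -/

/-- The ends of `P` are the hub and the spoke `x`. -/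
def Pass.HasEnds {d : ℕ} (P : Pass (Vert d)) (toHub : Bool) (x : ZMod d) : Prop :=
  if toHub then P.s = Vert.rim 0 x ∧ P.t = Vert.hub else P.s = Vert.hub ∧ P.t = Vert.rim 0 x

theorem Pass.HasEnds.unique {P : Pass (Vert d)} {toHub : Bool} {x y : ZMod d}
    (h : P.HasEnds toHub x) (h' : P.HasEnds toHub y) : x = y := by
  cases toHub
  · have := h.2.symm.trans h'.2; simpa using this
  · have := h.1.symm.trans h'.1; simpa using this

theorem Pass.AppearsIn.exists_hasEnds {P : Pass (Vert d)} {W : Cartwheel d} (hP : P.IsPass)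
    (a : P.AppearsIn W) {toHub : Bool} (h : if toHub then P.t = Vert.hub else P.s = Vert.hub) :
    ∃ x, P.HasEnds toHub x := by
  have hed := (a.isEdge_iff.1 hP.edge).2.2
  cases toHub
  · have h' : P.s = Vert.hub := h
    rw [h'] at hed
    obtain ⟨x, hx⟩ := hed.nbr
    exact ⟨x, h', hx⟩
  · have h' : P.t = Vert.hub := h
    rw [h'] at hed
    obtain ⟨x, hx⟩ := (Cartwheel.Ed.symm _ _ hed).nbr
    exact ⟨x, hx, h'⟩

theorem Pass.HasEnds.hub {P : Pass (Vert d)} {toHub : Bool} {x : ZMod d}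
    (h : P.HasEnds toHub x) : if toHub then P.t = Vert.hub else P.s = Vert.hub := by
  cases toHub
  · exact h.1
  · exact h.2

noncomputable instance : Fintype (RuleIndex R') := Fintype.ofFinite _

open Classical in
/-- The total value of the passes into or out of the hub, counted by rules of value one. -/
theorem finsum_passes {𝓟 : Set Rule} (hR' : IsCoherentSplitting 𝓟 R')
    (hβ : ∀ j, ∀ v ∈ (R' j).G.verts, (R' j).β v ∈ ({5, 6, 7, 8, 9} : Set ℕ))
    [NeZero d] (W : Cartwheel d) (h12 : ∀ v, W.γ v ≤ 12) (toHub : Bool) :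
    ∑ᶠ P ∈ {P : Pass (Vert d) | (∃ R ∈ 𝓟, P.Obeys R) ∧ P.AppearsIn W ∧
      if toHub then P.t = Vert.hub else P.s = Vert.hub}, (P.r : ℤ) =
    ∑ x : ZMod d, ∑ ρ : RuleIndex R', if HasPass W (unitRule R' ρ) toHub x then 1 else 0 := by
  set S := {P : Pass (Vert d) | (∃ R ∈ 𝓟, P.Obeys R) ∧ P.AppearsIn W ∧
      if toHub then P.t = Vert.hub else P.s = Vert.hub} with hS
  have hcoh := hR'.coherent
  -- Double counting of incidences between passes and pairs of a spoke and a unit rule. Each pair is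
  -- met by at most one pass (`hB`), and each pass meets as many pairs as its value (`hC`).
  let rel : Pass (Vert d) → ZMod d × RuleIndex R' → Prop := fun P z =>
    P.HasEnds toHub z.1 ∧ P.OrientObeys (orientedRule R' z.2) ∧ P.AppearsIn W
  have hγ : ∀ P : Pass (Vert d), P.AppearsIn W → ∀ v ∈ P.K.verts, P.K.γ v ≤ 12 := by
    intro P a v _
    rw [a.γ_eq]; exact h12 v
  have hrelS : ∀ P z, rel P z → P ∈ S := fun P z ⟨h1, h2, h3⟩ =>
    ⟨(hR'.same _ P).2 ⟨_, h2.obeys⟩, h3, h1.hub⟩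
  have hA : ∀ z, HasPass W (unitRule R' z.2) toHub z.1 ↔ ∃ P, rel P z := by
    intro z
    constructor
    · rintro ⟨P, ⟨f, hf⟩, a, he⟩
      exact ⟨P.setValue (R' z.2.1).r, he, ⟨f, hf.of_unitRule hR'.isRule⟩, a⟩
    · rintro ⟨P, he, ⟨f, hf⟩, a⟩
      exact ⟨P.setValue 1, ⟨f, hf.to_unitRule (hγ P a)⟩, a, he⟩
  have hB : ∀ P Q z, rel P z → rel Q z → P = Q := by
    rintro P Q z ⟨he, ⟨f, hf⟩, a⟩ ⟨he', ⟨g, hg⟩, a'⟩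
    have hr : P.r = Q.r := hf.2.1.trans hg.2.1.symm
    have hst : P.s = Q.s ∧ P.t = Q.t ∧ (Q.s = Vert.hub ∨ Q.t = Vert.hub) := by
      cases toHub
      · exact ⟨he.1.trans he'.1.symm, he.2.trans he'.2.symm, Or.inl he'.1⟩
      · exact ⟨he.1.trans he'.1.symm, he.2.trans he'.2.symm, Or.inr he'.2⟩
    have := (hg.to_unitRule (hγ Q a')).eq_of_eq (P := P.setValue 1) (W := W)
      (isRule_unitRule hR'.isRule hβ z.2)
      (fanSpoke_unitRule hR'.isRule hcoh hβ z.2) a' (hf.to_unitRule (hγ P a)) a hst.1 hst.2.1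
      hst.2.2
    obtain ⟨K, r, s, t⟩ := P
    obtain ⟨K', r', s', t'⟩ := Q
    simp only [Pass.setValue, Pass.mk.injEq] at this hr ⊢
    tauto
  have hC : ∀ P ∈ S, (Finset.univ.filter fun z => rel P z).card = P.r := by
    rintro P ⟨hob, a, hhub⟩
    obtain ⟨j, hj⟩ := (hR'.same _ P).1 hob
    have hP : P.IsPass ∧ P.r = (R' j).r := by
      rcases hj with ⟨f, hf⟩ | ⟨f, hf⟩
      · exact ⟨hf.1, hf.2.1⟩
      · exact ⟨hf.1, hf.2.1⟩
    obtain ⟨x, hx⟩ := a.exists_hasEnds hP.1 hhub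
    obtain ⟨o, ho⟩ := hj.exists_flag hcoh
    -- The ends fix the spoke, the splitting fixes the rule, coherence fixes the orientation; only
    -- the choice among the copies remains free.
    have heq : (Finset.univ.filter fun z => rel P z) =
        Finset.univ.image fun c : Fin (R' j).r => ((x, ⟨j, c, o⟩) : ZMod d × RuleIndex R') := by
      ext ⟨y, ρ⟩
      simp only [Finset.mem_filter, Finset.mem_univ, true_and, Finset.mem_image]
      constructor
      · rintro ⟨h1, h2, -⟩
        obtain rfl := hx.unique h1
        obtain ⟨j', c, o'⟩ := ρ
        obtain rfl : j = j' := hR'.once _ P _ _ hj h2.obeys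
        obtain rfl := (ho c o').1 h2
        exact ⟨c, rfl⟩
      · rintro ⟨c, hc⟩
        obtain ⟨rfl, rfl⟩ := Prod.mk.inj hc
        exact ⟨hx, (ho c o).2 rfl, a⟩
    rw [heq, Finset.card_image_of_injective, Finset.card_univ, Fintype.card_fin, hP.2]
    intro c c' hc
    exact (Prod.mk.inj (eq_of_heq (Sigma.mk.inj (Prod.mk.inj hc).2).2)).1
  have hpos : ∀ P ∈ S, ∃ z, rel P z := by
    intro P hP
    have h1 := hC P hP
    have h2 : 0 < P.r := by
      obtain ⟨⟨R, -, hR⟩, -⟩ := hP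
      rcases hR with ⟨f, hf⟩ | ⟨f, hf⟩ <;> exact hf.1.pos
    rw [← h1, Finset.card_pos] at h2
    obtain ⟨z, hz⟩ := h2
    exact ⟨z, (Finset.mem_filter.1 hz).2⟩
  -- Without finiteness the `finsum` would be 0 by convention. A pass is recovered from any pair
  -- related to it, and there are finitely many pairs.
  have hfin : S.Finite := by
    choose z hz using hpos
    have : Finite S := Finite.of_injective (fun P : S => z P.1 P.2) fun P Q hPQ =>
      Subtype.ext (hB P.1 Q.1 (z P.1 P.2) (hz P.1 P.2)
        ((show z P.1 P.2 = z Q.1 Q.2 from hPQ) ▸ hz Q.1 Q.2))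
    exact Set.toFinite S
  rw [finsum_mem_eq_finite_toFinset_sum _ hfin, ← Fintype.sum_prod_type'
    (f := fun x ρ => if HasPass W (unitRule R' ρ) toHub x then (1 : ℤ) else 0)]
  have h1 : ∀ P ∈ hfin.toFinset, (P.r : ℤ) = ∑ z, if rel P z then 1 else 0 := by
    intro P hP
    rw [← hC P (hfin.mem_toFinset.1 hP), Finset.sum_boole]
  rw [Finset.sum_congr rfl h1, Finset.sum_comm]
  refine Finset.sum_congr rfl fun z _ => ?_
  by_cases hz : ∃ P, rel P z
  · rw [if_pos ((hA z).2 hz)]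
    obtain ⟨P, hP⟩ := hz
    rw [Finset.sum_eq_single P]
    · exact if_pos hP
    · exact fun Q _ hne => if_neg fun hQ => hne (hB _ _ _ hQ hP)
    · exact fun h => absurd (hfin.mem_toFinset.2 (hrelS P z hP)) h
  · rw [if_neg (mt (hA z).1 hz)]
    exact Finset.sum_eq_zero fun P _ => if_neg fun h => hz ⟨P, h⟩

open Classical in
/-- The contribution of the spoke `x` to the charge of the hub. -/
noncomputable def spokeCharge (R' : Fin m → Rule) (W : Cartwheel d) (x : ZMod d) : ℤ :=
  ∑ τ : OutletIndex d R', if HasPass W (unitRule R' τ.1.1) τ.1.2 x then (outlet τ).r else 0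

theorem outlet_spec (τ : OutletIndex d R') :
    IsOutletOf (unitRule R' τ.1.1) τ.1.2 (outlet τ) := τ.2.choose_spec

-- The spoke charges range only over rules and directions that have an outlet. Nothing is lost,
-- since an occurring pass guarantees that the outlet exists.
open Classical in
theorem netCharge_eq {𝓟 : Set Rule} (hR' : IsCoherentSplitting 𝓟 R')
    (hβ : ∀ j, ∀ v ∈ (R' j).G.verts, (R' j).β v ∈ ({5, 6, 7, 8, 9} : Set ℕ))
    (hδ : ∀ j, ∀ v ∈ (R' j).G.verts, (R' j).δ v ∈ ({5, 6, 7, 8, ⊤} : Set ℕ∞))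
    [NeZero d] (hd : 7 ≤ d) (W : Cartwheel d) (h12 : ∀ v, W.γ v ≤ 12) :
    netCharge 𝓟 W = 10 * (6 - (d : ℤ)) + ∑ x : ZMod d, spokeCharge R' W x := by
  have h1 := finsum_passes hR' hβ W h12 true
  have h2 := finsum_passes hR' hβ W h12 false
  simp only [if_true, Bool.false_eq_true, if_false] at h1 h2
  rw [netCharge, h1, h2, add_sub_assoc, ← Finset.sum_sub_distrib]
  congr 1
  refine Finset.sum_congr rfl fun x _ => ?_
  have hspoke : spokeCharge R' W x = ∑ τ : OutletIndex d R',
      (fun q : RuleIndex R' × Bool => if HasPass W (unitRule R' q.1) q.2 x then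
        (if q.2 then (1 : ℤ) else -1) else 0) τ.1 := by
    refine Finset.sum_congr rfl fun τ _ => ?_
    rw [(outlet_spec τ).value]
    rfl
  have hsub := Finset.sum_subtype (F := (inferInstance : Fintype (OutletIndex d R')))
      (p := fun q : RuleIndex R' × Bool => ∃ T : Outlet d, IsOutletOf (unitRule R' q.1) q.2 T)
      (Finset.univ.filter fun q : RuleIndex R' × Bool =>
        ∃ T : Outlet d, IsOutletOf (unitRule R' q.1) q.2 T) (by simp)
      (fun q : RuleIndex R' × Bool => if HasPass W (unitRule R' q.1) q.2 x then
        (if q.2 then (1 : ℤ) else -1) else 0)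
  rw [hspoke]
  refine Eq.trans ?_ hsub
  rw [Finset.sum_filter_of_ne, Fintype.sum_prod_type, ← Finset.sum_sub_distrib]
  · refine Finset.sum_congr rfl fun ρ _ => ?_
    rw [Fintype.sum_bool]
    simp only [if_true, Bool.false_eq_true, if_false]
    split_ifs <;> simp
  · intro q _ hq
    have hpass : HasPass W (unitRule R' q.1) q.2 x := by
      by_contra h
      exact hq (if_neg h)
    exact exists_isOutletOf hd (isRule_unitRule hR'.isRule hβ _)
      (fanSpoke_unitRule hR'.isRule hR'.coherent hβ _) (unitRule_β_mem hβ _)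
      (unitRule_δ_mem hδ _) hpass

end Unit

/-! ### Positioned outlets and the cartwheels that satisfy them -/

namespace Cartwheel

variable {d : ℕ}

/-- The degrees of `W` lie between the bounds of the positioned outlet `(T, x)`. -/
def Fits (W : Cartwheel d) (T : Outlet d) (x : ZMod d) : Prop :=
  ∀ e ∈ T.M, e.l ≤ W.γ (Vert.rim (shift e.p x).1 (shift e.p x).2) ∧
    W.γ (Vert.rim (shift e.p x).1 (shift e.p x).2) ≤ e.u

open Classical in
/-- The tightest axle with which `W` is compatible. -/
noncomputable def axle (W : Cartwheel d) : Axle d where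
  l p := if p.1 ≤ 1 ∨ W.γ (Vert.rim 0 p.2) ≤ 8 then min (W.γ (Vert.rim p.1 p.2)) 9 else 5
  u p := if (p.1 ≤ 1 ∨ W.γ (Vert.rim 0 p.2) ≤ 8) ∧ W.γ (Vert.rim p.1 p.2) ≤ 8
    then W.γ (Vert.rim p.1 p.2) else 12

theorem isAxle_axle (W : Cartwheel d) : W.axle.IsAxle where
  le p := by
    simp only [axle]
    split_ifs <;> grind
  mem_l p := by
    have := W.five_le (Vert.rim p.1 p.2)
    simp only [axle, Set.mem_insert_iff, Set.mem_singleton_iff]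
    split_ifs <;> omega
  mem_u p := by
    have := W.five_le (Vert.rim p.1 p.2)
    simp only [axle, Set.mem_insert_iff, Set.mem_singleton_iff]
    split_ifs <;> omega
  free i h j hj := by
    have hj' : ¬ j ≤ 1 := by
      rw [Fin.le_def] at hj ⊢
      simp at hj ⊢
      omega
    have h8 : ¬ W.γ (Vert.rim 0 i) ≤ 8 := by
      intro h8
      apply h
      simp [axle, h8]
      omega
    simp [axle, hj', h8]

theorem compatible_axle (W : Cartwheel d) (h12 : ∀ v, W.γ v ≤ 12) : W.Compatible W.axle := by
  intro j i _
  have := W.five_le (Vert.rim j i)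
  have := h12 (Vert.rim j i)
  simp only [axle]
  constructor <;> split_ifs <;> omega

/-- The defining property of an outlet speaks about axles. Applied to the tightest axle of `W`, it
bounds the degrees of `W` itself: degrees up to 8 are recorded exactly, and larger ones as `(9,
12)`, an interval that an outlet permits only if its upper bound is 12. -/
theorem fits_of_hasPass {W : Cartwheel d} (h12 : ∀ v, W.γ v ≤ 12) {R : Rule} {toHub : Bool}
    {T : Outlet d} (hT : IsOutletOf R toHub T) {x : ZMod d} (h : HasPass W R toHub x) :
    W.Fits T x := by
  have hP := (hT.permitted W.axle x W.isAxle_axle).2 ⟨W, W.compatible_axle h12, h⟩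
  have key : ∀ e ∈ T.M, (shift e.p x).1 ≤ 1 ∨ W.γ (Vert.rim 0 (shift e.p x).2) ≤ 8 →
      e.l ≤ W.γ (Vert.rim (shift e.p x).1 (shift e.p x).2) ∧
        W.γ (Vert.rim (shift e.p x).1 (shift e.p x).2) ≤ e.u := by
    intro e he hdet
    have h1 := hP e he
    have h2 := hT.isOutlet.mem_l e he
    have h3 := hT.isOutlet.mem_u e he
    have h4 := h12 (Vert.rim (shift e.p x).1 (shift e.p x).2)
    simp only [axle, hdet, if_true, true_and] at h1
    simp only [Set.mem_insert_iff, Set.mem_singleton_iff] at h2 h3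
    split_ifs at h1 <;> omega
  intro e he
  by_cases hj : (shift e.p x).1 ≤ 1
  · exact key e he (Or.inl hj)
  · have hj2 : 2 ≤ e.p.1 := by
      have hj' : ¬ e.p.1 ≤ 1 := hj
      rw [Fin.le_def] at hj' ⊢
      simp at hj' ⊢
      omega
    -- The accompanying entry has equal bounds, hence at most 8, so the spoke is small enough for
    -- `W.axle` to record its fans.
    obtain ⟨e', he', hp, hlu, -⟩ := hT.isOutlet.fan e he hj2
    have h1 := (key e' he' (Or.inl (by rw [hp]; simp [shift]))).2
    have h2 := hT.isOutlet.mem_l e' he'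
    have h3 := hT.isOutlet.mem_u e' he'
    simp only [Set.mem_insert_iff, Set.mem_singleton_iff] at h2 h3
    rw [hp] at h1
    have h4 : W.γ (Vert.rim 0 (shift e.p x).2) ≤ e'.u := h1
    exact key e he (Or.inr (by omega))

end Cartwheel

/-! ### Axles tightened by positioned outlets -/

namespace Axle

variable {d : ℕ} {A : Axle d} {S : Set (Outlet d × ZMod d)}

theorem le_meet_l (hS : ∀ q ∈ S, q.1.IsOutlet) (p : Position d) :
    A.l p ≤ (A.meet S).l p ∧
      ∀ q ∈ S, ∀ e ∈ q.1.M, shift e.p q.2 = p → e.l ≤ (A.meet S).l p :=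
  Nat.sInf_mem (s := {n | A.l p ≤ n ∧ ∀ q ∈ S, ∀ e ∈ q.1.M, shift e.p q.2 = p → e.l ≤ n})
    ⟨max (A.l p) 9, le_max_left _ _, fun q hq e he _ =>
      (le_nine_of_mem ((hS q hq).mem_l e he)).trans (le_max_right _ _)⟩

theorem meet_l_le {p : Position d} {n : ℕ} (h : A.l p ≤ n)
    (h' : ∀ q ∈ S, ∀ e ∈ q.1.M, shift e.p q.2 = p → e.l ≤ n) : (A.meet S).l p ≤ n :=
  Nat.sInf_le ⟨h, h'⟩

theorem meet_u_le (p : Position d) :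
    (A.meet S).u p ≤ A.u p ∧
      ∀ q ∈ S, ∀ e ∈ q.1.M, shift e.p q.2 = p → (A.meet S).u p ≤ e.u :=
  Nat.sSup_mem (s := {n | n ≤ A.u p ∧ ∀ q ∈ S, ∀ e ∈ q.1.M, shift e.p q.2 = p → n ≤ e.u})
    ⟨0, Nat.zero_le _, fun _ _ _ _ _ => Nat.zero_le _⟩ ⟨A.u p, fun _ h => h.1⟩

theorem le_meet_u {p : Position d} {n : ℕ} (h : n ≤ A.u p)
    (h' : ∀ q ∈ S, ∀ e ∈ q.1.M, shift e.p q.2 = p → n ≤ e.u) : n ≤ (A.meet S).u p :=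
  le_csSup (s := {n | n ≤ A.u p ∧ ∀ q ∈ S, ∀ e ∈ q.1.M, shift e.p q.2 = p → n ≤ e.u})
    ⟨A.u p, fun _ h => h.1⟩ ⟨h, h'⟩

/-- The new bound is attained by one of the given ones, so it stays among the admissible values. -/
theorem meet_l_eq_or (hA : A.IsAxle) (hS : ∀ q ∈ S, q.1.IsOutlet) (p : Position d) :
    (A.meet S).l p = A.l p ∨
      ∃ q ∈ S, ∃ e ∈ q.1.M, shift e.p q.2 = p ∧ (A.meet S).l p = e.l := by
  by_contra! h
  obtain ⟨h1, h2⟩ := le_meet_l (A := A) hS p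
  have h5 := hA.five_le p
  have := meet_l_le (A := A) (S := S) (p := p) (n := (A.meet S).l p - 1) (by have := h.1; omega)
    fun q hq e he hp => by
      have := h.2 q hq e he hp
      have := h2 q hq e he hp
      omega
  omega

theorem meet_u_eq_or (p : Position d) :
    (A.meet S).u p = A.u p ∨
      ∃ q ∈ S, ∃ e ∈ q.1.M, shift e.p q.2 = p ∧ (A.meet S).u p = e.u := by
  by_contra! h
  obtain ⟨h1, h2⟩ := meet_u_le (A := A) (S := S) p
  have := le_meet_u (A := A) (S := S) (p := p) (n := (A.meet S).u p + 1)
    (by have := h.1; omega) fun q hq e he hp => by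
      have := h.2 q hq e he hp
      have := h2 q hq e he hp
      omega
  omega

variable {W : Cartwheel d}

/-- Tightening may prescribe a spoke that `A` leaves open, so that its fans become relevant. For
these `A` has only the vacuous bounds `(5, 12)`, which hold since degrees in `W` are at most 12. -/
theorem compatible_of_meet (hA : A.IsAxle) (hW : W.Compatible A)
    (h12 : ∀ v, W.γ v ≤ 12) (hfit : ∀ q ∈ S, W.Fits q.1 q.2) : W.Compatible (A.meet S) := by
  intro j i hji
  have key : A.l (j, i) ≤ W.γ (Vert.rim j i) ∧ W.γ (Vert.rim j i) ≤ A.u (j, i) := by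
    by_cases hj : j ≤ 1
    · exact hW j i (Or.inl hj)
    · obtain ⟨h1, h2⟩ := hji.resolve_left hj
      by_cases h0 : A.l (0, i) = A.u (0, i)
      · refine hW j i (Or.inr ⟨h0, ?_⟩)
        have := (meet_u_le (A := A) (S := S) (0, i)).1
        omega
      · have hj2 : 2 ≤ j := by
          rw [Fin.le_def] at hj ⊢
          simp at hj ⊢
          omega
        obtain ⟨e1, e2⟩ := hA.free i h0 j hj2
        rw [e1, e2]
        exact ⟨W.five_le _, h12 _⟩
  refine ⟨meet_l_le key.1 fun q hq e he hp => ?_, le_meet_u key.2 fun q hq e he hp => ?_⟩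
  · have := (hfit q hq e he).1
    rwa [hp] at this
  · have := (hfit q hq e he).2
    rwa [hp] at this

/-- The degrees of `W` witness that the combined bounds are consistent. An outlet with an entry at a
fan also prescribes the spoke, so fans over spokes left open are not touched. -/
theorem isAxle_meet (hA : A.IsAxle) (hS : ∀ q ∈ S, q.1.IsOutlet) (hW : W.Compatible A)
    (hfit : ∀ q ∈ S, W.Fits q.1 q.2) : (A.meet S).IsAxle where
  le := by
    rintro ⟨j, i⟩
    by_cases hent : ∃ q ∈ S, ∃ e ∈ q.1.M, shift e.p q.2 = (j, i)
    · have hent' : j ≤ 1 ∨ (j : ℕ) + 4 ≤ W.γ (Vert.rim 0 i) := by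
        obtain ⟨q, hq, e, he, hp⟩ := hent
        by_cases hj : j ≤ 1
        · exact Or.inl hj
        · have hpj : e.p.1 = j := congrArg Prod.fst hp
          have hpi : (shift e.p q.2).2 = i := congrArg Prod.snd hp
          have hj2 : 2 ≤ e.p.1 := by
            rw [hpj]
            rw [Fin.le_def] at hj ⊢
            simp at hj ⊢
            omega
          obtain ⟨e', he', hp', -, hle⟩ := (hS q hq).fan e he hj2
          have := (hfit q hq e' he').1
          rw [hp'] at this
          have h3 : e'.l ≤ W.γ (Vert.rim 0 (shift e.p q.2).2) := this
          rw [hpi] at h3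
          rw [hpj] at hle
          exact Or.inr (hle.trans h3)
      have hex : ∃ n, A.l (j, i) ≤ n ∧ n ≤ A.u (j, i) ∧ ∀ q ∈ S, ∀ e ∈ q.1.M,
          shift e.p q.2 = (j, i) → e.l ≤ n ∧ n ≤ e.u := by
        have hf : ∀ q ∈ S, ∀ e ∈ q.1.M, shift e.p q.2 = (j, i) →
            e.l ≤ W.γ (Vert.rim j i) ∧ W.γ (Vert.rim j i) ≤ e.u := fun q hq e he hp => by
          have := hfit q hq e he
          rwa [hp] at this
        by_cases hrel : j ≤ 1 ∨ A.l (0, i) = A.u (0, i)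
        · have : A.l (j, i) ≤ W.γ (Vert.rim j i) ∧ W.γ (Vert.rim j i) ≤ A.u (j, i) := by
            refine hW j i ?_
            by_cases hj : j ≤ 1
            · exact Or.inl hj
            · refine Or.inr ⟨hrel.resolve_left hj, (hent'.resolve_left hj).trans ?_⟩
              have h0 : W.γ (Vert.rim 0 i) ≤ A.u (0, i) := (hW 0 i (Or.inl (by simp))).2
              have := hrel.resolve_left hj
              omega
          exact ⟨_, this.1, this.2, hf⟩
        · push Not at hrel
          have hj2 : 2 ≤ j := by
            have := hrel.1
            rw [Fin.lt_def] at this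
            rw [Fin.le_def]
            simp at this ⊢
            omega
          obtain ⟨e1, e2⟩ := hA.free i hrel.2 j hj2
          -- Here the degree of `W` need not be at most 12. Cutting it down keeps it above the lower
          -- bounds, which are at most 9.
          refine ⟨min (W.γ (Vert.rim j i)) 12, ?_, ?_, fun q hq e he hp => ?_⟩
          · have := W.five_le (Vert.rim j i)
            omega
          · omega
          · have h1 := hf q hq e he hp
            have h2 := le_nine_of_mem ((hS q hq).mem_l e he)
            omega
      obtain ⟨n, h1, h2, h3⟩ := hex
      exact (meet_l_le h1 fun q hq e he hp => (h3 q hq e he hp).1).trans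
        (le_meet_u h2 fun q hq e he hp => (h3 q hq e he hp).2)
    · push Not at hent
      exact (meet_l_le le_rfl fun q hq e he hp => absurd hp (hent q hq e he)).trans
        ((hA.le _).trans (le_meet_u le_rfl fun q hq e he hp => absurd hp (hent q hq e he)))
  mem_l p := by
    rcases meet_l_eq_or hA hS p with h | ⟨q, hq, e, he, -, h⟩
    · rw [h]; exact hA.mem_l p
    · rw [h]; exact (hS q hq).mem_l e he
  mem_u p := by
    rcases meet_u_eq_or (A := A) (S := S) p with h | ⟨q, hq, e, he, -, h⟩
    · rw [h]; exact hA.mem_u p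
    · rw [h]; exact (hS q hq).mem_u e he
  free i hne j hj := by
    have hl0 := le_meet_l (A := A) hS (0, i)
    have hu0 := meet_u_le (A := A) (S := S) (0, i)
    have hw0 := hW 0 i (Or.inl (by simp))
    have hf0 : ∀ q ∈ S, ∀ e ∈ q.1.M, shift e.p q.2 = (0, i) →
        e.l ≤ W.γ (Vert.rim 0 i) ∧ W.γ (Vert.rim 0 i) ≤ e.u := fun q hq e he hp => by
      have := hfit q hq e he
      rw [hp] at this
      exact this
    have h0 : (A.meet S).l (0, i) ≤ W.γ (Vert.rim 0 i) :=
      meet_l_le hw0.1 fun q hq e he hp => (hf0 q hq e he hp).1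
    have h0' : W.γ (Vert.rim 0 i) ≤ (A.meet S).u (0, i) :=
      le_meet_u hw0.2 fun q hq e he hp => (hf0 q hq e he hp).2
    have hno : ∀ q ∈ S, ∀ e ∈ q.1.M, shift e.p q.2 ≠ (j, i) := by
      intro q hq e he hp
      have hpj : e.p.1 = j := congrArg Prod.fst hp
      have hpi : (shift e.p q.2).2 = i := congrArg Prod.snd hp
      obtain ⟨e', he', hp', hlu, -⟩ := (hS q hq).fan e he (hpj ▸ hj)
      have hp0 : shift e'.p q.2 = (0, i) := by
        rw [hp', ← hpi]; rfl
      have h1 := hl0.2 q hq e' he' hp0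
      have h2 := hu0.2 q hq e' he' hp0
      omega
    have hne0 : A.l (0, i) ≠ A.u (0, i) := by
      have := hl0.1
      have := hu0.1
      omega
    obtain ⟨e1, e2⟩ := hA.free i hne0 j hj
    have h1 := (le_meet_l (A := A) hS (j, i)).1
    have h2 := meet_l_le (A := A) (S := S) (p := (j, i)) le_rfl
      fun q hq e he hp => absurd hp (hno q hq e he)
    have h3 := (meet_u_le (A := A) (S := S) (j, i)).1
    have h4 := le_meet_u (A := A) (S := S) (p := (j, i)) le_rfl
      fun q hq e he hp => absurd hp (hno q hq e he)
    omega

theorem meet_enforces (hA : (A.meet S).IsAxle) (hS : ∀ q ∈ S, q.1.IsOutlet)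
    {q : Outlet d × ZMod d} (hq : q ∈ S) : (A.meet S).Enforces q.1 q.2 := fun e he =>
  ⟨(le_meet_l hS _).2 q hq e he rfl, hA.le _, (meet_u_le _).2 q hq e he rfl⟩

end Axle

/-! ### Hubcaps -/

section Hubcap

variable {m d : ℕ} {R' : Fin m → Rule} {𝒢 : Set (Config ℕ)} {A : Axle d} {W : Cartwheel d}

open Classical in
theorem spokeCharge_add_le_hubcapBound (hA : A.IsAxle) (hW : W.Compatible A)
    (h12 : ∀ v, W.γ v ≤ 12) (hgood : ¬ GoodAppears 𝒢 W) (x y : ZMod d) :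
    ((spokeCharge R' W x + spokeCharge R' W y : ℤ) : WithBot ℤ) ≤ hubcapBound 𝒢 R' A x y := by
  -- The outlets whose passes occur in `W`. The flag keeps the two placements apart even if `x = y`,
  -- where every outlet has to be counted twice.
  let S : Finset (OutletIndex d R' × Bool) := Finset.univ.filter fun q =>
    HasPass W (unitRule R' q.1.1.1) q.1.1.2 (if q.2 then y else x)
  have hS : ∀ q ∈ placed x y '' (S : Set (OutletIndex d R' × Bool)), q.1.IsOutlet := by
    rintro _ ⟨q, -, rfl⟩
    exact (outlet_spec q.1).isOutlet
  have hfit : ∀ q ∈ placed x y '' (S : Set (OutletIndex d R' × Bool)), W.Fits q.1 q.2 := by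
    rintro _ ⟨q, hq, rfl⟩
    exact Cartwheel.fits_of_hasPass h12 (outlet_spec q.1) (Finset.mem_filter.1 hq).2
  have hA' := Axle.isAxle_meet hA hS hW hfit
  have hW' := Axle.compatible_of_meet hA hW h12 hfit
  -- An enforced outlet has its pass in every cartwheel compatible with the tightened axle, and `W`
  -- is one; so nothing beyond `S` is enforced.
  have henf : ∀ q : OutletIndex d R' × Bool,
      (A.meet (placed x y '' (S : Set (OutletIndex d R' × Bool)))).Enforces
        (placed x y q).1 (placed x y q).2 ↔
      HasPass W (unitRule R' q.1.1.1) q.1.1.2 (if q.2 then y else x) := by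
    intro q
    constructor
    · exact fun h => ((outlet_spec q.1).enforced _ _ hA').1 h W hW'
    · exact fun h => Axle.meet_enforces hA' hS
        ⟨q, Finset.mem_filter.2 ⟨Finset.mem_univ _, h⟩, rfl⟩
  unfold hubcapBound
  refine le_trans (le_of_eq ?_) (Finset.le_sup (b := S) (Finset.mem_filter.2
    ⟨Finset.mem_univ _, hA', fun hred => hgood (hred W hW')⟩))
  rw [WithBot.coe_inj, Finset.sum_filter]
  simp only [henf]
  rw [Fintype.sum_prod_type, spokeCharge, spokeCharge, ← Finset.sum_add_distrib]
  refine Finset.sum_congr rfl fun τ _ => ?_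
  rw [Fintype.sum_bool]
  simp only [if_true, Bool.false_eq_true, if_false]
  exact add_comm _ _

theorem IsHubcap.sum_map [NeZero d] {H : List (ZMod d × ZMod d × ℤ)} (hH : IsHubcap H)
    (F : ZMod d → ℤ) : (H.map fun h => F h.1 + F h.2.1).sum = 2 * ∑ i, F i := by
  have h1 : (H.map fun h => F h.1 + F h.2.1).sum =
      ((H.map (fun h => h.1) ++ H.map (fun h => h.2.1)).map F).sum := by
    rw [List.map_append, List.sum_append, List.map_map, List.map_map, ← List.sum_map_add]
    rfl
  rw [h1, Finset.sum_list_map_count, Finset.mul_sum]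
  have huniv : (H.map (fun h => h.1) ++ H.map (fun h => h.2.1)).toFinset = Finset.univ := by
    ext i
    simp only [List.mem_toFinset, Finset.mem_univ, iff_true]
    rw [← List.count_pos_iff, hH i]
    norm_num
  rw [huniv]
  refine Finset.sum_congr rfl fun i _ => ?_
  rw [hH i]
  simp

theorem sum_spokeCharge_le [NeZero d] (hA : A.IsAxle) (hcap : A.HasHubcap 𝒢 R')
    (hW : W.Compatible A) (h12 : ∀ v, W.γ v ≤ 12) (hgood : ¬ GoodAppears 𝒢 W) :
    10 * (6 - (d : ℤ)) + ∑ x : ZMod d, spokeCharge R' W x ≤ 0 := by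
  obtain ⟨H, hH, hle, hsum⟩ := hcap
  have h1 : (H.map fun h => spokeCharge R' W h.1 + spokeCharge R' W h.2.1).sum ≤
      (H.map fun h => h.2.2).sum := List.sum_le_sum fun h hh => by
    have := (spokeCharge_add_le_hubcapBound hA hW h12 hgood h.1 h.2.1).trans (hle h hh)
    exact WithBot.coe_le_coe.1 this
  rw [hH.sum_map] at h1
  -- The left side is an integer, which is why half of the sum may be rounded down.
  have h2 : ∑ x : ZMod d, spokeCharge R' W x ≤
      ⌊(1 / 2 : ℚ) * ((H.map (fun h => h.2.2)).sum : ℤ)⌋ := by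
    rw [Int.le_floor]
    have : (2 * ∑ x : ZMod d, spokeCharge R' W x : ℚ) ≤ ((H.map (fun h => h.2.2)).sum : ℤ) := by
      exact_mod_cast h1
    push_cast at this ⊢
    linarith
  linarith

end Hubcap

/-! ### Large degrees -/

namespace Cartwheel

open Vert

variable {d : ℕ} {W W' : Cartwheel d}

/-- The degrees of spokes in `W` and `W'` are equal, and other degrees are equal or large. -/
structure Close (W W' : Cartwheel d) : Prop where
  spoke : ∀ i, W.γ (rim 0 i) = W'.γ (rim 0 i)
  near : ∀ v, W.γ v = W'.γ v ∨ (12 ≤ W.γ v ∧ 12 ≤ W'.γ v)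

theorem Close.symm (h : Close W W') : Close W' W :=
  ⟨fun i => (h.spoke i).symm, fun v => (h.near v).imp Eq.symm And.symm⟩

theorem Close.cw (h : Close W W') {a b c : Vert d} (hc : W.Cw a b c) : W'.Cw a b c := by
  have hout : ∀ i j, W.outer i j = W'.outer i j := fun i j => by
    simp only [outer, h.spoke]
  induction hc with
  | spokes i => exact .spokes i
  | hat i => exact .hat i
  | fan i j h1 h2 => rw [hout, hout]; exact .fan i j h1 (h.spoke i ▸ h2)
  | rot a b c _ ih => exact .rot _ _ _ ih

theorem Close.verts_eq (h : Close W W') : W.verts = W'.verts := by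
  ext v
  rcases v with _ | ⟨j, i⟩
  · exact Iff.rfl
  · change (j ≤ 1 ∨ j + 4 ≤ W.γ (rim 0 i)) ↔ (j ≤ 1 ∨ j + 4 ≤ W'.γ (rim 0 i))
    rw [h.spoke]

theorem Close.restrict_toDrawing (h : Close W W') (X : Set (Vert d)) :
    (W'.config.restrict X).toDrawing = (W.config.restrict X).toDrawing := by
  have hcw : W'.Cw = W.Cw := by
    funext a b c
    exact propext ⟨h.symm.cw, h.cw⟩
  simp only [Config.restrict, config, hcw]

theorem Close.appearsIn (h : Close W W') {K : Config (Vert d)} (hK : K.AppearsIn W) :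
    (W'.config.restrict K.verts).AppearsIn W' := by
  obtain ⟨hc, X, hX, rfl⟩ := hK
  refine ⟨hc.congr_large (h.restrict_toDrawing X) fun v _ => ?_, X, h.verts_eq ▸ hX, rfl⟩
  rcases v with _ | ⟨_ | j, i⟩
  · exact Or.inl (W'.hub_eq.trans W.hub_eq.symm)
  · exact Or.inl (h.spoke i).symm
  · rcases h.near (rim (j + 1) i) with e | ⟨e1, e2⟩
    · exact Or.inl e.symm
    · exact Or.inr ⟨e1, e2, deg_outer_le j i⟩

/-- In a copy of a good configuration all degrees are at most 11, so they are the same in both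
cartwheels. -/
theorem Close.goodAppears (h : Close W W') {𝒢 : Set (Config ℕ)}
    (h𝒢 : ∀ K ∈ 𝒢, ∀ v ∈ K.verts, K.γ v ≤ 11) (hg : GoodAppears 𝒢 W) : GoodAppears 𝒢 W' := by
  obtain ⟨K, hK, L, hL, f, hf, hγ⟩ := hg
  refine ⟨_, h.appearsIn hK, L, hL, f, ?_, ?_⟩
  · obtain ⟨-, X, -, rfl⟩ := hK
    change (W'.config.restrict X).toDrawing.OrientIso L.toDrawing f ∨
      (W'.config.restrict X).toDrawing.OrientIso L.toDrawing.mirror f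
    rwa [h.restrict_toDrawing]
  · intro v hv
    have hfv : f v ∈ L.verts := hf.elim (fun h => h.1.mapsTo hv) (fun h => h.1.mapsTo hv)
    have h1 := h𝒢 L hL _ hfv
    have h2 := hγ v hv
    obtain ⟨-, X, -, rfl⟩ := hK
    change L.γ (f v) = W.γ v at h2
    change L.γ (f v) = W'.γ v
    have := h.near v
    omega

/-- The pass in `W` with the same drawing as `P`. -/
def placePass (W : Cartwheel d) (P : Pass (Vert d)) : Pass (Vert d) :=
  { P with K := W.config.restrict P.K.verts }

/-- A degree of at least 12 exceeds every `β` and every finite `δ`; a rule that admits one such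
degree admits all. -/
theorem Close.obeysVia (h : Close W W') {P : Pass (Vert d)} (a : P.AppearsIn W) {R : Rule}
    (hβ : ∀ v ∈ R.G.verts, R.β v ∈ ({5, 6, 7, 8, 9} : Set ℕ))
    (hδ : ∀ v ∈ R.G.verts, R.δ v ∈ ({5, 6, 7, 8, ⊤} : Set ℕ∞)) {f : ℕ → Vert d}
    (hf : P.ObeysVia R f) : (W'.placePass P).ObeysVia R f := by
  have hD : (W'.placePass P).K.toDrawing = P.K.toDrawing := by
    conv_rhs => rw [a.eq]
    exact h.restrict_toDrawing _
  obtain ⟨hP, hr, hiso, hs, ht, hb⟩ := hf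
  refine ⟨⟨(h.appearsIn a).1, hP.pos, ?_, ?_, ?_⟩, hr, ?_, hs, ht, fun v hv => ?_⟩
  · rw [hD]; exact hP.edge
  · rw [hD]; exact hP.near_s
  · rw [hD]; exact hP.near_t
  · rw [hD]; exact hiso
  · have hbv := hb v hv
    rw [a.γ_eq] at hbv
    change R.β v ≤ W'.γ (f v) ∧ (W'.γ (f v) : ℕ∞) ≤ R.δ v
    rcases h.near (f v) with e | ⟨e1, e2⟩
    · rwa [← e]
    · refine ⟨(le_nine_of_mem (hβ v hv)).trans (by omega), ?_⟩
      have h12 : (12 : ℕ∞) ≤ R.δ v := le_trans (by exact_mod_cast e1) hbv.2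
      have hδv := hδ v hv
      simp only [Set.mem_insert_iff, Set.mem_singleton_iff] at hδv
      rcases hδv with e | e | e | e | e <;> rw [e] at h12 ⊢
      · exact absurd h12 (by norm_num)
      · exact absurd h12 (by norm_num)
      · exact absurd h12 (by norm_num)
      · exact absurd h12 (by norm_num)
      · exact le_top

theorem placePass_placePass {P : Pass (Vert d)} (a : P.AppearsIn W) :
    W.placePass (W'.placePass P) = P := by
  obtain ⟨K, r, s, t⟩ := P
  have : K = W.config.restrict K.verts := a.eq
  simp only [placePass, Pass.mk.injEq, and_true]
  exact this.symm

variable {𝓟 : Set Rule} {m : ℕ} {R' : Fin m → Rule}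

theorem Close.obeys (h : Close W W') (hR' : IsCoherentSplitting 𝓟 R')
    (hβ : ∀ j, ∀ v ∈ (R' j).G.verts, (R' j).β v ∈ ({5, 6, 7, 8, 9} : Set ℕ))
    (hδ : ∀ j, ∀ v ∈ (R' j).G.verts, (R' j).δ v ∈ ({5, 6, 7, 8, ⊤} : Set ℕ∞))
    {P : Pass (Vert d)} (a : P.AppearsIn W) (hP : ∃ R ∈ 𝓟, P.Obeys R) :
    ∃ R ∈ 𝓟, (W'.placePass P).Obeys R := by
  rw [hR'.same] at hP ⊢
  obtain ⟨j, ⟨f, hf⟩ | ⟨f, hf⟩⟩ := hP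
  · exact ⟨j, Or.inl ⟨f, h.obeysVia a (hβ j) (hδ j) hf⟩⟩
  · exact ⟨j, Or.inr ⟨f, h.obeysVia (R := (R' j).mirror) a (hβ j) (hδ j) hf⟩⟩

theorem Close.finsum_passes_eq (h : Close W W') (hR' : IsCoherentSplitting 𝓟 R')
    (hβ : ∀ j, ∀ v ∈ (R' j).G.verts, (R' j).β v ∈ ({5, 6, 7, 8, 9} : Set ℕ))
    (hδ : ∀ j, ∀ v ∈ (R' j).G.verts, (R' j).δ v ∈ ({5, 6, 7, 8, ⊤} : Set ℕ∞))
    (E : Vert d → Vert d → Prop) :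
    ∑ᶠ P ∈ {P : Pass (Vert d) | (∃ R ∈ 𝓟, P.Obeys R) ∧ P.AppearsIn W ∧ E P.s P.t}, (P.r : ℤ) =
    ∑ᶠ P ∈ {P : Pass (Vert d) | (∃ R ∈ 𝓟, P.Obeys R) ∧ P.AppearsIn W' ∧ E P.s P.t},
      (P.r : ℤ) := by
  refine finsum_mem_eq_of_bijOn W'.placePass ?_ fun P _ => rfl
  refine Set.InvOn.bijOn (f' := W.placePass) ⟨?_, ?_⟩ ?_ ?_
  · exact fun P hP => placePass_placePass hP.2.1
  · exact fun P hP => placePass_placePass hP.2.1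
  · exact fun P hP => ⟨h.obeys hR' hβ hδ hP.2.1 hP.1, h.appearsIn hP.2.1, hP.2.2⟩
  · exact fun P hP => ⟨h.symm.obeys hR' hβ hδ hP.2.1 hP.1, h.symm.appearsIn hP.2.1, hP.2.2⟩

theorem Close.netCharge_eq (h : Close W W') (hR' : IsCoherentSplitting 𝓟 R')
    (hβ : ∀ j, ∀ v ∈ (R' j).G.verts, (R' j).β v ∈ ({5, 6, 7, 8, 9} : Set ℕ))
    (hδ : ∀ j, ∀ v ∈ (R' j).G.verts, (R' j).δ v ∈ ({5, 6, 7, 8, ⊤} : Set ℕ∞)) :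
    netCharge 𝓟 W = netCharge 𝓟 W' := by
  rw [netCharge, netCharge, h.finsum_passes_eq hR' hβ hδ fun _ t => t = hub,
    h.finsum_passes_eq hR' hβ hδ fun s _ => s = hub]

/-- The cartwheel with the degrees greater than `12` replaced by `12`. -/
def truncate (W : Cartwheel d) (hd : d ≤ 12) : Cartwheel d where
  γ v := min (W.γ v) 12
  five_le_deg := W.five_le_deg
  hub_eq := by rw [W.hub_eq]; exact min_eq_left hd
  five_le v := le_min (W.five_le v) (by norm_num)

end Cartwheel

/-! ### Conclusion -/

theorem mainTheorem3
    (𝒢 : Set (Config ℕ))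
    (h𝒢 : ∀ K ∈ 𝒢, K.IsConfiguration ∧ ∀ v ∈ K.verts, K.γ v ≤ 11)
    (𝓟 : Set Rule) (h𝓟 : 𝓟.Finite) (h𝓟_rule : ∀ R ∈ 𝓟, R.IsRule)
    {m : ℕ} (R' : Fin m → Rule) (hR' : IsCoherentSplitting 𝓟 R')
    (hβ : ∀ j, ∀ v ∈ (R' j).G.verts, (R' j).β v ∈ ({5, 6, 7, 8, 9} : Set ℕ))
    (hδ : ∀ j, ∀ v ∈ (R' j).G.verts, (R' j).δ v ∈ ({5, 6, 7, 8, ⊤} : Set ℕ∞))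
    (d : ℕ) (hd : 7 ≤ d) (hd' : d ≤ 11)
    (A : Axle d) (hA : A.IsAxle) (hcap : A.HasHubcap 𝒢 R') :
    A.Successful 𝒢 𝓟 := by
  intro W hW
  have : NeZero d := ⟨by omega⟩
  have hspoke : ∀ i, W.γ (Vert.rim 0 i) ≤ 12 := fun i =>
    (hW 0 i (Or.inl (by simp))).2.trans (hA.le_twelve _)
  -- Compatibility already bounds spokes, hats and the fans over prescribed spokes by 12. Among the
  -- vertices of `W` only fans over the other spokes can change.
  let W' := W.truncate (by omega)
  have h12 : ∀ v, W'.γ v ≤ 12 := fun v => min_le_right _ _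
  have hclose : Cartwheel.Close W W' := by
    refine ⟨fun i => (min_eq_left (hspoke i)).symm, fun v => ?_⟩
    change W.γ v = min (W.γ v) 12 ∨ (12 ≤ W.γ v ∧ 12 ≤ min (W.γ v) 12)
    omega
  have hW' : W'.Compatible A := by
    intro j i hji
    obtain ⟨h1, h2⟩ := hW j i hji
    have h3 := hA.le (j, i)
    have h4 := hA.le_twelve (j, i)
    exact ⟨le_min h1 (h3.trans h4), (min_le_left _ _).trans h2⟩
  by_cases hgood : GoodAppears 𝒢 W
  · exact Or.inl hgood
  · right
    have hgood' : ¬ GoodAppears 𝒢 W' := fun hg =>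
      hgood (hclose.symm.goodAppears (fun K hK => (h𝒢 K hK).2) hg)
    -- Truncation preserves the charge, which can then be split among the spokes.
    rw [hclose.netCharge_eq hR' hβ hδ, netCharge_eq hR' hβ hδ hd W' h12]
    exact sum_spokeCharge_le hA hcap hW' h12 hgood'
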